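/- Consider $N\ge 1$ queues indexed by $\mathbb Z/N\mathbb Z$, each with unlimited waiting room and FIFO order. Customers arrive at each queue in batches; the batch epochs form independent Poisson processes of rate $\hat\lambda>0$, and the batch sizes are i.i.d. with mean $b\in(0,\infty)$ and second moment $b^{(2)}<\infty$. Let $\lambda=\hat\lambda b$ be the arrival rate of customers at each queue. A single server polls the queues. If the polled queue $i$ is non-empty, its head-of-line customer is served, and the next polling instant takes place at queue $i+d$ after a time $T$ (service plus switching), where $(d,T)$ has a given law with $P(d=k)=p_k$, $E[T]=\tau$, $E[T^2]=\tau^{(2)}<\infty$. If the polled queue $i$ is empty, the same holds with another given law, for which $P(d=k)=\tilde p_k$, $E[T]=\tilde\tau>0$, $E[T^2]=\tilde\tau^{(2)}<\infty$. These choices at successive polling instants are independent of each other and of the arrivals. Let $P=(p_{j-i})_{i,j}$ and $\tilde P=(\tilde p_{j-i})_{i,j}$ be the two circulant routing matrices, and put $$\mu_l=\sum_{d=1}^{N}p_d\,e^{2\pi\mathrm i\,ld/N},\qquad \tilde\mu_l=\sum_{d=1}^{N}\tilde p_d\,e^{2\pi\mathrm i\,ld/N},\qquad 1\le l\le N-1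 .$$ Assume that $\tilde P$ is irreducible and that $(I-P)(I-{}^t\tilde P)=(I-{}^tP)(I-\tilde P)$. Suppose that the system is in stationary regime, i.e. its states at the successive polling instants (polled queue, and the time already spent in queue by each waiting customer) form a stationary Markov chain. Then $N\lambda\tau<1$, a polled queue is non-empty with positive probability, and the waiting time $W$ of a customer (from its arrival to the start of its service; its law is that of the time spent in queue by the head-of-line customer of the polled queue at a polling instant, conditionally on this queue being non-empty) has the finite mean $$E[W]=\frac{\tilde\tau}{1-N\lambda\tau}\sum_{l=1}^{N-1}\frac1{1-\tilde\mu_l}+\frac{N\lambda\tau^{(2)}}{2(1-N\lambda\tau)}+\frac{\tilde\tau^{(2)}}{2\tilde\tau}+\frac{b^{(2)}-b}{2b}\left[\frac{\tau+(N-1)\tilde\tau}{1-N\lambda\tau}-\frac{\tilde\tau}{1-N\lambda\tau}\sum_{l=1}^{N-1}\frac{\mu_l-\tilde\mu_l}{1-\tilde\mu_l}\right].$$ -/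

import Mathlib

open MeasureTheory ProbabilityTheory
open scoped NNReal

namespace Polling

/-- Lists of reals are measured through their length and their entries. -/
instance instMeasurableSpaceListReal : MeasurableSpace (List ℝ) :=
  MeasurableSpace.comap (fun l : List ℝ => (l.length, fun i : ℕ => l.getD i 0)) inferInstance

/-- The data of a rotationally symmetric, state dependent, one-limited polling system with the
`N` queues `ZMod N` and batch Poisson arrivals.
* Batches arrive at each queue along independent Poisson processes of rate `batchRate`, with
  independent sizes distributed as `batchLaw`.
* When the server polls a non-empty queue `i`, it serves the head-of-line customer and next polls
  queue `i + d`, a time `t` after the present polling instant, where `(d, t)` has law `move`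
  (service and switching times are both contained in `t`, which may depend on `d`).
* When the server polls an empty queue `i`, the same holds with the law `moveEmpty`. -/
structure Model (N : ℕ) where
  batchRate : ℝ
  batchRate_pos : 0 < batchRate
  batchLaw : Measure ℕ
  batchLaw_prob : IsProbabilityMeasure batchLaw
  move : Measure (ZMod N × ℝ≥0)
  move_prob : IsProbabilityMeasure move
  moveEmpty : Measure (ZMod N × ℝ≥0)
  moveEmpty_prob : IsProbabilityMeasure moveEmpty

/-! ### Sample paths -/

/-- State at a polling instant: the polled queue and, for each queue, the list of its waiting
customers in order of arrival, each represented by the time spent in the queue so far. -/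
abbrev State (N : ℕ) : Type := ZMod N × (ZMod N → List ℝ)

/-- Randomness used between two successive polling instants: the displacement and duration to be
used if the polled queue is non-empty, those to be used if it is empty, and, for each queue `q` and
each `j : ℕ`, the gap before the `j`-th batch to come at `q` and the size of that batch. -/
abbrev Innovation (N : ℕ) : Type :=
  (ZMod N × ℝ≥0) × (ZMod N × ℝ≥0) × (ZMod N × ℕ → ℝ × ℕ)

/-- Epoch of the `j`-th batch, `j = 0, 1, …`: the sum of the first `j + 1` gaps. -/
def epoch (a : ℕ → ℝ × ℕ) (j : ℕ) : ℝ := ∑ i ∈ Finset.range (j + 1), (a i).1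

/-- Number of batches with epoch at most `t` (the gaps are positive). -/
noncomputable def batchCount (a : ℕ → ℝ × ℕ) (t : ℝ) : ℕ := sInf {n | t < epoch a n}

/-- The customers arrived in an interval of length `t`, in order of arrival, each represented by
the time elapsed from its arrival to the end of the interval. -/
noncomputable def arrivals (a : ℕ → ℝ × ℕ) (t : ℝ) : List ℝ :=
  (List.range (batchCount a t)).flatMap fun j => List.replicate (a j).2 (t - epoch a j)

/-- The state at the next polling instant. The head-of-line customer of the polled queue, if any,
is served and leaves its queue; all waiting customers get older; newly arrived customers join
the ends of the queues. -/
noncomputable def step {N : ℕ} (z : State N) (x : Innovation N) : State N :=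
  let m : ZMod N × ℝ≥0 := if (z.2 z.1).isEmpty then x.2.1 else x.1
  (z.1 + m.1, fun q =>
    ((if q = z.1 then (z.2 q).tail else z.2 q).map (fun age => age + (m.2 : ℝ)))
      ++ arrivals (fun j => x.2.2 (q, j)) (m.2 : ℝ))

/-- Law of an innovation: all components independent, gaps exponential of rate `batchRate`.
As Poisson processes are memoryless, the gaps may be drawn afresh at each polling instant. -/
noncomputable def Model.innovationLaw {N : ℕ} (M : Model N) : Measure (Innovation N) :=
  M.move.prod (M.moveEmpty.prod
    (Measure.infinitePi fun _ : ZMod N × ℕ => (expMeasure M.batchRate).prod M.batchLaw))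

/-- `Z n` is the state at the `n`-th polling instant of the system in stationary regime, driven by
the independent innovations `x n`. -/
structure IsStationaryRun {N : ℕ} {Ω : Type*} [MeasurableSpace Ω] (M : Model N) (Pr : Measure Ω)
    (Z : ℕ → Ω → State N) (x : ℕ → Ω → Innovation N) : Prop where
  measurable_init : Measurable (Z 0)
  measurable_innovation : ∀ n, Measurable (x n)
  innovation_law : ∀ n, Pr.map (x n) = M.innovationLaw
  innovation_indep : iIndepFun x Pr
  init_indep : IndepFun (Z 0) (fun ω n => x n ω) Pr
  evolution : ∀ n ω, Z (n + 1) ω = step (Z n ω) (x n ω)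
  stationary : ∀ n, Pr.map (Z n) = Pr.map (Z 0)

/-- A customer starts being served at this polling instant: the polled queue is non-empty. -/
def State.Serving {N : ℕ} (z : State N) : Prop := z.2 z.1 ≠ []

/-- The time from arrival to start of service of the customer who starts being served at this
polling instant (`0` if there is none). -/
def State.waitingTime {N : ℕ} (z : State N) : ℝ := (z.2 z.1).headD 0

/-- Law of the experiment as seen from a customer who starts being served at the `n`-th polling
instant. -/
noncomputable def servedLaw {N : ℕ} {Ω : Type*} [MeasurableSpace Ω] (Pr : Measure Ω)
    (Z : ℕ → Ω → State N) (n : ℕ) : Measure Ω :=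
  ProbabilityTheory.cond Pr {ω | State.Serving (Z n ω)}

/-! ### Parameters -/

namespace Model

variable {N : ℕ} (M : Model N)

/-- Mean batch size. -/
noncomputable def b : ℝ := ∫ k, (k : ℝ) ∂M.batchLaw

/-- Second moment of the batch size. -/
noncomputable def b2 : ℝ := ∫ k, (k : ℝ) ^ 2 ∂M.batchLaw

/-- Arrival rate of customers at each queue. -/
noncomputable def rate : ℝ := M.batchRate * M.b

/-- Mean time between two polling instants, when the first finds a non-empty queue. -/
noncomputable def tau : ℝ := ∫ y, (y.2 : ℝ) ∂M.move

/-- Second moment of the time between two polling instants, when the first finds a non-empty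
queue. -/
noncomputable def tau2 : ℝ := ∫ y, (y.2 : ℝ) ^ 2 ∂M.move

/-- Mean time between two polling instants, when the first finds an empty queue. -/
noncomputable def tauEmpty : ℝ := ∫ y, (y.2 : ℝ) ∂M.moveEmpty

/-- Second moment of the time between two polling instants, when the first finds an empty
queue. -/
noncomputable def tauEmpty2 : ℝ := ∫ y, (y.2 : ℝ) ^ 2 ∂M.moveEmpty

/-- Probability of the displacement `d` after polling a non-empty queue. -/
noncomputable def p (d : ZMod N) : ℝ := M.move.real {y | y.1 = d}

/-- Probability of the displacement `d` after polling an empty queue. -/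
noncomputable def pEmpty (d : ZMod N) : ℝ := M.moveEmpty.real {y | y.1 = d}

/-- Routing matrix used after polling a non-empty queue. -/
noncomputable def P : Matrix (ZMod N) (ZMod N) ℝ := Matrix.of fun i j => M.p (j - i)

/-- Routing matrix used after polling an empty queue. -/
noncomputable def PEmpty : Matrix (ZMod N) (ZMod N) ℝ := Matrix.of fun i j => M.pEmpty (j - i)

/-- The eigenvalue `∑ d, p d * exp (2 π i l d / N)` of the circulant matrix `P`. -/
noncomputable def mu [NeZero N] (l : ℕ) : ℂ :=
  ∑ d : ZMod N, (M.p d : ℂ) * Complex.exp (2 * Real.pi * Complex.I * l * (d.val : ℂ) / N)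

/-- The eigenvalue `∑ d, pEmpty d * exp (2 π i l d / N)` of the circulant matrix `PEmpty`. -/
noncomputable def muEmpty [NeZero N] (l : ℕ) : ℂ :=
  ∑ d : ZMod N, (M.pEmpty d : ℂ) * Complex.exp (2 * Real.pi * Complex.I * l * (d.val : ℂ) / N)

end Model

end Polling

/-!
The mean waiting time of a rotationally symmetric one-limited polling system with a mirror
symmetry is found from three balance equations for the stationary chain embedded at the polling
instants: those of the number of customers, of a quadratic potential, and of the total age of the
customers.

**The potential.** With the server at `i` and queue lengths `Q`, put
`V = 1/2 ∑ q, q', g (q' - q) Q q Q q' + ∑ q, f (q - i) Q q`. The function `f` is chosen so that its drift under a displacement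
from an empty queue is `-τ̃` outside the polled queue (Poisson equation of the walk of the server
among empty queues, solvable since that walk is irreducible), and `g` is `τ` plus the drift of `f`
under a displacement from a non-empty queue. At a non-empty queue `i` the departure of a customer
contributes `-g (q - i) Q q`, which the displacement turns into `-τ Q q`; the arrivals contribute
the same multiple of every `Q q`. Hence the mean increment of `V` depends on the queue lengths
through their sum only: it is `-(1 - N λ τ) E[T] ∑ q, Q q` plus a constant, where `E[T]` is the
mean duration of the step at hand (`hasMean_potentialIncrement`). This computation requires `g` to
be even. In Fourier variables `f` has the coefficients `-τ̃ / (1 - μ̃ l)` and `g - τ` the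
coefficients `τ̃ (1 - μ l) / (1 - μ̃ l)`, and the mirror condition says that the latter are real;
being real ratios of numbers with nonnegative real parts, they are even nonnegative
(`exists_potential`). The values `f 0` and `g 0` are the source of the two sums over `l` in the
formula for the mean waiting time.

**Stability.** No moment of the stationary queue lengths is known beforehand. Integrable
increments of a function of a stationary process have mean zero even if the function is not
integrable (`integral_sub_eq_zero`). Applied to the number of customers, this is `flow_balance`,
which determines the probability that the polled queue is non-empty. That probability is not `1`,
as one sees from the generating function of the number of customers (`integral_served_ne_one`),
and `stability` follows.

**Finite means.** A nonnegative function of a stationary process does not decrease in the mean on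
its sublevel sets (`setIntegral_sub_nonneg`). If a small `ε > 0` is added to the kernel `g`, the
potential becomes coercive, because `g - τ` is positive semidefinite (`le_potential`), and its
drift remains negative; therefore the mean number of customers is finite (`integrable_total`). The
potential with `ε = 0` then has integrable increments, and their mean being zero is
`potential_balance`.

**Little's formula.** The total age of the waiting customers increases by the time integral of
their number and drops by the waiting time of the customer served. Its balance gives the mean
waiting time in terms of the mean number of customers (`waitingTime_balance`). The three balance
equations are solved in `mean_waitingTime_eq`.

All means over one step reduce to the first two moments of the number of customers arriving in a
batch Poisson stream during a given time, and to the mean of their total age. These are computed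
from the densities of the epochs (`lintegral_tsum_epoch`, `lintegral_tsum_sum_epoch`).
-/

namespace Polling

/-! ### Fourier analysis of circulant routing -/

section Fourier

variable {N : ℕ} [NeZero N]

/-- The Fourier transform `∑ d, p d * exp (2 π i l d / N)` of a real vector indexed by `ZMod N`. -/
noncomputable def fourier (p : ZMod N → ℝ) (l : ZMod N) : ℂ :=
  ∑ d, (p d : ℂ) * ZMod.stdAddChar (l * d)

lemma conj_stdAddChar (s : ZMod N) :
    (starRingEnd ℂ) (ZMod.stdAddChar s) = ZMod.stdAddChar (-s) := by
  rw [AddChar.map_neg_eq_conj]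

lemma conj_fourier (p : ZMod N → ℝ) (l : ZMod N) :
    (starRingEnd ℂ) (fourier p l) = fourier p (-l) := by
  simp only [fourier, map_sum, map_mul, Complex.conj_ofReal, conj_stdAddChar, neg_mul]

lemma fourier_zero (p : ZMod N → ℝ) (hp : ∑ d, p d = 1) : fourier p 0 = 1 := by
  simp only [fourier, zero_mul, AddChar.map_zero_eq_one, mul_one]
  exact_mod_cast hp

lemma fourier_natCast (p : ZMod N → ℝ) (l : ℕ) :
    fourier p (l : ZMod N) = ∑ d : ZMod N, (p d : ℂ) *
      Complex.exp (2 * Real.pi * Complex.I * l * (d.val : ℂ) / N) := by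
  unfold fourier
  refine Finset.sum_congr rfl fun d _ => ?_
  have h : (l : ZMod N) * d = (((l * d.val : ℕ) : ℤ) : ZMod N) := by
    push_cast
    rw [ZMod.natCast_zmod_val]
  rw [h, ZMod.stdAddChar_coe]
  push_cast
  congr 2
  ring

/-- A character is an eigenvector of convolution with `p`. -/
lemma sum_mul_char_sub (p : ZMod N → ℝ) (l s : ZMod N) :
    ∑ d, (p d : ℂ) * ZMod.stdAddChar (-(l * (s - d))) =
      ZMod.stdAddChar (-(l * s)) * fourier p l := by
  rw [fourier, Finset.mul_sum]
  refine Finset.sum_congr rfl fun d _ => ?_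
  rw [show -(l * (s - d)) = -(l * s) + l * d by ring, AddChar.map_add_eq_mul]
  ring

lemma norm_stdAddChar (s : ZMod N) : ‖(ZMod.stdAddChar s : ℂ)‖ = 1 := by
  rw [ZMod.stdAddChar_apply]; exact Circle.norm_coe _

lemma re_stdAddChar_le (s : ZMod N) : (ZMod.stdAddChar s : ℂ).re ≤ 1 :=
  (Complex.re_le_norm _).trans (norm_stdAddChar s).le

lemma re_fourier_le (p : ZMod N → ℝ) (hp0 : ∀ d, 0 ≤ p d) (hp : ∑ d, p d = 1) (l : ZMod N) :
    (fourier p l).re ≤ 1 := by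
  rw [fourier, Complex.re_sum, ← hp]
  refine Finset.sum_le_sum fun d _ => ?_
  rw [Complex.re_ofReal_mul]
  exact mul_le_of_le_one_right (hp0 d) (re_stdAddChar_le _)

lemma stdAddChar_eq_one_of_re {s : ZMod N} (h : (ZMod.stdAddChar s : ℂ).re = 1) : s = 0 := by
  have h1 : (ZMod.stdAddChar s : ℂ) = 1 := by
    have hn := norm_stdAddChar s
    have h2 : Complex.normSq (ZMod.stdAddChar s : ℂ) = 1 := by
      rw [Complex.normSq_eq_norm_sq, hn]; norm_num
    rw [Complex.normSq_apply, h] at h2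
    apply Complex.ext
    · simpa using h
    · simp only [Complex.one_im]; nlinarith
  apply ZMod.injective_stdAddChar
  rw [h1, AddChar.map_zero_eq_one]

/-- Irreducibility of the circulant matrix means that only the constant character has
eigenvalue `1`; for the others `Re (1 - fourier p l) > 0`. -/
lemma re_fourier_lt (p : ZMod N → ℝ) (hp : ∑ d, p d = 1)
    (hirr : (Matrix.of fun i j : ZMod N => p (j - i)).IsIrreducible) {l : ZMod N} (hl : l ≠ 0) :
    (fourier p l).re < 1 := by
  have hp0 : ∀ d, 0 ≤ p d := fun d => by simpa using hirr.nonneg 0 d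
  refine lt_of_le_of_ne (re_fourier_le p hp0 hp l) fun h => hl ?_
  have hterm : ∀ d, 0 < p d → l * d = 0 := by
    rw [fourier, Complex.re_sum, ← hp] at h
    have h' := (Finset.sum_eq_sum_iff_of_le (fun d _ => by
      rw [Complex.re_ofReal_mul]
      exact mul_le_of_le_one_right (hp0 d) (re_stdAddChar_le _))).1 h
    intro d hd
    have := h' d (Finset.mem_univ d)
    rw [Complex.re_ofReal_mul] at this
    exact stdAddChar_eq_one_of_re (mul_left_cancel₀ hd.ne' (by rw [this, mul_one]))
  let _ := Matrix.toQuiver (Matrix.of fun i j : ZMod N => p (j - i))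
  have hpath : ∀ i j : ZMod N, Quiver.Path i j → l * i = l * j := by
    intro i j w
    induction w with
    | nil => rfl
    | cons w e ih =>
      have := hterm _ e.down
      rw [mul_sub, sub_eq_zero] at this
      rw [ih, this]
  obtain ⟨w, -⟩ := hirr.connected 0 1
  have := hpath _ _ w
  rw [mul_zero, mul_one] at this
  exact this.symm

/-- The mirror condition on circulant matrices, read on a common eigenvector. -/
lemma fourier_mirror (p p' : ZMod N → ℝ)
    (h : (1 - Matrix.of fun i j : ZMod N => p (j - i)) *
        (1 - Matrix.of fun i j : ZMod N => p' (j - i)).transpose =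
      (1 - Matrix.of fun i j : ZMod N => p (j - i)).transpose *
        (1 - Matrix.of fun i j : ZMod N => p' (j - i))) (l : ZMod N) :
    (1 - fourier p l) * (1 - (starRingEnd ℂ) (fourier p' l)) =
      (1 - (starRingEnd ℂ) (fourier p l)) * (1 - fourier p' l) := by
  have key : ∀ (q : ZMod N → ℝ),
      (((1 - Matrix.of fun i j : ZMod N => q (j - i)).map (algebraMap ℝ ℂ)).mulVec
        fun j => ZMod.stdAddChar (l * j)) =
        (1 - fourier q l) • fun j => ZMod.stdAddChar (l * j) := by
    intro q
    rw [Matrix.map_sub _ (map_sub _), Matrix.map_one _ (map_zero _) (map_one _), Matrix.sub_mulVec,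
      Matrix.one_mulVec]
    ext i
    simp only [Pi.sub_apply, Pi.smul_apply, smul_eq_mul, sub_mul, one_mul, Matrix.mulVec,
      dotProduct, Matrix.map_apply, Matrix.of_apply, fourier]
    congr 1
    rw [Finset.sum_mul]
    refine Fintype.sum_equiv (Equiv.subRight i) _ _ fun j => ?_
    simp only [Equiv.subRight_apply, Complex.coe_algebraMap]
    rw [mul_assoc, ← AddChar.map_add_eq_mul]
    congr 2; ring
  have key' : ∀ (q : ZMod N → ℝ),
      (((1 - Matrix.of fun i j : ZMod N => q (j - i)).transpose.map (algebraMap ℝ ℂ)).mulVec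
        fun j => ZMod.stdAddChar (l * j)) =
        (1 - (starRingEnd ℂ) (fourier q l)) • fun j => ZMod.stdAddChar (l * j) := by
    intro q
    rw [Matrix.transpose_sub, Matrix.transpose_one,
      Matrix.map_sub _ (map_sub _), Matrix.map_one _ (map_zero _) (map_one _), Matrix.sub_mulVec,
      Matrix.one_mulVec, conj_fourier]
    ext i
    simp only [Pi.sub_apply, Pi.smul_apply, smul_eq_mul, sub_mul, one_mul, Matrix.mulVec,
      dotProduct, Matrix.map_apply, Matrix.of_apply, fourier, Matrix.transpose_apply]
    congr 1
    rw [Finset.sum_mul]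
    refine Fintype.sum_equiv (Equiv.subLeft i) _ _ fun j => ?_
    simp only [Equiv.subLeft_apply, Complex.coe_algebraMap]
    rw [mul_assoc, ← AddChar.map_add_eq_mul]
    congr 2; ring
  have h2 := congrArg (fun A : Matrix (ZMod N) (ZMod N) ℝ =>
    (A.map (algebraMap ℝ ℂ)).mulVec fun j => (ZMod.stdAddChar (l * j) : ℂ)) h
  simp only [Matrix.map_mul, ← Matrix.mulVec_mulVec] at h2
  rw [key, key', Matrix.mulVec_smul, Matrix.mulVec_smul, key, key'] at h2
  have h3 := congrFun h2 0
  simp only [Pi.smul_apply, smul_eq_mul, mul_zero, AddChar.map_zero_eq_one, mul_one] at h3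
  linear_combination h3

lemma sum_char_neg_mul (s : ZMod N) :
    ∑ l : ZMod N, (ZMod.stdAddChar (-(l * s)) : ℂ) = if s = 0 then (N : ℂ) else 0 := by
  have := AddChar.sum_mulShift (ψ := (ZMod.stdAddChar : AddChar (ZMod N) ℂ)) (-s)
    (ZMod.isPrimitive_stdAddChar N)
  simp only [mul_neg, neg_eq_zero, ZMod.card] at this
  rw [this]
  push_cast
  rfl

lemma sum_natCast_Ico (F : ZMod N → ℂ) (h0 : F 0 = 0) :
    ∑ l, F l = ∑ l ∈ Finset.Ico 1 N, F (l : ZMod N) := by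
  have h1 : ∑ l, F l = ∑ l ∈ Finset.range N, F (l : ZMod N) := by
    symm
    refine Finset.sum_bij (fun l _ => (l : ZMod N)) (fun _ _ => Finset.mem_univ _) ?_ ?_ ?_
    · intro a ha b hb hab
      have := congrArg ZMod.val hab
      rwa [ZMod.val_cast_of_lt (Finset.mem_range.1 ha), ZMod.val_cast_of_lt (Finset.mem_range.1 hb)]
        at this
    · intro b _
      exact ⟨b.val, Finset.mem_range.2 (ZMod.val_lt b), ZMod.natCast_zmod_val b⟩
    · intros; rfl
  rw [h1, Finset.range_eq_Ico, Finset.sum_eq_sum_Ico_succ_bot (NeZero.pos N)]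
  simp [h0]

/-- The function `f` solves the Poisson equation of the walk of the server among empty queues, and
`g - τ` is the drift of `f` under the walk among non-empty queues. The mirror condition makes `g`
even; its Fourier coefficients, real ratios of numbers with nonnegative real parts, are
nonnegative, so that `g - τ` is a positive semidefinite kernel. -/
theorem exists_potential (p p' : ZMod N → ℝ) (hp0 : ∀ d, 0 ≤ p d) (hp : ∑ d, p d = 1)
    (hp' : ∑ d, p' d = 1)
    (hirr : (Matrix.of fun i j : ZMod N => p' (j - i)).IsIrreducible)
    (h : (1 - Matrix.of fun i j : ZMod N => p (j - i)) *
        (1 - Matrix.of fun i j : ZMod N => p' (j - i)).transpose =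
      (1 - Matrix.of fun i j : ZMod N => p (j - i)).transpose *
        (1 - Matrix.of fun i j : ZMod N => p' (j - i))) (τ τ' : ℝ) (hτ' : 0 ≤ τ') :
    ∃ f g : ZMod N → ℝ,
      (∀ s, ∑ d, p' d * f (s - d) - f s = τ' * (if s = 0 then (N : ℝ) else 0) - τ') ∧
      (∀ s, g s = τ + (∑ d, p d * f (s - d) - f s)) ∧
      (∀ s, g (-s) = g s) ∧ ∑ s, f s = 0 ∧
      (∀ Q : ZMod N → ℝ, 0 ≤ ∑ q, ∑ q', (g (q' - q) - τ) * (Q q * Q q')) ∧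
      (f 0 : ℂ) = -(τ' * ∑ l ∈ Finset.Ico 1 N, 1 / (1 - fourier p' (l : ZMod N))) ∧
      (g 0 : ℂ) = τ + (N - 1) * τ' - τ' * ∑ l ∈ Finset.Ico 1 N,
        (fourier p (l : ZMod N) - fourier p' (l : ZMod N)) / (1 - fourier p' (l : ZMod N)) := by
  have hne : ∀ l : ZMod N, l ≠ 0 → 1 - fourier p' l ≠ 0 := fun l hl h0 => by
    have := re_fourier_lt p' hp' hirr hl
    have h1 := congrArg Complex.re h0
    simp at h1; linarith
  have hz : 1 - fourier p' (0 : ZMod N) = 0 := by rw [fourier_zero p' hp', sub_self]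
  -- At `l = 0` the coefficient `w` is `0⁻¹ = 0`, which normalises `f` to have sum zero.
  set w : ZMod N → ℂ := fun l => (1 - fourier p' l)⁻¹ with hw
  have hw0 : w 0 = 0 := by simp only [hw, hz, inv_zero]
  have hwc : ∀ l, (starRingEnd ℂ) (w l) = w (-l) := fun l => by
    simp only [hw, map_inv₀, map_sub, map_one, conj_fourier]
  set F : ZMod N → ℂ := fun s => -(τ' * ∑ l, ZMod.stdAddChar (-(l * s)) * w l) with hF
  have hFc : ∀ s, (starRingEnd ℂ) (F s) = F s := fun s => by
    simp only [hF, map_neg, map_mul, Complex.conj_ofReal, map_sum, hwc, conj_stdAddChar]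
    congr 2
    refine Fintype.sum_equiv (Equiv.neg _) _ _ fun l => ?_
    simp
  set f : ZMod N → ℝ := fun s => (F s).re with hf
  have hfF : ∀ s, (f s : ℂ) = F s := fun s => Complex.conj_eq_iff_re.1 (hFc s)
  have hconv : ∀ (q : ZMod N → ℝ) s, ((∑ d, q d * f (s - d) - f s : ℝ) : ℂ) =
      τ' * ∑ l, ZMod.stdAddChar (-(l * s)) * ((1 - fourier q l) * w l) := by
    intro q s
    push_cast
    simp only [hfF]
    have : ∑ d, (q d : ℂ) * F (s - d) =
        -(τ' * ∑ l, (ZMod.stdAddChar (-(l * s)) * fourier q l) * w l) := by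
      simp only [hF, ← sum_mul_char_sub, mul_neg, Finset.sum_neg_distrib, Finset.mul_sum,
        Finset.sum_mul]
      rw [Finset.sum_comm]
      congr 1
      refine Finset.sum_congr rfl fun d _ => Finset.sum_congr rfl fun l _ => ?_
      ring
    rw [this]
    simp only [hF]
    rw [neg_sub_neg, ← mul_sub, ← Finset.sum_sub_distrib]
    congr 1
    refine Finset.sum_congr rfl fun l _ => ?_
    ring
  set t : ZMod N → ℂ := fun l => (1 - fourier p l) * w l with ht
  -- The mirror condition says precisely that the ratios `t l` are real.
  have htc : ∀ l, (starRingEnd ℂ) (t l) = t l := by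
    intro l
    by_cases hl : l = 0
    · simp [ht, hl, hw0]
    have hm := fourier_mirror p p' h l
    have h1 := hne l hl
    have h2 : 1 - (starRingEnd ℂ) (fourier p' l) ≠ 0 := by
      rw [← map_one (starRingEnd ℂ), ← map_sub]
      exact (map_ne_zero _).2 h1
    simp only [ht, hw, map_mul, map_inv₀, map_sub, map_one]
    field_simp
    linear_combination -hm
  have htre : ∀ l, t l = ((t l).re : ℂ) := fun l => (Complex.conj_eq_iff_re.1 (htc l)).symm
  -- A real ratio of two numbers with nonnegative real parts is nonnegative.
  have htnn : ∀ l, 0 ≤ (t l).re := by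
    intro l
    by_cases hl : l = 0
    · simp [ht, hl, hw0]
    have h1 : 1 - fourier p l = ((t l).re : ℂ) * (1 - fourier p' l) := by
      rw [← htre l]
      simp only [ht, hw]
      rw [mul_assoc, inv_mul_cancel₀ (hne l hl), mul_one]
    have h2 := congrArg Complex.re h1
    rw [Complex.re_ofReal_mul] at h2
    simp only [Complex.sub_re, Complex.one_re] at h2
    have h3 := re_fourier_le p hp0 hp l
    have h4 := re_fourier_lt p' hp' hirr hl
    by_contra hneg
    push Not at hneg
    nlinarith
  refine ⟨f, fun s => τ + (∑ d, p d * f (s - d) - f s), ?_, fun _ => rfl, ?_, ?_, ?_, ?_, ?_⟩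
  · intro s
    apply Complex.ofReal_injective
    rw [hconv]
    have : ∀ l, ZMod.stdAddChar (-(l * s)) * ((1 - fourier p' l) * w l) =
        ZMod.stdAddChar (-(l * s)) - if l = 0 then 1 else 0 := by
      intro l
      by_cases hl : l = 0
      · simp [hl, hw0]
      · simp only [hw, mul_inv_cancel₀ (hne l hl), hl, if_false]; ring
    simp only [this, Finset.sum_sub_distrib, sum_char_neg_mul]
    simp
    split_ifs
    · simp; ring
    · simp
  · intro s
    simp only [add_right_inj]
    apply Complex.ofReal_injective
    rw [← Complex.conj_ofReal, hconv, hconv]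
    simp only [map_mul, map_sum, Complex.conj_ofReal, conj_stdAddChar]
    congr 1
    refine Finset.sum_congr rfl fun l _ => ?_
    rw [← map_mul, htc]
    simp [ht]
  · apply Complex.ofReal_injective
    push_cast
    simp only [hfF, hF, Finset.sum_neg_distrib, ← Finset.mul_sum]
    rw [Finset.sum_comm]
    have : ∀ l, ∑ s, ZMod.stdAddChar (-(l * s)) * w l = 0 := by
      intro l
      rw [← Finset.sum_mul]
      have := sum_char_neg_mul l
      simp only [mul_comm _ l] at this
      rw [this]
      split_ifs with hl
      · rw [hl, hw0, mul_zero]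
      · rw [zero_mul]
    simp [this]
  · intro Q
    -- The quadratic form is diagonal in the Fourier basis, with the coefficients `t l`.
    have key : ((∑ q, ∑ q', (τ + (∑ d, p d * f (q' - q - d) - f (q' - q)) - τ) * (Q q * Q q') : ℝ)
        : ℂ) = ((τ' * ∑ l, (t l).re * Complex.normSq (∑ q, ZMod.stdAddChar (l * q) * (Q q : ℂ))
          : ℝ) : ℂ) := by
      simp only [add_sub_cancel_left]
      rw [Complex.ofReal_sum]
      simp only [Complex.ofReal_sum, Complex.ofReal_mul, hconv, ← Complex.mul_conj,
        ← htre, map_sum, map_mul, Complex.conj_ofReal, conj_stdAddChar]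
      simp only [Finset.mul_sum, Finset.sum_mul]
      calc _ = ∑ q, ∑ l, ∑ q', τ' * (ZMod.stdAddChar (-(l * (q' - q))) * t l) * (Q q * Q q') := by
            refine Finset.sum_congr rfl fun q _ => ?_
            rw [Finset.sum_comm]
        _ = ∑ l, ∑ q, ∑ q', τ' * (ZMod.stdAddChar (-(l * (q' - q))) * t l) * (Q q * Q q') :=
            Finset.sum_comm
        _ = _ := by
            refine Finset.sum_congr rfl fun l _ => ?_
            rw [Finset.sum_comm]
            refine Finset.sum_congr rfl fun q' _ => Finset.sum_congr rfl fun q _ => ?_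
            rw [show -(l * (q' - q)) = l * q + -(l * q') by ring, AddChar.map_add_eq_mul]
            ring
    have key' := Complex.ofReal_injective key
    rw [key']
    exact mul_nonneg hτ' (Finset.sum_nonneg fun l _ =>
      mul_nonneg (htnn l) (Complex.normSq_nonneg _))
  · rw [hfF]
    simp only [hF, mul_zero, neg_zero, AddChar.map_zero_eq_one, one_mul]
    rw [sum_natCast_Ico w hw0]
    simp [hw]
  · rw [Complex.ofReal_add, hconv]
    simp only [mul_zero, neg_zero, AddChar.map_zero_eq_one, one_mul]
    rw [sum_natCast_Ico (fun l => (1 - fourier p l) * w l) (by simp [hw0]), add_sub_assoc]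
    congr 1
    have h1 : ((N : ℂ) - 1) = ∑ l ∈ Finset.Ico 1 N, (1 : ℂ) := by
      have := NeZero.pos N
      rw [Finset.sum_const, Nat.card_Ico, nsmul_eq_mul, mul_one, Nat.cast_sub this, Nat.cast_one]
    rw [h1, mul_comm _ (τ' : ℂ), ← mul_sub, ← Finset.sum_sub_distrib]
    congr 1
    refine Finset.sum_congr rfl fun l hl => ?_
    have hl0 : ((l : ℕ) : ZMod N) ≠ 0 := by
      intro h0
      have := (ZMod.natCast_eq_zero_iff _ _).1 h0
      rw [Finset.mem_Ico] at hl
      exact absurd (Nat.le_of_dvd (by omega) this) (by omega)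
    have := hne _ hl0
    simp only [hw]
    field_simp
    ring

end Fourier

/-! ### Epochs of a Poisson stream -/

section Stream

open scoped ENNReal

/-- Density of the epoch of the `k`-th batch, a sum of `k + 1` independent exponential gaps. -/
noncomputable def epochDensity (r : ℝ) (k : ℕ) (x : ℝ) : ℝ :=
  r ^ (k + 1) * x ^ k / (k.factorial : ℝ) * Real.exp (-(r * x))

@[fun_prop]
lemma measurable_epochDensity (r : ℝ) (k : ℕ) : Measurable (epochDensity r k) := by
  unfold epochDensity; fun_prop

lemma epochDensity_nonneg {r : ℝ} (hr : 0 < r) (k : ℕ) {x : ℝ} (hx : 0 ≤ x) :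
    0 ≤ epochDensity r k x := by
  unfold epochDensity; positivity

lemma lintegral_expMeasure {r : ℝ} {h : ℝ → ℝ≥0∞} (hh : Measurable h) :
    ∫⁻ x, h x ∂(expMeasure r) = ∫⁻ x in Set.Ioi 0, ENNReal.ofReal (epochDensity r 0 x) * h x := by
  unfold expMeasure gammaMeasure
  have hm : Measurable (gammaPDF 1 r) := (measurable_gammaPDFReal 1 r).ennreal_ofReal
  rw [lintegral_withDensity_eq_lintegral_mul _ hm hh, setLIntegral_congr Ioi_ae_eq_Ici,
    ← lintegral_indicator measurableSet_Ici]
  refine lintegral_congr fun x => ?_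
  simp only [Pi.mul_apply, Set.indicator_apply, Set.mem_Ici]
  split_ifs with hx
  · rw [gammaPDF_of_nonneg hx]
    simp [epochDensity]
  · rw [gammaPDF_of_neg (not_le.1 hx), zero_mul]

/-- The convolution of the density of the `k`-th epoch with the density of a gap. -/
lemma lintegral_epochDensity_succ {r : ℝ} (hr : 0 < r) (k : ℕ) {h : ℝ → ℝ≥0∞} (hh : Measurable h) :
    ∫⁻ x in Set.Ioi 0, ENNReal.ofReal (epochDensity r k x) *
        ∫⁻ y in Set.Ioi 0, ENNReal.ofReal (epochDensity r 0 y) * h (x + y) =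
      ∫⁻ z in Set.Ioi 0, ENNReal.ofReal (epochDensity r (k + 1) z) * h z := by
  have hd := fun j => (measurable_epochDensity r j).ennreal_ofReal
  have h1 : ∀ x : ℝ, ∫⁻ y in Set.Ioi 0, ENNReal.ofReal (epochDensity r 0 y) * h (x + y) =
      ∫⁻ z, (Set.Ioi x).indicator
        (fun z => ENNReal.ofReal (epochDensity r 0 (z - x)) * h z) z := by
    intro x
    rw [← lintegral_indicator measurableSet_Ioi,
      ← lintegral_add_left_eq_self (fun z => (Set.Ioi x).indicator _ z) x]
    refine lintegral_congr fun y => ?_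
    simp only [Set.indicator_apply, Set.mem_Ioi, lt_add_iff_pos_right, add_sub_cancel_left]
  have h2 : ∀ x z : ℝ, (Set.Ioi x).indicator
      (fun z => ENNReal.ofReal (epochDensity r 0 (z - x)) * h z) z =
      if x < z then ENNReal.ofReal (epochDensity r 0 (z - x)) * h z else 0 := by
    intro x z; simp only [Set.indicator_apply, Set.mem_Ioi]
  have hmeas : Measurable (fun p : ℝ × ℝ => if p.1 < p.2 then
      ENNReal.ofReal (epochDensity r 0 (p.2 - p.1)) * h p.2 else 0) :=
    Measurable.ite (measurableSet_lt measurable_fst measurable_snd)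
      (((hd 0).comp (measurable_snd.sub measurable_fst)).mul (hh.comp measurable_snd))
      measurable_const
  simp only [h1, h2]
  have h3 : ∀ x : ℝ, ENNReal.ofReal (epochDensity r k x) *
      (∫⁻ z, if x < z then ENNReal.ofReal (epochDensity r 0 (z - x)) * h z else 0) =
      ∫⁻ z, ENNReal.ofReal (epochDensity r k x) *
        (if x < z then ENNReal.ofReal (epochDensity r 0 (z - x)) * h z else 0) := fun x =>
    (lintegral_const_mul _ (hmeas.comp measurable_prodMk_left)).symm
  simp only [h3]
  rw [lintegral_lintegral_swap]
  swap
  · exact (((hd k).comp measurable_fst).mul hmeas).aemeasurable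
  rw [← lintegral_indicator measurableSet_Ioi]
  refine lintegral_congr fun z => ?_
  have h4 : ∀ x, ENNReal.ofReal (epochDensity r k x) *
        (if x < z then ENNReal.ofReal (epochDensity r 0 (z - x)) * h z else 0) =
      h z * (Set.Iio z).indicator (fun x => ENNReal.ofReal (epochDensity r k x) *
        ENNReal.ofReal (epochDensity r 0 (z - x))) x := by
    intro x
    simp only [Set.indicator_apply, Set.mem_Iio]
    split_ifs <;> ring
  simp only [h4]
  rw [lintegral_const_mul _ (by
    refine Measurable.indicator ?_ measurableSet_Iio
    exact (hd k).mul ((hd 0).comp (measurable_const.sub measurable_id))),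
    setLIntegral_indicator measurableSet_Iio, Set.inter_comm, Set.Ioi_inter_Iio]
  simp only [Set.indicator_apply, Set.mem_Ioi]
  split_ifs with hz
  · rw [mul_comm]
    congr 1
    rw [setLIntegral_congr Ioo_ae_eq_Ioc]
    have h5 : ∀ x ∈ Set.Ioc 0 z, ENNReal.ofReal (epochDensity r k x) *
        ENNReal.ofReal (epochDensity r 0 (z - x)) =
        ENNReal.ofReal (r ^ (k + 2) / (k.factorial : ℝ) * Real.exp (-(r * z)) * x ^ k) := by
      intro x hx
      rw [← ENNReal.ofReal_mul (epochDensity_nonneg hr k hx.1.le)]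
      congr 1
      have : Real.exp (-(r * z)) = Real.exp (-(r * x)) * Real.exp (-(r * (z - x))) := by
        rw [← Real.exp_add]; congr 1; ring
      simp only [epochDensity, this, pow_zero, Nat.factorial_zero]
      push_cast
      ring
    rw [setLIntegral_congr_fun measurableSet_Ioc h5, ← ofReal_integral_eq_lintegral_ofReal,
      ← intervalIntegral.integral_of_le hz.le, intervalIntegral.integral_const_mul, integral_pow]
    · congr 1
      simp only [epochDensity, Nat.factorial_succ]
      push_cast
      have : (k.factorial : ℝ) ≠ 0 := by positivity
      field_simp
      simp
    · exact (Continuous.integrableOn_Ioc (by fun_prop))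
    · filter_upwards [ae_restrict_mem measurableSet_Ioc] with x hx
      have := hx.1.le
      simp only [Pi.zero_apply]
      positivity
  · rw [Set.Ioo_eq_empty hz]; simp

/-- The epochs of a Poisson process have constant intensity. -/
lemma hasSum_epochDensity (r x : ℝ) : HasSum (fun k => epochDensity r k x) r := by
  have h := NormedSpace.expSeries_div_hasSum_exp (r * x)
  rw [← Real.exp_eq_exp_ℝ] at h
  have h2 := (h.mul_left r).mul_right (Real.exp (-(r * x)))
  rw [mul_assoc, ← Real.exp_add, add_neg_cancel, Real.exp_zero, mul_one] at h2
  refine h2.congr_fun fun k => ?_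
  simp only [epochDensity]
  rw [mul_pow]
  ring

lemma hasSum_mul_epochDensity (r x : ℝ) :
    HasSum (fun k : ℕ => (k : ℝ) * epochDensity r k x) (r ^ 2 * x) := by
  have h := (hasSum_nat_add_iff (f := fun k : ℕ => (k : ℝ) * epochDensity r k x)
    (g := r * x * r) 1).1 (((hasSum_epochDensity r x).mul_left (r * x)).congr_fun fun k => by
      simp only [epochDensity, Nat.factorial_succ]
      have : (k.factorial : ℝ) ≠ 0 := by positivity
      push_cast
      field_simp
      ring)
  simp only [Finset.range_one, Finset.sum_singleton, Nat.cast_zero, zero_mul, add_zero] at h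
  rwa [show r ^ 2 * x = r * x * r by ring]

lemma isProbabilityMeasure_exp_prod {r : ℝ} (hr : 0 < r) (β : Measure ℕ) [IsProbabilityMeasure β] :
    IsProbabilityMeasure ((expMeasure r).prod β) := by
  have := isProbabilityMeasure_expMeasure hr
  infer_instance

/-- The law of the stream of batches at one queue: independent gaps, exponential of rate `r`, and
independent sizes of law `β`. -/
noncomputable def streamLaw (r : ℝ) (β : Measure ℕ) : Measure (ℕ → ℝ × ℕ) :=
  Measure.infinitePi fun _ => (expMeasure r).prod β

lemma isProbabilityMeasure_streamLaw {r : ℝ} (hr : 0 < r) (β : Measure ℕ)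
    [IsProbabilityMeasure β] : IsProbabilityMeasure (streamLaw r β) := by
  have := isProbabilityMeasure_exp_prod hr β
  unfold streamLaw
  infer_instance

lemma measurable_epoch (k : ℕ) : Measurable (fun a : ℕ → ℝ × ℕ => epoch a k) := by
  unfold epoch
  fun_prop

/-- An epoch is independent of the batch sizes, and the sizes are independent of each other: the
mean of a function of the `k`-th epoch, weighted by functions of the sizes of the first `k + 1`
batches, is a product. -/
lemma lintegral_prod_eval_epoch {r : ℝ} (hr : 0 < r) (β : Measure ℕ) [IsProbabilityMeasure β]
    (w : ℕ → ℕ → ℝ≥0∞) (k : ℕ) {h : ℝ → ℝ≥0∞} (hh : Measurable h) :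
    ∫⁻ a, (∏ i ∈ Finset.range (k + 1), w i (a i).2) * h (epoch a k) ∂(streamLaw r β) =
      (∏ i ∈ Finset.range (k + 1), ∫⁻ n, w i n ∂β) *
        ∫⁻ x in Set.Ioi 0, ENNReal.ofReal (epochDensity r k x) * h x := by
  have := isProbabilityMeasure_expMeasure hr
  have := isProbabilityMeasure_exp_prod hr β
  have := isProbabilityMeasure_streamLaw hr β
  have hd := fun j => (measurable_epochDensity r j).ennreal_ofReal
  have hw : ∀ i, Measurable (w i) := fun i => measurable_of_countable _
  induction k generalizing h with
  | zero =>
    simp only [zero_add, Finset.range_one, Finset.prod_singleton, epoch, Finset.sum_singleton]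
    rw [← lintegral_expMeasure hh]
    have hp := measurePreserving_eval_infinitePi (fun _ : ℕ => (expMeasure r).prod β) 0
    have := hp.lintegral_comp (f := fun y => w 0 y.2 * h y.1)
      (((hw 0).comp measurable_snd).mul (hh.comp measurable_fst))
    simp only [Function.eval] at this
    rw [streamLaw, this]
    simp only [mul_comm (w 0 _)]
    rw [lintegral_prod_mul hh.aemeasurable (hw 0).aemeasurable, mul_comm]
  | succ k ih =>
    have hind : iIndepFun (fun (i : ℕ) (a : ℕ → ℝ × ℕ) => a i) (streamLaw r β) :=
      iIndepFun_infinitePi (X := fun _ y => y) (fun _ => measurable_id)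
    have h1 := hind.indepFun_finset (Finset.range (k + 1)) {k + 1} (by simp)
      (fun i => measurable_pi_apply i)
    let Y : (Finset.range (k + 1) → ℝ × ℕ) → ℝ≥0∞ × ℝ := fun a =>
      (∏ i : Finset.range (k + 1), w i (a i).2, ∑ i : Finset.range (k + 1), (a i).1)
    have hY : Measurable Y := by
      refine Measurable.prodMk ?_ ?_
      · exact Finset.measurable_prod _ fun i _ =>
          (hw i).comp (measurable_snd.comp (measurable_pi_apply i))
      · exact Finset.measurable_sum _ fun i _ => measurable_fst.comp (measurable_pi_apply i)
    have h2 := h1.comp hY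
      (measurable_pi_apply (⟨k + 1, Finset.mem_singleton_self _⟩ : ({k + 1} : Finset ℕ)))
    have hYe : (Y ∘ fun (a : ℕ → ℝ × ℕ) (i : Finset.range (k + 1)) => a i) = fun a =>
        (∏ i ∈ Finset.range (k + 1), w i (a i).2, epoch a k) := by
      ext a
      · simp only [Y, Function.comp]
        rw [← Finset.prod_coe_sort (Finset.range (k + 1)) (fun i => w i (a i).2)]
      · simp only [Y, Function.comp, epoch]
        rw [← Finset.sum_coe_sort (Finset.range (k + 1)) (fun i => (a i).1)]
    rw [hYe] at h2
    change IndepFun _ (fun a : ℕ → ℝ × ℕ => a (k + 1)) _ at h2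
    have hYm : Measurable (fun a : ℕ → ℝ × ℕ =>
        (∏ i ∈ Finset.range (k + 1), w i (a i).2, epoch a k)) := by
      rw [← hYe]; exact hY.comp (measurable_pi_lambda _ fun i => measurable_pi_apply _)
    have h3 := (indepFun_iff_map_prod_eq_prod_map_map hYm.aemeasurable
      (measurable_pi_apply (k + 1)).aemeasurable).1 h2
    have hlaw : (streamLaw r β).map (fun a => a (k + 1)) = (expMeasure r).prod β :=
      (measurePreserving_eval_infinitePi (fun _ : ℕ => (expMeasure r).prod β) (k + 1)).map_eq
    rw [hlaw] at h3
    let Φ : (ℝ≥0∞ × ℝ) × (ℝ × ℕ) → ℝ≥0∞ := fun y =>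
      y.1.1 * (h (y.1.2 + y.2.1) * w (k + 1) y.2.2)
    have hΦ : Measurable Φ := by
      have := hw (k + 1)
      fun_prop
    have h4 : ∫⁻ a, (∏ i ∈ Finset.range (k + 1 + 1), w i (a i).2) * h (epoch a (k + 1))
        ∂(streamLaw r β) = ∫⁻ y, Φ y ∂((streamLaw r β).map (fun a : ℕ → ℝ × ℕ =>
        ((∏ i ∈ Finset.range (k + 1), w i (a i).2, epoch a k), a (k + 1)))) := by
      rw [lintegral_map hΦ (hYm.prodMk (measurable_pi_apply _))]
      refine lintegral_congr fun a => ?_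
      simp only [Φ]
      rw [Finset.prod_range_succ, epoch, epoch, Finset.sum_range_succ _ (k + 1)]
      ring
    rw [h4, h3, lintegral_prod _ hΦ.aemeasurable]
    have h5 : ∀ y : ℝ≥0∞ × ℝ, ∫⁻ x, Φ (y, x) ∂((expMeasure r).prod β) =
        (∫⁻ n, w (k + 1) n ∂β) * (y.1 *
          ∫⁻ g in Set.Ioi 0, ENNReal.ofReal (epochDensity r 0 g) * h (y.2 + g)) := by
      intro y
      have hg : Measurable (fun g => h (y.2 + g)) := by fun_prop
      simp only [Φ]
      rw [lintegral_const_mul, lintegral_prod_mul hg.aemeasurable (hw _).aemeasurable,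
        lintegral_expMeasure hg]
      · ring
      · exact (hg.comp measurable_fst).mul ((hw (k + 1)).comp measurable_snd)
    simp only [h5]
    have hK : Measurable (fun e : ℝ =>
        ∫⁻ g in Set.Ioi 0, ENNReal.ofReal (epochDensity r 0 g) * h (e + g)) := by
      apply Measurable.lintegral_prod_right'
        (f := fun p : ℝ × ℝ => ENNReal.ofReal (epochDensity r 0 p.2) * h (p.1 + p.2))
      fun_prop
    have hK' : Measurable fun y : ℝ≥0∞ × ℝ => y.1 *
        ∫⁻ g in Set.Ioi 0, ENNReal.ofReal (epochDensity r 0 g) * h (y.2 + g) :=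
      measurable_fst.mul (hK.comp measurable_snd)
    rw [lintegral_const_mul _ hK', lintegral_map hK' hYm, ih hK,
      lintegral_epochDensity_succ hr k hh, Finset.prod_range_succ _ (k + 1)]
    ring

/-- Mean of a sum over batches, with a weight depending on the size of the batch. -/
lemma lintegral_tsum_epoch {r : ℝ} (hr : 0 < r) (β : Measure ℕ) [IsProbabilityMeasure β]
    (w : ℕ → ℝ≥0∞) {h : ℝ → ℝ≥0∞} (hh : Measurable h) :
    ∫⁻ a, ∑' k, w (a k).2 * h (epoch a k) ∂(streamLaw r β) =
      (∫⁻ n, w n ∂β) * (ENNReal.ofReal r * ∫⁻ x in Set.Ioi 0, h x) := by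
  have hd := fun j => (measurable_epochDensity r j).ennreal_ofReal
  have hw : Measurable w := measurable_of_countable _
  rw [lintegral_tsum fun k => by
    have := measurable_epoch k
    fun_prop]
  have h1 : ∀ k, ∫⁻ a, w (a k).2 * h (epoch a k) ∂(streamLaw r β) = (∫⁻ n, w n ∂β) *
      ∫⁻ x in Set.Ioi 0, ENNReal.ofReal (epochDensity r k x) * h x := by
    intro k
    -- All weights but that of the `k`-th batch are `1`.
    have := lintegral_prod_eval_epoch hr β (fun i n => if i = k then w n else 1) k hh
    have h2 : ∀ i, ∫⁻ n, (if i = k then w n else 1) ∂β =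
        if i = k then ∫⁻ n, w n ∂β else 1 := by
      intro i; split_ifs <;> simp
    simp only [h2] at this
    simpa using this
  simp only [h1]
  rw [ENNReal.tsum_mul_left, ← lintegral_tsum
    (f := fun k x => ENNReal.ofReal (epochDensity r k x) * h x)
    fun k => ((hd k).mul hh).aemeasurable,
    ← lintegral_const_mul _ hh]
  congr 1
  refine setLIntegral_congr_fun measurableSet_Ioi fun x hx => ?_
  rw [ENNReal.tsum_mul_right, ← ENNReal.ofReal_tsum_of_nonneg
    (fun k => epochDensity_nonneg hr k (le_of_lt hx)) (hasSum_epochDensity r x).summable,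
    (hasSum_epochDensity r x).tsum_eq]

/-- Mean of a sum over pairs of distinct batches, weighted by the product of their sizes. -/
lemma lintegral_tsum_sum_epoch {r : ℝ} (hr : 0 < r) (β : Measure ℕ) [IsProbabilityMeasure β]
    {h : ℝ → ℝ≥0∞} (hh : Measurable h) :
    ∫⁻ a, ∑' k, (∑ j ∈ Finset.range k, ((a j).2 : ℝ≥0∞) * ((a k).2 : ℝ≥0∞)) * h (epoch a k)
        ∂(streamLaw r β) =
      (∫⁻ n, (n : ℝ≥0∞) ∂β) ^ 2 *
        ∫⁻ x in Set.Ioi 0, ENNReal.ofReal (r ^ 2 * x) * h x := by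
  have hd := fun j => (measurable_epochDensity r j).ennreal_ofReal
  have hc : Measurable (fun n : ℕ => (n : ℝ≥0∞)) := measurable_of_countable _
  have hm : ∀ j k : ℕ, Measurable fun a : ℕ → ℝ × ℕ =>
      ((a j).2 : ℝ≥0∞) * ((a k).2 : ℝ≥0∞) * h (epoch a k) := by
    intro j k
    have := measurable_epoch k
    fun_prop
  simp only [Finset.sum_mul]
  rw [lintegral_tsum fun k => (Finset.measurable_sum _ fun j _ => hm j k).aemeasurable]
  have h1 : ∀ k, ∀ j ∈ Finset.range k, ∫⁻ a, ((a j).2 : ℝ≥0∞) * ((a k).2 : ℝ≥0∞) *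
      h (epoch a k) ∂(streamLaw r β) = (∫⁻ n, (n : ℝ≥0∞) ∂β) ^ 2 *
      ∫⁻ x in Set.Ioi 0, ENNReal.ofReal (epochDensity r k x) * h x := by
    intro k j hj
    have hjk : j < k := Finset.mem_range.1 hj
    have := lintegral_prod_eval_epoch hr β
      (fun i n => (if i = j then (n : ℝ≥0∞) else 1) * (if i = k then (n : ℝ≥0∞) else 1)) k hh
    have h2 : ∀ i, ∫⁻ n : ℕ, ((if i = j then (n : ℝ≥0∞) else 1) *
        (if i = k then (n : ℝ≥0∞) else 1)) ∂β =
        (if i = j then ∫⁻ n, (n : ℝ≥0∞) ∂β else 1) *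
          (if i = k then ∫⁻ n, (n : ℝ≥0∞) ∂β else 1) := by
      intro i
      by_cases hij : i = j
      · have : i ≠ k := by omega
        simp [hij, hjk.ne]
      · by_cases hik : i = k
        · subst hik; simp [hij]
        · simp [hij, hik]
    simp only [h2, Finset.prod_mul_distrib, Finset.prod_ite_eq', Finset.mem_range] at this
    simp only [show j < k + 1 by omega, Nat.lt_succ_self, if_true] at this
    rw [this, sq]
  have h3 : ∀ k : ℕ, ∫⁻ a, ∑ j ∈ Finset.range k, ((a j).2 : ℝ≥0∞) * ((a k).2 : ℝ≥0∞) *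
      h (epoch a k) ∂(streamLaw r β) = (∫⁻ n, (n : ℝ≥0∞) ∂β) ^ 2 *
      ∫⁻ x in Set.Ioi 0, ENNReal.ofReal ((k : ℝ) * epochDensity r k x) * h x := by
    intro k
    rw [lintegral_finsetSum _ fun j _ => hm j k, Finset.sum_congr rfl (h1 k), Finset.sum_const,
      Finset.card_range, nsmul_eq_mul, mul_left_comm, ← lintegral_const_mul
        (f := fun x => ENNReal.ofReal (epochDensity r k x) * h x) _ ((hd k).mul hh)]
    congr 1
    refine lintegral_congr fun x => ?_
    rw [ENNReal.ofReal_mul (by positivity), ENNReal.ofReal_natCast, mul_assoc]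
  simp only [h3]
  rw [ENNReal.tsum_mul_left, ← lintegral_tsum
    (f := fun (k : ℕ) x => ENNReal.ofReal ((k : ℝ) * epochDensity r k x) * h x)
    fun k => by fun_prop]
  congr 1
  refine setLIntegral_congr_fun measurableSet_Ioi fun x hx => ?_
  rw [ENNReal.tsum_mul_right, ← ENNReal.ofReal_tsum_of_nonneg
    (fun k => mul_nonneg k.cast_nonneg (epochDensity_nonneg hr k (le_of_lt hx)))
    (hasSum_mul_epochDensity r x).summable, (hasSum_mul_epochDensity r x).tsum_eq]

end Stream

/-! ### Arrivals of a stream over a random duration -/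

section StreamMoments

open scoped ENNReal

/-- Streams with positive gaps and finitely many batches in bounded time. -/
def GoodStream (a : ℕ → ℝ × ℕ) : Prop := (∀ j, 0 < (a j).1) ∧ ∀ t, ∃ n, t < epoch a n

lemma epoch_zero (a : ℕ → ℝ × ℕ) : epoch a 0 = (a 0).1 := by simp [epoch]

lemma epoch_succ (a : ℕ → ℝ × ℕ) (k : ℕ) : epoch a (k + 1) = epoch a k + (a (k + 1)).1 :=
  Finset.sum_range_succ _ _

lemma GoodStream.monotone {a : ℕ → ℝ × ℕ} (ha : GoodStream a) : Monotone (epoch a) :=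
  monotone_nat_of_le_succ fun k => by rw [epoch_succ]; linarith [ha.1 (k + 1)]

lemma epoch_le_of_lt_batchCount {a : ℕ → ℝ × ℕ} {t : ℝ} {j : ℕ} (h : j < batchCount a t) :
    epoch a j ≤ t :=
  not_lt.1 fun hlt => absurd (Nat.sInf_le (s := {n | t < epoch a n}) hlt) (not_le.2 h)

lemma GoodStream.lt_batchCount_iff {a : ℕ → ℝ × ℕ} (ha : GoodStream a) {t : ℝ} {j : ℕ} :
    j < batchCount a t ↔ epoch a j ≤ t := by
  refine ⟨epoch_le_of_lt_batchCount, fun h => ?_⟩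
  by_contra hj
  have hmem : t < epoch a (batchCount a t) := Nat.sInf_mem (s := {n | t < epoch a n}) (ha.2 t)
  exact absurd (hmem.trans_le (ha.monotone (not_lt.1 hj))) (not_lt.2 h)

/-- A stream is almost surely good: the mean number of epochs in a bounded interval is finite, so
that the number itself is. -/
lemma ae_goodStream {r : ℝ} (hr : 0 < r) (β : Measure ℕ) [IsProbabilityMeasure β] :
    ∀ᵐ a ∂(streamLaw r β), GoodStream a := by
  have := isProbabilityMeasure_expMeasure hr
  have := isProbabilityMeasure_exp_prod hr β
  have hexp : ∀ᵐ y ∂(expMeasure r), 0 < y := by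
    have h := lintegral_expMeasure (r := r) (h := (Set.Iic (0 : ℝ)).indicator 1)
      (measurable_one.indicator measurableSet_Iic)
    rw [lintegral_indicator_one measurableSet_Iic, setLIntegral_congr_fun (g := fun _ => 0)
      measurableSet_Ioi (fun x hx => by simp [not_le.2 (Set.mem_Ioi.1 hx)]), lintegral_zero] at h
    rw [ae_iff]
    simpa [Set.Iic] using h
  have h1 : ∀ᵐ a ∂(streamLaw r β), ∀ j, 0 < (a j).1 := by
    rw [ae_all_iff]
    intro j
    have hp := measurePreserving_eval_infinitePi (fun _ : ℕ => (expMeasure r).prod β) j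
    have hq := (measurePreserving_fst (μ := expMeasure r) (ν := β)).comp hp
    exact hq.quasiMeasurePreserving.ae hexp
  have h2 : ∀ᵐ a ∂(streamLaw r β), ∀ m : ℕ, ∃ n, (m : ℝ) < epoch a n := by
    rw [ae_all_iff]
    intro m
    have hm : Measurable ((Set.Iic (m : ℝ)).indicator (1 : ℝ → ℝ≥0∞)) :=
      measurable_one.indicator measurableSet_Iic
    have h := lintegral_tsum_epoch hr β (fun _ => 1) hm
    rw [lintegral_indicator_one measurableSet_Iic, Measure.restrict_apply measurableSet_Iic,
      Set.inter_comm, Set.Ioi_inter_Iic, Real.volume_Ioc] at h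
    have hfin : ∀ᵐ a ∂(streamLaw r β),
        ∑' k, (1 : ℝ≥0∞) * (Set.Iic (m : ℝ)).indicator 1 (epoch a k) < ∞ := by
      refine ae_lt_top (Measurable.tsum fun k => ?_) ?_
      · exact measurable_const.mul (hm.comp (measurable_epoch k))
      · rw [h]
        simp [ENNReal.mul_eq_top]
    filter_upwards [hfin] with a ha
    by_contra hcon
    push Not at hcon
    simp [hcon] at ha
  filter_upwards [h1, h2] with a ha hb
  refine ⟨ha, fun t => ?_⟩
  obtain ⟨m, hm⟩ := exists_nat_ge t
  obtain ⟨n, hn⟩ := hb m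
  exact ⟨n, hm.trans_lt hn⟩

/-- Number of customers arrived by time `t`. -/
noncomputable def arrived (a : ℕ → ℝ × ℕ) (t : ℝ) : ℝ :=
  ∑ j ∈ Finset.range (batchCount a t), ((a j).2 : ℝ)

/-- Total age at time `t` of the customers arrived by then. -/
noncomputable def arrivedAge (a : ℕ → ℝ × ℕ) (t : ℝ) : ℝ :=
  ∑ j ∈ Finset.range (batchCount a t), ((a j).2 : ℝ) * (t - epoch a j)

lemma sum_map_arrivals (a : ℕ → ℝ × ℕ) (t : ℝ) (φ : ℝ → ℝ) :
    ((arrivals a t).map φ).sum =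
      ∑ j ∈ Finset.range (batchCount a t), ((a j).2 : ℝ) * φ (t - epoch a j) := by
  unfold arrivals
  generalize batchCount a t = n
  induction n with
  | zero => simp
  | succ n ih =>
    rw [List.range_succ, List.flatMap_append, List.map_append, List.sum_append, ih,
      Finset.sum_range_succ]
    simp

lemma length_arrivals (a : ℕ → ℝ × ℕ) (t : ℝ) : ((arrivals a t).length : ℝ) = arrived a t := by
  have := sum_map_arrivals a t (fun _ => 1)
  simpa [arrived] using this

lemma sum_arrivals (a : ℕ → ℝ × ℕ) (t : ℝ) : (arrivals a t).sum = arrivedAge a t := by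
  simpa [arrivedAge] using sum_map_arrivals a t id

lemma nonneg_of_mem_arrivals {a : ℕ → ℝ × ℕ} {t y : ℝ} (h : y ∈ arrivals a t) : 0 ≤ y := by
  simp only [arrivals, List.mem_flatMap, List.mem_range, List.mem_replicate] at h
  obtain ⟨j, hj, -, rfl⟩ := h
  exact sub_nonneg.2 (epoch_le_of_lt_batchCount hj)

lemma arrived_nonneg (a : ℕ → ℝ × ℕ) (t : ℝ) : 0 ≤ arrived a t :=
  Finset.sum_nonneg fun _ _ => Nat.cast_nonneg _

lemma arrivedAge_nonneg (a : ℕ → ℝ × ℕ) (t : ℝ) : 0 ≤ arrivedAge a t :=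
  Finset.sum_nonneg fun _ hj => mul_nonneg (Nat.cast_nonneg _)
    (sub_nonneg.2 (epoch_le_of_lt_batchCount (Finset.mem_range.1 hj)))

/-- On the null set of streams without epoch after `t`, the infimum defining `batchCount` is that of
the empty set, which is `0`; this case is the second member of the union in the proof. -/
lemma measurable_batchCount :
    Measurable fun p : (ℕ → ℝ × ℕ) × ℝ => batchCount p.1 p.2 := by
  have hlt : ∀ n, MeasurableSet {p : (ℕ → ℝ × ℕ) × ℝ | p.2 < epoch p.1 n} := fun n =>
    measurableSet_lt measurable_snd ((measurable_epoch n).comp measurable_fst)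
  refine measurable_of_Iio fun n => ?_
  have : (fun p : (ℕ → ℝ × ℕ) × ℝ => batchCount p.1 p.2) ⁻¹' Set.Iio n =
      (⋃ m ∈ Set.Iio n, {p | p.2 < epoch p.1 m}) ∪
        ({p | 0 < n} ∩ ⋂ m, {p | p.2 < epoch p.1 m}ᶜ) := by
    ext p
    simp only [Set.mem_preimage, Set.mem_Iio, Set.mem_union, Set.mem_iUnion, Set.mem_ofPred_eq,
      Set.mem_inter_iff, Set.mem_iInter, Set.mem_compl_iff, exists_prop]
    constructor
    · intro h
      by_cases hne : ∃ m, p.2 < epoch p.1 m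
      · exact Or.inl ⟨_, h, Nat.sInf_mem (s := {n | p.2 < epoch p.1 n}) hne⟩
      · push Not at hne
        exact Or.inr ⟨(Nat.zero_le _).trans_lt h, fun m => not_lt.2 (hne m)⟩
    · rintro (⟨m, hm, hlt⟩ | ⟨hn, hm⟩)
      · exact (Nat.sInf_le (s := {n | p.2 < epoch p.1 n}) hlt).trans_lt hm
      · have : {n | p.2 < epoch p.1 n} = ∅ := by
          ext m; simpa using hm m
        rwa [batchCount, this, Nat.sInf_empty]
  rw [this]
  exact (MeasurableSet.biUnion (Set.to_countable _) fun m _ => hlt m).union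
    ((MeasurableSet.const _).inter (MeasurableSet.iInter fun m => (hlt m).compl))

lemma measurable_sum_range {α : Type*} [MeasurableSpace α] {n : α → ℕ} (hn : Measurable n)
    {F : ℕ → α → ℝ} (hF : ∀ j, Measurable (F j)) :
    Measurable fun x => ∑ j ∈ Finset.range (n x), F j x := by
  have : Measurable fun y : ℕ × α => ∑ j ∈ Finset.range y.1, F j y.2 :=
    by
    refine measurable_from_prod_countable_right fun k => ?_
    exact Finset.measurable_fun_sum (Finset.range k) fun j _ => hF j
  exact this.comp (hn.prodMk measurable_id)

lemma measurable_arrived : Measurable fun p : (ℕ → ℝ × ℕ) × ℝ => arrived p.1 p.2 := by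
  refine measurable_sum_range measurable_batchCount fun j => ?_
  have hc : Measurable (fun n : ℕ => (n : ℝ)) := measurable_of_countable _
  fun_prop

lemma measurable_arrivedAge : Measurable fun p : (ℕ → ℝ × ℕ) × ℝ => arrivedAge p.1 p.2 := by
  refine measurable_sum_range measurable_batchCount fun j => ?_
  have hc : Measurable (fun n : ℕ => (n : ℝ)) := measurable_of_countable _
  have := measurable_epoch j
  fun_prop

/-- The finite sum over the batches arrived by time `t`, as a series over all batches. -/
lemma GoodStream.ofReal_sum {a : ℕ → ℝ × ℕ} (ha : GoodStream a) (t : ℝ) {F : ℕ → ℝ}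
    (hF : ∀ j, epoch a j ≤ t → 0 ≤ F j) :
    ENNReal.ofReal (∑ j ∈ Finset.range (batchCount a t), F j) =
      ∑' j, ENNReal.ofReal (F j) * (Set.Iic t).indicator 1 (epoch a j) := by
  rw [ENNReal.ofReal_sum_of_nonneg fun j hj =>
    hF j (epoch_le_of_lt_batchCount (Finset.mem_range.1 hj)), tsum_eq_sum
    (s := Finset.range (batchCount a t))]
  · refine Finset.sum_congr rfl fun j hj => ?_
    rw [Set.indicator_of_mem (show epoch a j ∈ Set.Iic t from
      epoch_le_of_lt_batchCount (Finset.mem_range.1 hj))]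
    simp
  · intro j hj
    have h : epoch a j ∉ Set.Iic t := fun h =>
      hj (Finset.mem_range.2 (ha.lt_batchCount_iff.2 h))
    rw [Set.indicator_of_notMem h, mul_zero]

lemma lintegral_ofReal_eq {β : Measure ℕ} {F : ℕ → ℝ} (hF : Integrable F β) (h0 : ∀ n, 0 ≤ F n) :
    ∫⁻ n, ENNReal.ofReal (F n) ∂β = ENNReal.ofReal (∫ n, F n ∂β) :=
  (ofReal_integral_eq_lintegral_ofReal hF (Filter.Eventually.of_forall h0)).symm

/-- Total weight of the batches arrived by time `t`. -/
lemma lintegral_sum_weight {r : ℝ} (hr : 0 < r) (β : Measure ℕ) [IsProbabilityMeasure β]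
    {F : ℕ → ℝ} (hF : Integrable F β) (h0 : ∀ n, 0 ≤ F n) (t : ℝ) :
    ∫⁻ a, ENNReal.ofReal (∑ j ∈ Finset.range (batchCount a t), F (a j).2) ∂(streamLaw r β) =
      ENNReal.ofReal (r * (∫ n, F n ∂β) * t) := by
  rw [lintegral_congr_ae ((ae_goodStream hr β).mono fun a ha =>
    ha.ofReal_sum t (F := fun j => F (a j).2) fun j _ => h0 _),
    lintegral_tsum_epoch hr β (fun n => ENNReal.ofReal (F n))
      (measurable_one.indicator measurableSet_Iic), lintegral_ofReal_eq hF h0,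
    lintegral_indicator_one measurableSet_Iic, Measure.restrict_apply measurableSet_Iic,
    Set.inter_comm, Set.Ioi_inter_Iic, Real.volume_Ioc, sub_zero,
    ← ENNReal.ofReal_mul hr.le, ← ENNReal.ofReal_mul (integral_nonneg h0)]
  congr 1; ring

lemma setLIntegral_Iic_ofReal_mul {c t : ℝ} (hc : 0 ≤ c) (ht : 0 ≤ t) (F : ℝ → ℝ)
    (hF : Continuous F) (h0 : ∀ x, 0 < x → x ≤ t → 0 ≤ F x) :
    ENNReal.ofReal c * ∫⁻ x in Set.Ioi 0, ENNReal.ofReal (F x) * (Set.Iic t).indicator 1 x =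
      ENNReal.ofReal (c * ∫ x in (0 : ℝ)..t, F x) := by
  have h1 : ∀ x, ENNReal.ofReal (F x) * (Set.Iic t).indicator 1 x =
      (Set.Iic t).indicator (fun x => ENNReal.ofReal (F x)) x := fun x => by
    simp only [Set.indicator_apply]; split_ifs <;> simp
  simp only [h1]
  rw [setLIntegral_indicator measurableSet_Iic, Set.inter_comm, Set.Ioi_inter_Iic,
    ← ofReal_integral_eq_lintegral_ofReal hF.integrableOn_Ioc,
    ← intervalIntegral.integral_of_le ht, ENNReal.ofReal_mul hc]
  filter_upwards [ae_restrict_mem measurableSet_Ioc] with x hx using h0 x hx.1 hx.2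

lemma lintegral_arrivedAge {r : ℝ} (hr : 0 < r) (β : Measure ℕ) [IsProbabilityMeasure β]
    (hF : Integrable (fun n : ℕ => (n : ℝ)) β) {t : ℝ} (ht : 0 ≤ t) :
    ∫⁻ a, ENNReal.ofReal (arrivedAge a t) ∂(streamLaw r β) =
      ENNReal.ofReal (r * (∫ n : ℕ, (n : ℝ) ∂β) * t ^ 2 / 2) := by
  have h1 : ∀ᵐ a ∂(streamLaw r β), ENNReal.ofReal (arrivedAge a t) =
      ∑' j, ENNReal.ofReal ((a j).2 : ℝ) *
        (ENNReal.ofReal (t - epoch a j) * (Set.Iic t).indicator 1 (epoch a j)) := by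
    filter_upwards [ae_goodStream hr β] with a ha
    rw [arrivedAge, ha.ofReal_sum t fun j hj => mul_nonneg (Nat.cast_nonneg _) (sub_nonneg.2 hj)]
    refine tsum_congr fun j => ?_
    rw [ENNReal.ofReal_mul (Nat.cast_nonneg _), mul_assoc]
  have hm : Measurable fun x : ℝ => ENNReal.ofReal (t - x) * (Set.Iic t).indicator 1 x :=
    Measurable.mul (by fun_prop) (measurable_one.indicator measurableSet_Iic)
  rw [lintegral_congr_ae h1, lintegral_tsum_epoch hr β (fun n => ENNReal.ofReal (n : ℝ)) hm,
    lintegral_ofReal_eq hF fun n => Nat.cast_nonneg _,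
    setLIntegral_Iic_ofReal_mul hr.le ht (fun x => t - x) (by fun_prop)
      (fun x _ hx => sub_nonneg.2 hx),
    ← ENNReal.ofReal_mul (integral_nonneg fun n => Nat.cast_nonneg _)]
  congr 1
  rw [intervalIntegral.integral_sub (by simp) (by simp), integral_id]
  simp
  ring

lemma sum_range_sq (s : ℕ → ℝ) (n : ℕ) : (∑ k ∈ Finset.range n, s k) ^ 2 =
    ∑ k ∈ Finset.range n, s k ^ 2 +
      2 * ∑ k ∈ Finset.range n, ∑ j ∈ Finset.range k, s j * s k := by
  induction n with
  | zero => simp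
  | succ n ih =>
    rw [Finset.sum_range_succ, Finset.sum_range_succ, Finset.sum_range_succ, add_sq, ih,
      ← Finset.sum_mul]
    ring

/-- Second moment of the number of customers arrived by time `t`: the square is split into the
contributions of single batches and of pairs of distinct batches. -/
lemma lintegral_arrived_sq {r : ℝ} (hr : 0 < r) (β : Measure ℕ) [IsProbabilityMeasure β]
    (hF : Integrable (fun n : ℕ => (n : ℝ)) β) (hF2 : Integrable (fun n : ℕ => (n : ℝ) ^ 2) β)
    {t : ℝ} (ht : 0 ≤ t) :
    ∫⁻ a, ENNReal.ofReal (arrived a t ^ 2) ∂(streamLaw r β) =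
      ENNReal.ofReal (r * (∫ n : ℕ, (n : ℝ) ^ 2 ∂β) * t + (r * (∫ n : ℕ, (n : ℝ) ∂β) * t) ^ 2) := by
  have hb0 : 0 ≤ ∫ n : ℕ, (n : ℝ) ∂β := integral_nonneg fun n => Nat.cast_nonneg _
  have hb20 : 0 ≤ ∫ n : ℕ, (n : ℝ) ^ 2 ∂β := integral_nonneg fun n => by positivity
  set S : (ℕ → ℝ × ℕ) → ℝ := fun a => ∑ k ∈ Finset.range (batchCount a t),
    ∑ j ∈ Finset.range k, ((a j).2 : ℝ) * ((a k).2 : ℝ) with hS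
  have hS0 : ∀ a, 0 ≤ S a := fun a =>
    Finset.sum_nonneg fun _ _ => Finset.sum_nonneg fun _ _ => by positivity
  have hone : Measurable ((Set.Iic t).indicator (1 : ℝ → ℝ≥0∞)) :=
    measurable_one.indicator measurableSet_Iic
  have hS1 : ∫⁻ a, ENNReal.ofReal (S a) ∂(streamLaw r β) =
      ENNReal.ofReal ((r * (∫ n : ℕ, (n : ℝ) ∂β) * t) ^ 2 / 2) := by
    have h1 : ∀ᵐ a ∂(streamLaw r β), ENNReal.ofReal (S a) =
        ∑' k, (∑ j ∈ Finset.range k, ((a j).2 : ℝ≥0∞) * ((a k).2 : ℝ≥0∞)) *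
          (Set.Iic t).indicator 1 (epoch a k) := by
      filter_upwards [ae_goodStream hr β] with a ha
      rw [hS, ha.ofReal_sum t fun k _ => Finset.sum_nonneg fun _ _ => by positivity]
      refine tsum_congr fun k => ?_
      rw [ENNReal.ofReal_sum_of_nonneg fun _ _ => by positivity]
      congr 1
      refine Finset.sum_congr rfl fun j _ => ?_
      rw [ENNReal.ofReal_mul (Nat.cast_nonneg _), ENNReal.ofReal_natCast, ENNReal.ofReal_natCast]
    have h2 : ∫⁻ n : ℕ, (n : ℝ≥0∞) ∂β = ENNReal.ofReal (∫ n : ℕ, (n : ℝ) ∂β) := by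
      rw [← lintegral_ofReal_eq hF fun n => Nat.cast_nonneg _]
      simp
    rw [lintegral_congr_ae h1, lintegral_tsum_sum_epoch hr β hone, h2, ← ENNReal.ofReal_pow hb0,
      setLIntegral_Iic_ofReal_mul (sq_nonneg _) ht (fun x => r ^ 2 * x) (by fun_prop)
        (fun x hx _ => by positivity), intervalIntegral.integral_const_mul, integral_id]
    congr 1; ring
  have h3 : ∀ a, ENNReal.ofReal (arrived a t ^ 2) =
      ENNReal.ofReal (∑ k ∈ Finset.range (batchCount a t), ((a k).2 : ℝ) ^ 2) +
        2 * ENNReal.ofReal (S a) := by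
    intro a
    rw [arrived, sum_range_sq, ENNReal.ofReal_add (Finset.sum_nonneg fun _ _ => by positivity)
      (mul_nonneg zero_le_two (hS0 a)), ENNReal.ofReal_mul zero_le_two]
    simp [hS]
  have hSm : Measurable S := by
    have hc : Measurable (fun n : ℕ => (n : ℝ)) := measurable_of_countable _
    exact measurable_sum_range (measurable_batchCount.comp (measurable_id.prodMk measurable_const))
      fun k => by fun_prop
  simp only [h3]
  rw [lintegral_add_right _ (by fun_prop), lintegral_const_mul _ (by fun_prop), hS1,
    lintegral_sum_weight hr β hF2 (fun n => by positivity) t, ← ENNReal.ofReal_ofNat 2,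
    ← ENNReal.ofReal_mul (by simp), ← ENNReal.ofReal_add (by positivity) (by positivity)]
  congr 1
  simp
  ring

lemma lintegral_arrived {r : ℝ} (hr : 0 < r) (β : Measure ℕ) [IsProbabilityMeasure β]
    (hF : Integrable (fun n : ℕ => (n : ℝ)) β) (t : ℝ) :
    ∫⁻ a, ENNReal.ofReal (arrived a t) ∂(streamLaw r β) =
      ENNReal.ofReal (r * (∫ n : ℕ, (n : ℝ) ∂β) * t) :=
  lintegral_sum_weight hr β hF (fun _ => Nat.cast_nonneg _) t

lemma expMeasure_Ioi_pos {r : ℝ} (hr : 0 < r) (t : ℝ) : 0 < expMeasure r (Set.Ioi t) := by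
  have h := lintegral_expMeasure (r := r) (h := (Set.Ioi t).indicator 1)
    (measurable_one.indicator measurableSet_Ioi)
  rw [lintegral_indicator_one measurableSet_Ioi] at h
  rw [h, setLIntegral_pos_iff]
  · have : Function.support (fun x => ENNReal.ofReal (epochDensity r 0 x) *
        (Set.Ioi t).indicator 1 x) ∩ Set.Ioi 0 = Set.Ioi (max t 0) := by
      ext x
      have : ¬ epochDensity r 0 x ≤ 0 := by
        simp only [epochDensity, not_le]
        simp
        positivity
      simp [this]
    rw [this]
    simp
  · have := measurable_epochDensity r 0
    exact Measurable.mul (by fun_prop) (measurable_one.indicator measurableSet_Ioi)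

end StreamMoments

/-! ### Means over an innovation -/

section Mean

variable {α β : Type*} [MeasurableSpace α] [MeasurableSpace β] {μ : Measure α}

/-- `F` is integrable with mean `v`. -/
def HasMean (μ : Measure α) (F : α → ℝ) (v : ℝ) : Prop := Integrable F μ ∧ ∫ x, F x ∂μ = v

namespace HasMean

variable {F G : α → ℝ} {v w : ℝ}

lemma of_integrable (hF : Integrable F μ) : HasMean μ F (∫ x, F x ∂μ) := ⟨hF, rfl⟩

lemma const [IsProbabilityMeasure μ] (c : ℝ) : HasMean μ (fun _ => c) c :=
  ⟨integrable_const c, by simp⟩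

lemma add (hF : HasMean μ F v) (hG : HasMean μ G w) :
    HasMean μ (fun x => F x + G x) (v + w) :=
  ⟨hF.1.add hG.1, by rw [integral_add hF.1 hG.1, hF.2, hG.2]⟩

lemma sub (hF : HasMean μ F v) (hG : HasMean μ G w) :
    HasMean μ (fun x => F x - G x) (v - w) :=
  ⟨hF.1.sub hG.1, by rw [integral_sub hF.1 hG.1, hF.2, hG.2]⟩

lemma const_mul (c : ℝ) (hF : HasMean μ F v) : HasMean μ (fun x => c * F x) (c * v) :=
  ⟨hF.1.const_mul c, by rw [integral_const_mul, hF.2]⟩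

lemma sum {ι : Type*} (s : Finset ι) {F : ι → α → ℝ} {v : ι → ℝ}
    (hF : ∀ i ∈ s, HasMean μ (F i) (v i)) :
    HasMean μ (fun x => ∑ i ∈ s, F i x) (∑ i ∈ s, v i) :=
  ⟨integrable_finsetSum s fun i hi => (hF i hi).1, by
    rw [integral_finsetSum s fun i hi => (hF i hi).1]
    exact Finset.sum_congr rfl fun i hi => (hF i hi).2⟩

lemma congr (hF : HasMean μ F v) (h : ∀ x, G x = F x) (hv : w = v) : HasMean μ G w := by
  rw [funext h, hv]; exact hF

lemma comp {ν : Measure β} {F : β → ℝ} {T : α → β} (hT : MeasurePreserving T μ ν)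
    (hF : HasMean ν F v) : HasMean μ (fun x => F (T x)) v := by
  refine ⟨hT.integrable_comp_of_integrable hF.1, ?_⟩
  have hm : AEStronglyMeasurable F (μ.map T) := by rw [hT.map_eq]; exact hF.1.1
  rw [← integral_map hT.measurable.aemeasurable hm, hT.map_eq, hF.2]

end HasMean

/-- Conditioning on the first coordinate: a nonnegative function of two independent variables whose
conditional mean `G` is integrable. -/
lemma integrable_prod_of_lintegral {μ : Measure α} {ν : Measure β} [SFinite ν] [SFinite μ]
    {F : α × β → ℝ} (hF : Measurable F) (h0 : ∀ p, 0 ≤ F p) {G : α → ℝ} (hG : Integrable G μ)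
    (hG0 : ∀ x, 0 ≤ G x)
    (h : ∀ x, ∫⁻ y, ENNReal.ofReal (F (x, y)) ∂ν = ENNReal.ofReal (G x)) :
    Integrable F (μ.prod ν) ∧ ∀ φ : α → ℝ, Measurable φ → (∃ C, ∀ x, ‖φ x‖ ≤ C) →
      HasMean (μ.prod ν) (fun p => φ p.1 * F p) (∫ x, φ x * G x ∂μ) := by
  have hint : Integrable F (μ.prod ν) := by
    refine ⟨hF.aestronglyMeasurable, ?_⟩
    rw [hasFiniteIntegral_iff_ofReal (Filter.Eventually.of_forall h0),
      lintegral_prod _ hF.ennreal_ofReal.aemeasurable]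
    simp only [h]
    rw [← hasFiniteIntegral_iff_ofReal (Filter.Eventually.of_forall hG0)]
    exact hG.2
  refine ⟨hint, fun φ hφ ⟨C, hC⟩ => ?_⟩
  have hint' : Integrable (fun p : α × β => φ p.1 * F p) (μ.prod ν) :=
    hint.bdd_mul (c := C) (hφ.comp measurable_fst).aestronglyMeasurable
      (Filter.Eventually.of_forall fun p => hC p.1)
  refine ⟨hint', ?_⟩
  rw [integral_prod _ hint']
  refine integral_congr_ae (Filter.Eventually.of_forall fun x => ?_)
  simp only [integral_const_mul]
  rw [integral_eq_lintegral_of_nonneg_ae (Filter.Eventually.of_forall fun y => h0 _)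
    (hF.comp measurable_prodMk_left).aestronglyMeasurable, h, ENNReal.toReal_ofReal (hG0 x)]

end Mean

section Innovations

open scoped ENNReal

variable {N : ℕ} [NeZero N] (M : Model N)

/-- The part of the innovation that concerns arrivals: independent streams at all queues. -/
noncomputable def Model.streamsLaw : Measure (ZMod N × ℕ → ℝ × ℕ) :=
  Measure.infinitePi fun _ : ZMod N × ℕ => (expMeasure M.batchRate).prod M.batchLaw

instance : IsProbabilityMeasure M.batchLaw := M.batchLaw_prob
instance : IsProbabilityMeasure M.move := M.move_prob
instance : IsProbabilityMeasure M.moveEmpty := M.moveEmpty_prob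
instance : IsProbabilityMeasure (expMeasure M.batchRate) :=
  isProbabilityMeasure_expMeasure M.batchRate_pos
instance : IsProbabilityMeasure M.streamsLaw := by unfold Model.streamsLaw; infer_instance
instance : IsProbabilityMeasure (streamLaw M.batchRate M.batchLaw) :=
  isProbabilityMeasure_streamLaw M.batchRate_pos _

omit [NeZero N] in
lemma measurePreserving_curry : MeasurePreserving
    (fun (a : ZMod N × ℕ → ℝ × ℕ) (q : ZMod N) (j : ℕ) => a (q, j)) M.streamsLaw
    (Measure.infinitePi fun _ : ZMod N => streamLaw M.batchRate M.batchLaw) := by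
  refine ⟨by fun_prop, ?_⟩
  exact Measure.infinitePi_map_curry
    (fun (_ : ZMod N) (_ : ℕ) => (expMeasure M.batchRate).prod M.batchLaw)

omit [NeZero N] in
lemma measurePreserving_stream (q : ZMod N) : MeasurePreserving
    (fun (a : ZMod N × ℕ → ℝ × ℕ) (j : ℕ) => a (q, j)) M.streamsLaw
    (streamLaw M.batchRate M.batchLaw) :=
  (measurePreserving_eval_infinitePi (fun _ : ZMod N => streamLaw M.batchRate M.batchLaw) q).comp
    (measurePreserving_curry M)

omit [NeZero N] in
/-- The streams at two different queues are independent. -/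
lemma lintegral_mul_streams {q q' : ZMod N} (hq : q ≠ q') {F : (ℕ → ℝ × ℕ) → ℝ≥0∞}
    (hF : Measurable F) :
    ∫⁻ a, F (fun j => a (q, j)) * F (fun j => a (q', j)) ∂M.streamsLaw =
      (∫⁻ a, F a ∂(streamLaw M.batchRate M.batchLaw)) ^ 2 := by
  have h1 := (measurePreserving_curry M).lintegral_comp
    (f := fun c : ZMod N → ℕ → ℝ × ℕ => F (c q) * F (c q')) (by fun_prop)
  simp only at h1
  rw [h1]
  have hind := (iIndepFun_infinitePi (P := fun _ : ZMod N => streamLaw M.batchRate M.batchLaw)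
    (X := fun _ => F) (fun _ => hF)).indepFun hq
  have h2 := lintegral_mul_eq_lintegral_mul_lintegral_of_indepFun
    (hF.comp (measurable_pi_apply q)) (hF.comp (measurable_pi_apply q')) hind
  simp only [Pi.mul_apply, Function.comp] at h2
  rw [h2]
  have h3 : ∀ p : ZMod N, ∫⁻ c, F (c p)
      ∂(Measure.infinitePi fun _ : ZMod N => streamLaw M.batchRate M.batchLaw) =
      ∫⁻ a, F a ∂(streamLaw M.batchRate M.batchLaw) := fun p =>
    (measurePreserving_eval_infinitePi
      (fun _ : ZMod N => streamLaw M.batchRate M.batchLaw) p).lintegral_comp hF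
  rw [h3, h3, sq]

/-- The displacement and duration of a move, together with the streams of arrivals. -/
abbrev Move (N : ℕ) : Type := (ZMod N × ℝ≥0) × (ZMod N × ℕ → ℝ × ℕ)

/-- Number of arrivals at queue `q` during a move. -/
noncomputable def arr (q : ZMod N) (y : Move N) : ℝ :=
  arrived (fun j => y.2 (q, j)) (y.1.2 : ℝ)

/-- Total age, at the end of a move, of the customers arrived at queue `q` during it. -/
noncomputable def arrAge (q : ZMod N) (y : Move N) : ℝ :=
  arrivedAge (fun j => y.2 (q, j)) (y.1.2 : ℝ)

omit [NeZero N] in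
lemma arr_nonneg (q : ZMod N) (y : Move N) : 0 ≤ arr q y := arrived_nonneg _ _

omit [NeZero N] in
lemma arrAge_nonneg (q : ZMod N) (y : Move N) : 0 ≤ arrAge q y := arrivedAge_nonneg _ _

omit [NeZero N] in
lemma measurable_stream_duration (q : ZMod N) :
    Measurable fun y : Move N => ((fun j => y.2 (q, j)), (y.1.2 : ℝ)) := by
  refine Measurable.prodMk ?_ ?_
  · exact measurable_pi_lambda _ fun j => (measurable_pi_apply (q, j)).comp measurable_snd
  · exact measurable_coe_nnreal_real.comp (measurable_snd.comp measurable_fst)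

omit [NeZero N] in
@[fun_prop]
lemma measurable_arr (q : ZMod N) : Measurable (arr q) := by
  have h := measurable_arrived.comp (measurable_stream_duration q)
  simp only [Function.comp_def] at h
  exact h

omit [NeZero N] in
@[fun_prop]
lemma measurable_arrAge (q : ZMod N) : Measurable (arrAge q) := by
  have h := measurable_arrivedAge.comp (measurable_stream_duration q)
  simp only [Function.comp_def] at h
  exact h

lemma integrable_natCast_of_sq {β : Measure ℕ} [IsFiniteMeasure β]
    (h : Integrable (fun k : ℕ => (k : ℝ) ^ 2) β) : Integrable (fun k : ℕ => (k : ℝ)) β := by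
  refine (h.add (integrable_const 1)).mono' (measurable_of_countable _).aestronglyMeasurable
    (Filter.Eventually.of_forall fun k => ?_)
  simp only [Pi.add_apply, Real.norm_natCast]
  nlinarith [sq_nonneg ((k : ℝ) - 1)]

lemma integrable_duration_of_sq {κ : Measure (ZMod N × ℝ≥0)} [IsFiniteMeasure κ]
    (h : Integrable (fun y : ZMod N × ℝ≥0 => (y.2 : ℝ) ^ 2) κ) :
    Integrable (fun y : ZMod N × ℝ≥0 => (y.2 : ℝ)) κ := by
  refine (h.add (integrable_const 1)).mono' (by fun_prop)
    (Filter.Eventually.of_forall fun y => ?_)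
  simp only [Pi.add_apply, Real.norm_of_nonneg y.2.coe_nonneg]
  nlinarith [sq_nonneg ((y.2 : ℝ) - 1), y.2.coe_nonneg]

variable {M}

omit [NeZero N] in
lemma Model.b_nonneg : 0 ≤ M.b := integral_nonneg fun _ => Nat.cast_nonneg _

omit [NeZero N] in
lemma Model.b2_nonneg : 0 ≤ M.b2 := integral_nonneg fun _ => sq_nonneg _

omit [NeZero N] in
lemma Model.rate_nonneg : 0 ≤ M.rate := mul_nonneg M.batchRate_pos.le M.b_nonneg

variable {κ : Measure (ZMod N × ℝ≥0)} [IsProbabilityMeasure κ]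

lemma hasMean_displacement (φ : ZMod N → ℝ) :
    HasMean (κ.prod M.streamsLaw) (fun y => φ y.1.1) (∑ d, κ.real {y | y.1 = d} * φ d) := by
  have hT : MeasurePreserving (fun y : Move N => y.1.1) (κ.prod M.streamsLaw)
      (κ.map Prod.fst) :=
    (Measurable.measurePreserving measurable_fst κ).comp measurePreserving_fst
  have : IsProbabilityMeasure (κ.map Prod.fst) :=
    Measure.isProbabilityMeasure_map measurable_fst.aemeasurable
  refine HasMean.comp hT ⟨Integrable.of_finite, ?_⟩
  rw [integral_fintype Integrable.of_finite]
  refine Finset.sum_congr rfl fun d _ => ?_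
  rw [smul_eq_mul, Measure.real, Measure.real, Measure.map_apply measurable_fst (by measurability)]
  rfl

omit [IsProbabilityMeasure κ] in
lemma hasMean_duration (h : Integrable (fun y : ZMod N × ℝ≥0 => (y.2 : ℝ)) κ) :
    HasMean (κ.prod M.streamsLaw) (fun y => (y.1.2 : ℝ)) (∫ y, (y.2 : ℝ) ∂κ) :=
  HasMean.comp (T := Prod.fst) (F := fun y : ZMod N × ℝ≥0 => (y.2 : ℝ))
    measurePreserving_fst ⟨h, rfl⟩

lemma hasMean_displacement_mul_arr (hb : Integrable (fun k : ℕ => (k : ℝ)) M.batchLaw)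
    (h : Integrable (fun y : ZMod N × ℝ≥0 => (y.2 : ℝ)) κ) (φ : ZMod N → ℝ) (q : ZMod N) :
    HasMean (κ.prod M.streamsLaw) (fun y => φ y.1.1 * arr q y)
      (∫ y, φ y.1 * (M.rate * y.2) ∂κ) := by
  refine (integrable_prod_of_lintegral (measurable_arr q) (arr_nonneg q) (h.const_mul M.rate)
    (fun x => mul_nonneg M.rate_nonneg x.2.coe_nonneg) fun x => ?_).2 (fun y => φ y.1)
    ((measurable_of_countable φ).comp measurable_fst) ⟨∑ d, ‖φ d‖, fun x =>
      Finset.single_le_sum (f := fun d => ‖φ d‖) (fun _ _ => norm_nonneg _) (Finset.mem_univ x.1)⟩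
  have := (measurePreserving_stream M q).lintegral_comp
    (f := fun a => ENNReal.ofReal (arrived a x.2))
    (measurable_arrived.comp (measurable_id.prodMk measurable_const)).ennreal_ofReal
  simp only [arr]
  rw [this, lintegral_arrived M.batchRate_pos _ hb, Model.rate, Model.b]

lemma hasMean_arr (hb : Integrable (fun k : ℕ => (k : ℝ)) M.batchLaw)
    (h : Integrable (fun y : ZMod N × ℝ≥0 => (y.2 : ℝ)) κ) (q : ZMod N) :
    HasMean (κ.prod M.streamsLaw) (arr q) (M.rate * ∫ y, (y.2 : ℝ) ∂κ) := by
  refine (hasMean_displacement_mul_arr hb h (fun _ => 1) q).congr (fun y => (one_mul _).symm) ?_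
  simp only [one_mul, integral_const_mul]

/-- A sum over all queues of the arrivals, weighted by the place of the queue relative to the
server at the end of the move, does not feel the displacement. -/
lemma hasMean_sum_displacement_arr (hb : Integrable (fun k : ℕ => (k : ℝ)) M.batchLaw)
    (h : Integrable (fun y : ZMod N × ℝ≥0 => (y.2 : ℝ)) κ) (f : ZMod N → ℝ) (i : ZMod N) :
    HasMean (κ.prod M.streamsLaw) (fun y => ∑ q, f (q - i - y.1.1) * arr q y)
      ((∑ s, f s) * (M.rate * ∫ y, (y.2 : ℝ) ∂κ)) := by
  refine (HasMean.sum Finset.univ fun q _ => hasMean_displacement_mul_arr hb h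
    (fun d => f (q - i - d)) q).congr (fun y => rfl) ?_
  rw [← integral_finsetSum _ fun q _ => ?_]
  · simp only [← Finset.sum_mul]
    rw [← integral_const_mul, ← integral_const_mul]
    refine integral_congr_ae (Filter.Eventually.of_forall fun y => ?_)
    simp only
    congr 1
    refine (Fintype.sum_equiv (Equiv.subRight (i + y.1)) _ _ fun q => ?_).symm
    simp [sub_sub]
  · refine (h.const_mul M.rate).bdd_mul (c := ∑ d, ‖f d‖) ?_
      (Filter.Eventually.of_forall fun y => ?_)
    · exact ((measurable_of_countable (fun d => f (q - i - d))).comp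
        measurable_fst).aestronglyMeasurable
    · exact Finset.single_le_sum (f := fun d => ‖f d‖) (fun _ _ => norm_nonneg _)
        (Finset.mem_univ _)

lemma hasMean_arr_mul_arr (hb2 : Integrable (fun k : ℕ => (k : ℝ) ^ 2) M.batchLaw)
    (h2 : Integrable (fun y : ZMod N × ℝ≥0 => (y.2 : ℝ) ^ 2) κ) (q q' : ZMod N) :
    HasMean (κ.prod M.streamsLaw) (fun y => arr q y * arr q' y)
      (M.rate ^ 2 * (∫ y, (y.2 : ℝ) ^ 2 ∂κ) +
        if q = q' then M.batchRate * M.b2 * ∫ y, (y.2 : ℝ) ∂κ else 0) := by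
  have hb := integrable_natCast_of_sq hb2
  have h := integrable_duration_of_sq h2
  set c : ℝ := if q = q' then M.batchRate * M.b2 else 0 with hc
  have hc0 : 0 ≤ c := by
    rw [hc]; split_ifs
    · exact mul_nonneg M.batchRate_pos.le M.b2_nonneg
    · exact le_rfl
  have key := (integrable_prod_of_lintegral (μ := κ) (ν := M.streamsLaw)
    (F := fun y => arr q y * arr q' y) (by fun_prop)
    (fun y => mul_nonneg (arr_nonneg q y) (arr_nonneg q' y))
    (G := fun x => M.rate ^ 2 * (x.2 : ℝ) ^ 2 + c * x.2)
    ((h2.const_mul _).add (h.const_mul _))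
    (fun x => add_nonneg (by positivity) (mul_nonneg hc0 x.2.coe_nonneg)) fun x => ?_).2
    (fun _ => 1) measurable_const ⟨1, by simp⟩
  · refine key.congr (fun y => (one_mul _).symm) ?_
    simp only [one_mul]
    rw [integral_add (h2.const_mul _) (h.const_mul _), integral_const_mul, integral_const_mul, hc]
    split_ifs <;> simp
  · have hm : Measurable fun a => ENNReal.ofReal (arrived a x.2) :=
      (measurable_arrived.comp (measurable_id.prodMk measurable_const)).ennreal_ofReal
    have hm2 : Measurable fun a => ENNReal.ofReal (arrived a x.2 ^ 2) :=
      ((measurable_arrived.comp (measurable_id.prodMk measurable_const)).pow_const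
        2).ennreal_ofReal
    simp only [arr]
    by_cases hq : q = q'
    · subst hq
      have := (measurePreserving_stream M q).lintegral_comp hm2
      simp only [← sq]
      rw [this, lintegral_arrived_sq M.batchRate_pos _ hb hb2 x.2.coe_nonneg, hc, if_pos rfl,
        Model.rate, Model.b, Model.b2]
      congr 1; ring
    · simp only [ENNReal.ofReal_mul (arrived_nonneg _ _)]
      rw [lintegral_mul_streams M hq hm, lintegral_arrived M.batchRate_pos _ hb,
        ← ENNReal.ofReal_pow (by
          exact mul_nonneg (mul_nonneg M.batchRate_pos.le M.b_nonneg) x.2.coe_nonneg),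
        hc, if_neg hq, Model.rate, Model.b]
      congr 1; ring

lemma hasMean_arrAge (hb : Integrable (fun k : ℕ => (k : ℝ)) M.batchLaw)
    (h2 : Integrable (fun y : ZMod N × ℝ≥0 => (y.2 : ℝ) ^ 2) κ) (q : ZMod N) :
    HasMean (κ.prod M.streamsLaw) (arrAge q) (M.rate / 2 * ∫ y, (y.2 : ℝ) ^ 2 ∂κ) := by
  have key := (integrable_prod_of_lintegral (μ := κ) (ν := M.streamsLaw)
    (measurable_arrAge q) (arrAge_nonneg q) (h2.const_mul (M.rate / 2))
    (fun x => mul_nonneg (div_nonneg M.rate_nonneg zero_le_two) (sq_nonneg _)) fun x => ?_).2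
    (fun _ => 1) measurable_const ⟨1, by simp⟩
  · refine key.congr (fun y => (one_mul _).symm) ?_
    simp only [one_mul, integral_const_mul]
  · have := (measurePreserving_stream M q).lintegral_comp
      (f := fun a => ENNReal.ofReal (arrivedAge a x.2))
      (measurable_arrivedAge.comp (measurable_id.prodMk measurable_const)).ennreal_ofReal
    simp only [arrAge]
    rw [this, lintegral_arrivedAge M.batchRate_pos _ hb x.2.coe_nonneg, Model.rate, Model.b]
    congr 1; ring

/-- With positive probability, no customer arrives during a move. -/
lemma measure_no_arrival_ne_zero : (κ.prod M.streamsLaw) {y | ∀ q, arr q y = 0} ≠ 0 := by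
  have hms : MeasurableSet {y : Move N | ∀ q, arr q y = 0} := by
    simp only [Set.ofPred_forall]
    exact MeasurableSet.iInter fun q => measurable_arr q (measurableSet_singleton 0)
  intro h0
  rw [Measure.measure_prod_null hms] at h0
  obtain ⟨m, hm⟩ := h0.exists
  refine absurd hm (ne_of_gt (lt_of_lt_of_le ?_ (measure_mono (s :=
    Set.pi (Finset.univ.image fun q : ZMod N => (q, 0) : Finset (ZMod N × ℕ))
      fun _ => Set.Ioi (m.2 : ℝ) ×ˢ Set.univ) fun a ha q => ?_)))
  · rw [Model.streamsLaw, Measure.infinitePi_pi _ fun _ _ =>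
      measurableSet_Ioi.prod MeasurableSet.univ]
    refine pos_iff_ne_zero.2 (Finset.prod_ne_zero_iff.2 fun _ _ => ?_)
    rw [Measure.prod_prod, measure_univ, mul_one]
    exact (expMeasure_Ioi_pos M.batchRate_pos _).ne'
  · have ha' : (m.2 : ℝ) < (a (q, 0)).1 := by
      have := ha (q, 0) (by simp)
      exact this.1
    have hz : batchCount (fun j => a (q, j)) (m.2 : ℝ) = 0 :=
      Nat.eq_zero_of_le_zero (Nat.sInf_le (by
        change (m.2 : ℝ) < epoch (fun j => a (q, j)) 0
        rw [epoch_zero]; exact ha'))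
    simp [arr, arrived, hz]

end Innovations

/-! ### Functions of a stationary process, and the potential -/

section Stationary

variable {Ω S I : Type*} [MeasurableSpace Ω] [MeasurableSpace S] [MeasurableSpace I]
  {Pr : Measure Ω} [IsProbabilityMeasure Pr] {X₀ X₁ : Ω → ℝ}

omit [IsProbabilityMeasure Pr] in
lemma integral_comp_eq_of_identDistrib (h : IdentDistrib X₁ X₀ Pr Pr) {φ : ℝ → ℝ}
    (hφ : Measurable φ) : ∫ ω, φ (X₁ ω) ∂Pr = ∫ ω, φ (X₀ ω) ∂Pr :=
  (h.comp hφ).integral_eq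

lemma integrable_comp_of_bounded {X : Ω → ℝ} (hX : AEMeasurable X Pr) {φ : ℝ → ℝ}
    (hφ : Measurable φ) {C : ℝ} (hC : ∀ ω, ‖φ (X ω)‖ ≤ C) : Integrable (fun ω => φ (X ω)) Pr :=
  Integrable.of_bound (hφ.comp_aemeasurable hX).aestronglyMeasurable C
    (Filter.Eventually.of_forall hC)

/-- A nonnegative function of a stationary process does not decrease in the mean on a sublevel
set, because its truncation at that level keeps its mean. -/
lemma setIntegral_sub_nonneg (h : IdentDistrib X₁ X₀ Pr Pr) (hX : Measurable X₀)
    (h0 : ∀ ω, 0 ≤ X₀ ω) (h1 : ∀ ω, 0 ≤ X₁ ω) (m : ℝ)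
    (hint : IntegrableOn (fun ω => X₁ ω - X₀ ω) {ω | X₀ ω ≤ m} Pr) :
    0 ≤ ∫ ω in {ω | X₀ ω ≤ m}, (X₁ ω - X₀ ω) ∂Pr := by
  have hms : MeasurableSet {ω | X₀ ω ≤ m} := measurableSet_le hX measurable_const
  have hφ : Measurable fun x : ℝ => min x m := by fun_prop
  have hb : ∀ x : ℝ, 0 ≤ x → ‖min x m‖ ≤ |m| := fun x hx => by
    rw [Real.norm_eq_abs]
    rcases le_total x m with hle | hle
    · rw [min_eq_left hle, abs_of_nonneg hx]; exact hle.trans (le_abs_self m)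
    · rw [min_eq_right hle]
  have i0 := integrable_comp_of_bounded h.aemeasurable_snd hφ fun ω => hb _ (h0 ω)
  have i1 := integrable_comp_of_bounded h.aemeasurable_fst hφ fun ω => hb _ (h1 ω)
  have hz : ∫ ω, (min (X₁ ω) m - min (X₀ ω) m) ∂Pr = 0 := by
    rw [integral_sub i1 i0, integral_comp_eq_of_identDistrib h hφ, sub_self]
  rw [← hz, ← integral_indicator hms]
  refine integral_mono (i1.sub i0) (hint.integrable_indicator hms) fun ω => ?_
  simp only [Set.indicator_apply, Set.mem_ofPred_eq]
  split_ifs with hle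
  · rw [min_eq_left hle]
    linarith [min_le_left (X₁ ω) m]
  · rw [min_eq_right (not_le.1 hle).le]
    linarith [min_le_right (X₁ ω) m]

/-- Integrable increments of a function of a stationary process have mean zero, even when the
function itself is not integrable. -/
lemma integral_sub_eq_zero (h : IdentDistrib X₁ X₀ Pr Pr)
    (hint : Integrable (fun ω => X₁ ω - X₀ ω) Pr) : ∫ ω, (X₁ ω - X₀ ω) ∂Pr = 0 := by
  -- The truncations at level `n` are contractions, so that the increments of the truncated
  -- variables, whose means vanish, are dominated by the given integrable increments.
  let φ : ℕ → ℝ → ℝ := fun n x => max (-(n : ℝ)) (min n x)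
  have hφ : ∀ n, Measurable (φ n) := fun n => by fun_prop
  have hb : ∀ n x, ‖φ n x‖ ≤ n := fun n x => by
    rw [Real.norm_eq_abs, abs_le]
    exact ⟨le_max_left _ _, max_le (by linarith [n.cast_nonneg (α := ℝ)]) (min_le_left _ _)⟩
  have i0 := fun n => integrable_comp_of_bounded h.aemeasurable_snd (hφ n) fun ω => hb n _
  have i1 := fun n => integrable_comp_of_bounded h.aemeasurable_fst (hφ n) fun ω => hb n _
  have hz : ∀ n, ∫ ω, (φ n (X₁ ω) - φ n (X₀ ω)) ∂Pr = 0 := fun n => by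
    rw [integral_sub (i1 n) (i0 n), integral_comp_eq_of_identDistrib h (hφ n), sub_self]
  have hlim : ∀ x, ∀ᶠ n in Filter.atTop, φ n x = x := fun x => by
    obtain ⟨n₀, hn₀⟩ := exists_nat_ge |x|
    filter_upwards [Filter.eventually_ge_atTop n₀] with n hn
    have : |x| ≤ n := hn₀.trans (Nat.cast_le.2 hn)
    rw [abs_le] at this
    simp only [φ]
    rw [min_eq_right this.2, max_eq_right this.1]
  have htend := tendsto_integral_of_dominated_convergence (μ := Pr)
    (F := fun n ω => φ n (X₁ ω) - φ n (X₀ ω)) (f := fun ω => X₁ ω - X₀ ω)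
    (fun ω => ‖X₁ ω - X₀ ω‖) (fun n => ((i1 n).sub (i0 n)).1) hint.norm
    (fun n => Filter.Eventually.of_forall fun ω => ?_)
    (Filter.Eventually.of_forall fun ω => ?_)
  · simp only [hz] at htend
    exact tendsto_nhds_unique htend tendsto_const_nhds
  · simp only [φ, Real.norm_eq_abs]
    rw [max_comm _ (min _ (X₁ ω)), max_comm _ (min _ (X₀ ω)), min_comm _ (X₁ ω),
      min_comm _ (X₀ ω)]
    exact (abs_max_sub_max_le_abs _ _ _).trans (abs_inf_sub_inf_le_abs _ _ _)
  · refine tendsto_const_nhds.congr' ?_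
    filter_upwards [hlim (X₁ ω), hlim (X₀ ω)] with n h1 h0
    rw [h1, h0]

/-- A function of a stationary process that never increases is almost surely constant. -/
lemma ae_eq_of_le_of_identDistrib (h : IdentDistrib X₁ X₀ Pr Pr) (hle : ∀ ω, X₁ ω ≤ X₀ ω) :
    X₁ =ᵐ[Pr] X₀ := by
  -- The variables are made integrable by a bounded and strictly increasing function.
  have hφ : Measurable Real.arctan := Real.measurable_arctan
  have hb : ∀ x, ‖Real.arctan x‖ ≤ Real.pi / 2 := fun x => by
    rw [Real.norm_eq_abs, abs_le]
    exact ⟨(Real.neg_pi_div_two_lt_arctan x).le, (Real.arctan_lt_pi_div_two x).le⟩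
  have i0 := integrable_comp_of_bounded h.aemeasurable_snd hφ fun ω => hb _
  have i1 := integrable_comp_of_bounded h.aemeasurable_fst hφ fun ω => hb _
  have hz : ∫ ω, (Real.arctan (X₀ ω) - Real.arctan (X₁ ω)) ∂Pr = 0 := by
    rw [integral_sub i0 i1, integral_comp_eq_of_identDistrib h hφ, sub_self]
  rw [integral_eq_zero_iff_of_nonneg (fun ω => sub_nonneg.2
    (Real.arctan_mono (hle ω))) (i0.sub i1)] at hz
  filter_upwards [hz] with ω hω
  simp only [Pi.zero_apply, sub_eq_zero] at hω
  exact (Real.arctan_injective hω).symm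

/-- If the innovation `Y` is independent of `X`, a function of both is integrable as soon as it is
dominated by a product of integrable functions. -/
lemma integrable_of_indep {X : Ω → S} {Y : Ω → I} (hX : Measurable X) (hY : Measurable Y)
    (hind : IndepFun X Y Pr) {ν : Measure I} (hν : Pr.map Y = ν) {Ψ : S × I → ℝ}
    (hΨ : Measurable Ψ) {k : S → ℝ} {R : I → ℝ} (hk : Measurable k)
    (hb : ∀ s y, |Ψ (s, y)| ≤ k s * R y)
    (hki : Integrable (fun ω => k (X ω)) Pr) (hR : Integrable R ν) :
    Integrable (fun ω => Ψ (X ω, Y ω)) Pr := by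
  have hjoint := (indepFun_iff_map_prod_eq_prod_map_map hX.aemeasurable hY.aemeasurable).1 hind
  have := Measure.isProbabilityMeasure_map (μ := Pr) hX.aemeasurable
  have := Measure.isProbabilityMeasure_map (μ := Pr) hY.aemeasurable
  rw [hν] at this hjoint
  have h1 : Integrable Ψ ((Pr.map X).prod ν) := by
    refine Integrable.mono' (Integrable.mul_prod (f := k) (g := R) ?_ hR)
      hΨ.aestronglyMeasurable (Filter.Eventually.of_forall fun p => hb p.1 p.2)
    exact (integrable_map_measure hk.aestronglyMeasurable hX.aemeasurable).2 hki
  rw [← hjoint] at h1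
  exact h1.comp_measurable (hX.prodMk hY)

/-- If `Y` is independent of `X`, the mean of `Ψ (X, Y)` is computed by first averaging over `Y`. -/
lemma integral_of_indep {X : Ω → S} {Y : Ω → I} (hX : Measurable X) (hY : Measurable Y)
    (hind : IndepFun X Y Pr) {ν : Measure I} (hν : Pr.map Y = ν) {Ψ : S × I → ℝ}
    (hΨ : Measurable Ψ) {D : S → ℝ} (hD : ∀ s, HasMean ν (fun y => Ψ (s, y)) (D s))
    (hint : Integrable (fun ω => Ψ (X ω, Y ω)) Pr) :
    HasMean Pr (fun ω => D (X ω)) (∫ ω, Ψ (X ω, Y ω) ∂Pr) := by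
  have hjoint := (indepFun_iff_map_prod_eq_prod_map_map hX.aemeasurable hY.aemeasurable).1 hind
  have := Measure.isProbabilityMeasure_map (μ := Pr) hX.aemeasurable
  have := Measure.isProbabilityMeasure_map (μ := Pr) hY.aemeasurable
  rw [hν] at this hjoint
  have h1 : Integrable Ψ ((Pr.map X).prod ν) := by
    rw [← hjoint]
    exact (integrable_map_measure hΨ.aestronglyMeasurable (hX.prodMk hY).aemeasurable).2 hint
  have hDe : D = fun s => ∫ y, Ψ (s, y) ∂ν := funext fun s => (hD s).2.symm
  have h2 : Integrable D (Pr.map X) := by rw [hDe]; exact h1.integral_prod_left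
  refine ⟨h2.comp_measurable hX, ?_⟩
  rw [← integral_map hX.aemeasurable h2.1, hDe, ← integral_prod _ h1, ← hjoint,
    integral_map (hX.prodMk hY).aemeasurable hΨ.aestronglyMeasurable]

end Stationary

section Potential

variable {N : ℕ} [NeZero N] {M : Model N}

/-- A quadratic form in the queue lengths `Q`, with kernel `g`, plus a linear form whose
coefficients depend through `f` on the place of the queues relative to the server at `i`. -/
noncomputable def potential (f g : ZMod N → ℝ) (i : ZMod N) (Q : ZMod N → ℝ) : ℝ :=
  (∑ q, ∑ q', g (q' - q) * (Q q * Q q')) / 2 + ∑ q, f (q - i) * Q q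

/-- The queue lengths after a move from `i`, where `e` customers have been served. -/
noncomputable def lengthsAfter (e : ℝ) (i : ZMod N) (Q : ZMod N → ℝ) (y : Move N) : ZMod N → ℝ :=
  fun q => Q q + (arr q y - if q = i then e else 0)

lemma sum_sub_right (g : ZMod N → ℝ) (q : ZMod N) : ∑ q', g (q' - q) = ∑ s, g s :=
  Fintype.sum_equiv (Equiv.subRight q) _ _ fun _ => rfl

/-- Exact increment of the potential when the server moves by `d` and the queue lengths change
by `δ`. -/
lemma potential_increment {f g : ZMod N → ℝ} (hg : ∀ s, g (-s) = g s) (i d : ZMod N)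
    (Q δ : ZMod N → ℝ) :
    potential f g (i + d) (fun q => Q q + δ q) - potential f g i Q =
      ∑ q', (∑ q, Q q * g (q' - q)) * δ q' + (∑ q, ∑ q', g (q' - q) * (δ q * δ q')) / 2
        + ∑ q, Q q * f (q - i - d) + ∑ q, f (q - i - d) * δ q - ∑ q, f (q - i) * Q q := by
  have h1 : ∑ q, ∑ q', g (q' - q) * (δ q * Q q') = ∑ q, ∑ q', g (q' - q) * (Q q * δ q') := by
    rw [Finset.sum_comm]
    refine Finset.sum_congr rfl fun q _ => Finset.sum_congr rfl fun q' _ => ?_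
    rw [← hg, neg_sub]; ring
  have h2 : ∑ q', (∑ q, Q q * g (q' - q)) * δ q' = ∑ q, ∑ q', g (q' - q) * (Q q * δ q') := by
    rw [Finset.sum_comm]
    simp only [Finset.sum_mul]
    refine Finset.sum_congr rfl fun q _ => Finset.sum_congr rfl fun q' _ => ?_
    ring
  have h3 : ∑ q, ∑ q', g (q' - q) * ((Q q + δ q) * (Q q' + δ q')) =
      ∑ q, ∑ q', g (q' - q) * (Q q * Q q') + ∑ q, ∑ q', g (q' - q) * (Q q * δ q') +
      ∑ q, ∑ q', g (q' - q) * (δ q * Q q') + ∑ q, ∑ q', g (q' - q) * (δ q * δ q') := by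
    simp only [← Finset.sum_add_distrib]
    refine Finset.sum_congr rfl fun q _ => Finset.sum_congr rfl fun q' _ => ?_
    ring
  have h4 : ∑ q, f (q - (i + d)) * (Q q + δ q) =
      ∑ q, Q q * f (q - i - d) + ∑ q, f (q - i - d) * δ q := by
    rw [← Finset.sum_add_distrib]
    refine Finset.sum_congr rfl fun q _ => ?_
    rw [sub_sub]; ring
  simp only [potential]
  rw [h3, h4, h1, h2]
  ring

/-- Mean increment of the potential over one move from `i`, during which `e` customers are served.
The linear form contributes nothing through the arrivals, because `f` has sum zero. -/
lemma hasMean_potential_move {κ : Measure (ZMod N × ℝ≥0)} [IsProbabilityMeasure κ]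
    (hb2 : Integrable (fun k : ℕ => (k : ℝ) ^ 2) M.batchLaw)
    (h2 : Integrable (fun y : ZMod N × ℝ≥0 => (y.2 : ℝ) ^ 2) κ)
    {f g : ZMod N → ℝ} (hg : ∀ s, g (-s) = g s) (hf : ∑ s, f s = 0) (e : ℝ) (i : ZMod N)
    (Q : ZMod N → ℝ) :
    HasMean (κ.prod M.streamsLaw)
      (fun y => potential f g (i + y.1.1) (lengthsAfter e i Q y) - potential f g i Q)
      (∑ q, Q q * ((∑ s, g s) * (M.rate * ∫ y, (y.2 : ℝ) ∂κ) - e * g (q - i)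
          + (∑ d, κ.real {y | y.1 = d} * f (q - i - d) - f (q - i)))
        + (N * (∑ s, g s) * (M.rate ^ 2 * ∫ y, (y.2 : ℝ) ^ 2 ∂κ) / 2
          + N * g 0 * (M.batchRate * M.b2 * ∫ y, (y.2 : ℝ) ∂κ) / 2
          - e * (∑ s, g s) * (M.rate * ∫ y, (y.2 : ℝ) ∂κ) + e ^ 2 * g 0 / 2
          - e * ∑ d, κ.real {y | y.1 = d} * f (-d))) := by
  have hb := integrable_natCast_of_sq hb2
  have h := integrable_duration_of_sq h2
  set G := ∑ s, g s with hG
  set τ := ∫ y, (y.2 : ℝ) ∂κ with hτ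
  set τ2 := ∫ y, (y.2 : ℝ) ^ 2 ∂κ
  have mδ : ∀ q, HasMean (κ.prod M.streamsLaw) (fun y => arr q y - if q = i then e else 0)
      (M.rate * τ - if q = i then e else 0) := fun q => (hasMean_arr hb h q).sub (HasMean.const _)
  have mδδ : ∀ q q', HasMean (κ.prod M.streamsLaw)
      (fun y => (arr q y - if q = i then e else 0) * (arr q' y - if q' = i then e else 0))
      (M.rate ^ 2 * τ2 + (if q = q' then M.batchRate * M.b2 * τ else 0)
        - (if q = i then e else 0) * (M.rate * τ) - (if q' = i then e else 0) * (M.rate * τ)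
        + (if q = i then e else 0) * (if q' = i then e else 0)) := fun q q' =>
    ((((hasMean_arr_mul_arr hb2 h2 q q').sub ((hasMean_arr hb h q').const_mul _)).sub
      ((hasMean_arr hb h q).const_mul _)).add (HasMean.const _)).congr (fun y => by ring) rfl
  have m1 : HasMean (κ.prod M.streamsLaw)
      (fun y => ∑ q', (∑ q, Q q * g (q' - q)) * (arr q' y - if q' = i then e else 0)) _ :=
    HasMean.sum Finset.univ fun q' _ => (mδ q').const_mul _
  have m2 : HasMean (κ.prod M.streamsLaw)
      (fun y => (1 / 2 : ℝ) * ∑ q, ∑ q', g (q' - q) *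
        ((arr q y - if q = i then e else 0) * (arr q' y - if q' = i then e else 0))) _ :=
    (HasMean.sum Finset.univ fun q _ => HasMean.sum Finset.univ fun q' _ =>
      (mδδ q q').const_mul _).const_mul _
  have m3 : HasMean (κ.prod M.streamsLaw) (fun y => ∑ q, Q q * f (q - i - y.1.1)) _ :=
    HasMean.sum Finset.univ fun q _ =>
      (hasMean_displacement (M := M) (κ := κ) fun d => f (q - i - d)).const_mul _
  have m4 : HasMean (κ.prod M.streamsLaw) (fun y => ∑ q, f (q - i - y.1.1) *
      (arr q y - if q = i then e else 0)) (0 - e * ∑ d, κ.real {y | y.1 = d} * f (-d)) := by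
    have ha := hasMean_sum_displacement_arr hb h f i
    rw [hf, zero_mul] at ha
    refine (ha.sub ((hasMean_displacement (M := M) (κ := κ) fun d => f (-d)).const_mul e)).congr
      (fun y => ?_) rfl
    simp only [mul_sub, Finset.sum_sub_distrib, mul_ite, mul_zero, Finset.sum_ite_eq',
      Finset.mem_univ, if_true, sub_self, zero_sub]
    ring
  refine ((((m1.add m2).add m3).add m4).sub (HasMean.const (∑ q, f (q - i) * Q q))).congr
    (fun y => ?_) ?_
  · unfold lengthsAfter
    rw [potential_increment hg]
    ring
  · have s1 : ∑ q', (∑ q, Q q * g (q' - q)) * (M.rate * τ - if q' = i then e else 0) =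
        ∑ q, Q q * (G * (M.rate * τ) - e * g (q - i)) := by
      simp only [mul_sub, Finset.sum_sub_distrib, mul_ite, mul_zero, Finset.sum_ite_eq',
        Finset.mem_univ, if_true]
      congr 1
      · simp only [Finset.sum_mul]
        rw [Finset.sum_comm]
        refine Finset.sum_congr rfl fun q _ => ?_
        rw [hG, ← sum_sub_right g q, Finset.sum_mul, Finset.mul_sum]
        exact Finset.sum_congr rfl fun _ _ => by ring
      · rw [Finset.sum_mul]
        refine Finset.sum_congr rfl fun q _ => ?_
        rw [← hg, neg_sub]; ring
    have s2 : ∑ q, ∑ q', g (q' - q) * (M.rate ^ 2 * τ2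
        + (if q = q' then M.batchRate * M.b2 * τ else 0)
        - (if q = i then e else 0) * (M.rate * τ) - (if q' = i then e else 0) * (M.rate * τ)
        + (if q = i then e else 0) * (if q' = i then e else 0)) =
        N * G * (M.rate ^ 2 * τ2) + N * g 0 * (M.batchRate * M.b2 * τ)
          - 2 * (e * G * (M.rate * τ)) + e ^ 2 * g 0 := by
      have hG' : ∀ q, ∑ q', g (q' - q) = G := sum_sub_right g
      have hG'' : ∑ q, g (i - q) = G := by
        rw [hG]; exact Fintype.sum_equiv (Equiv.subLeft i) _ _ fun _ => rfl
      simp only [mul_add, mul_sub, Finset.sum_add_distrib, Finset.sum_sub_distrib,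
        ← Finset.sum_mul, hG', mul_ite, ite_mul, mul_zero, zero_mul, Finset.sum_ite_eq,
        Finset.sum_ite_eq', Finset.mem_univ, if_true, sub_self, Finset.sum_const, Finset.card_univ,
        ZMod.card, nsmul_eq_mul]
      have hs : ∀ (q : ZMod N) (c : ℝ), ∑ q', (if q = i then g (q' - q) * c else 0) =
          if q = i then G * c else 0 := fun q c => by
        split_ifs
        · rw [← Finset.sum_mul, hG']
        · simp
      simp only [hs, Finset.sum_ite_eq', Finset.mem_univ, if_true, hG'']
      ring
    rw [s1, s2]
    have s3 : ∀ q, Q q * (G * (M.rate * τ) - e * g (q - i)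
          + (∑ d, κ.real {y | y.1 = d} * f (q - i - d) - f (q - i))) =
        Q q * (G * (M.rate * τ) - e * g (q - i)) +
          Q q * (∑ d, κ.real {y | y.1 = d} * f (q - i - d)) - f (q - i) * Q q := fun q => by ring
    simp only [s3, Finset.sum_add_distrib, Finset.sum_sub_distrib]
    ring

end Potential

/-! ### The chain of configurations -/

section Config

variable {N : ℕ} [NeZero N] (M : Model N)

/-- Place of the server and queue lengths: a countable projection of the state that is itself a
Markov chain. -/
abbrev Config (N : ℕ) : Type := ZMod N × (ZMod N → ℕ)

/-- The configuration of a state. -/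
def State.config (z : State N) : Config N := (z.1, fun q => (z.2 q).length)

namespace Config

variable (c : Config N)

/-- The number of customers, `0` or `1`, served from the polled queue. -/
noncomputable def served : ℝ := if c.2 c.1 = 0 then 0 else 1

/-- Queue lengths as real numbers. -/
def lengths : ZMod N → ℝ := fun q => c.2 q

/-- Total number of waiting customers. -/
def total : ℝ := ∑ q, c.lengths q

/-- The part of an innovation that is used in a given configuration. -/
def moveOf (x : Innovation N) : Move N := (if c.2 c.1 = 0 then x.2.1 else x.1, x.2.2)

/-- Law of the move used in a given configuration. -/
noncomputable def moveLaw : Measure (ZMod N × ℝ≥0) := if c.2 c.1 = 0 then M.moveEmpty else M.move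

/-- Mean duration of the move used in a given configuration. -/
noncomputable def meanDuration : ℝ := ∫ y, (y.2 : ℝ) ∂(c.moveLaw M)

/-- Increment of the potential over one step. -/
noncomputable def potentialIncrement (f g : ZMod N → ℝ) (x : Innovation N) : ℝ :=
  potential f g (c.1 + (c.moveOf x).1.1) (lengthsAfter c.served c.1 c.lengths (c.moveOf x)) -
    potential f g c.1 c.lengths

end Config

instance (c : Config N) : IsProbabilityMeasure (c.moveLaw M) := by
  unfold Config.moveLaw; split_ifs <;> infer_instance

instance : IsProbabilityMeasure M.innovationLaw := by
  change IsProbabilityMeasure (M.move.prod (M.moveEmpty.prod M.streamsLaw))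
  infer_instance

lemma measurePreserving_busyMove : MeasurePreserving (fun x : Innovation N => (x.1, x.2.2))
    M.innovationLaw (M.move.prod M.streamsLaw) :=
  (MeasurePreserving.id M.move).prod measurePreserving_snd

omit [NeZero N] in
lemma measurePreserving_emptyMove : MeasurePreserving (fun x : Innovation N => x.2)
    M.innovationLaw (M.moveEmpty.prod M.streamsLaw) := measurePreserving_snd

lemma measurePreserving_moveOf (c : Config N) :
    MeasurePreserving c.moveOf M.innovationLaw ((c.moveLaw M).prod M.streamsLaw) := by
  unfold Config.moveOf Config.moveLaw
  split_ifs
  · exact measurePreserving_emptyMove M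
  · exact measurePreserving_busyMove M

omit [NeZero N] in
lemma measurable_moveOf (c : Config N) : Measurable c.moveOf := by
  unfold Config.moveOf
  split_ifs <;> fun_prop

lemma measurable_length : Measurable (fun l : List ℝ => l.length) :=
  measurable_fst.comp (comap_measurable (fun l : List ℝ => (l.length, fun i : ℕ => l.getD i 0)))

omit [NeZero N] in
lemma measurable_config : Measurable (State.config : State N → Config N) :=
  Measurable.prodMk measurable_fst (measurable_pi_lambda _ fun q =>
    measurable_length.comp ((measurable_pi_apply q).comp measurable_snd))

omit [NeZero N] in
lemma config_step_fst (z : State N) (x : Innovation N) :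
    (step z x).config.1 = z.config.1 + (z.config.moveOf x).1.1 := by
  by_cases h : z.2 z.1 = [] <;> simp [State.config, step, Config.moveOf, h]

omit [NeZero N] in
lemma step_snd (z : State N) (x : Innovation N) (q : ZMod N) :
    (step z x).2 q = ((if q = z.1 then (z.2 q).tail else z.2 q).map
        (fun age => age + ((z.config.moveOf x).1.2 : ℝ)))
      ++ arrivals (fun j => x.2.2 (q, j)) ((z.config.moveOf x).1.2 : ℝ) := by
  by_cases h : z.2 z.1 = [] <;> simp [State.config, step, Config.moveOf, h]

omit [NeZero N] in
lemma lengths_step (z : State N) (x : Innovation N) :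
    (step z x).config.lengths =
      lengthsAfter z.config.served z.config.1 z.config.lengths (z.config.moveOf x) := by
  ext q
  simp only [Config.lengths, lengthsAfter, State.config, arr, Config.served]
  rw [step_snd, List.length_append, List.length_map, Nat.cast_add, length_arrivals, add_comm,
    add_sub_assoc', add_comm]
  simp only [Config.moveOf]
  rw [add_sub_right_comm]
  congr 1
  by_cases hq : q = z.1
  · subst hq
    by_cases h0 : (z.2 z.1).length = 0
    · simp [h0]
    · simp only [if_true]
      rw [List.length_tail, Nat.cast_sub (Nat.one_le_iff_ne_zero.2 h0), Nat.cast_one]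
      exact congrArg _ (if_neg h0).symm
  · simp [hq]

lemma potential_step (f g : ZMod N → ℝ) (z : State N) (x : Innovation N) :
    potential f g (step z x).config.1 (step z x).config.lengths -
      potential f g z.config.1 z.config.lengths = z.config.potentialIncrement f g x := by
  rw [lengths_step, config_step_fst, Config.potentialIncrement]

lemma total_lengthsAfter (e : ℝ) (i : ZMod N) (Q : ZMod N → ℝ) (y : Move N) :
    ∑ q, lengthsAfter e i Q y q = ∑ q, Q q + (∑ q, arr q y - e) := by
  simp [lengthsAfter, Finset.sum_add_distrib, Finset.sum_sub_distrib]

lemma total_step (z : State N) (x : Innovation N) : (step z x).config.total =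
    z.config.total + (∑ q, arr q (z.config.moveOf x) - z.config.served) := by
  rw [Config.total, lengths_step, total_lengthsAfter, Config.total]

lemma Config.total_nonneg (c : Config N) : 0 ≤ c.total :=
  Finset.sum_nonneg fun _ _ => Nat.cast_nonneg _

omit [NeZero N] in
lemma Config.served_mem (c : Config N) : 0 ≤ c.served ∧ c.served ≤ 1 := by
  unfold Config.served; split_ifs <;> norm_num

/-- A random variable that dominates the increments of all queue lengths and their products. -/
noncomputable def arrBound (x : Innovation N) : ℝ :=
  (1 + ∑ q, arr q (x.1, x.2.2)) ^ 2 + (1 + ∑ q, arr q x.2) ^ 2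

lemma arr_bound_le (c : Config N) (x : Innovation N) :
    (1 + ∑ q, arr q (c.moveOf x)) ^ 2 ≤ arrBound x := by
  unfold arrBound Config.moveOf
  split_ifs
  · exact le_add_of_nonneg_left (sq_nonneg _)
  · exact le_add_of_nonneg_right (sq_nonneg _)

lemma one_le_sum_arr (y : Move N) : 1 ≤ 1 + ∑ q, arr q y :=
  le_add_of_nonneg_right (Finset.sum_nonneg fun q _ => arr_nonneg q y)

variable {M}

lemma integrable_sum_arr_sq {κ : Measure (ZMod N × ℝ≥0)} [IsProbabilityMeasure κ]
    (hb2 : Integrable (fun k : ℕ => (k : ℝ) ^ 2) M.batchLaw)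
    (h2 : Integrable (fun y : ZMod N × ℝ≥0 => (y.2 : ℝ) ^ 2) κ) :
    Integrable (fun y => (1 + ∑ q, arr q y) ^ 2) (κ.prod M.streamsLaw) := by
  have h1 := HasMean.sum Finset.univ fun q (_ : q ∈ Finset.univ) =>
    hasMean_arr (M := M) (integrable_natCast_of_sq hb2) (integrable_duration_of_sq h2) q
  have h3 := HasMean.sum Finset.univ fun q (_ : q ∈ Finset.univ) =>
    HasMean.sum Finset.univ fun q' (_ : q' ∈ Finset.univ) =>
      hasMean_arr_mul_arr (M := M) hb2 h2 q q'
  refine (((HasMean.const 1).add (h1.const_mul 2)).add h3).1.congr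
    (Filter.Eventually.of_forall fun y => ?_)
  simp only
  rw [← Finset.sum_mul_sum]
  ring

lemma integrable_arrBound (hb2 : Integrable (fun k : ℕ => (k : ℝ) ^ 2) M.batchLaw)
    (htau2 : Integrable (fun y : ZMod N × ℝ≥0 => (y.2 : ℝ) ^ 2) M.move)
    (htauEmpty2 : Integrable (fun y : ZMod N × ℝ≥0 => (y.2 : ℝ) ^ 2) M.moveEmpty) :
    Integrable arrBound M.innovationLaw :=
  ((measurePreserving_busyMove M).integrable_comp_of_integrable
    (integrable_sum_arr_sq hb2 htau2)).add
  ((measurePreserving_emptyMove M).integrable_comp_of_integrable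
    (integrable_sum_arr_sq hb2 htauEmpty2))

/-- The increments of the potential grow at most linearly with the queue lengths. -/
lemma abs_potentialIncrement_le {f g : ZMod N → ℝ} (hg : ∀ s, g (-s) = g s) (c : Config N)
    (x : Innovation N) :
    |c.potentialIncrement f g x| ≤
      ((∑ s, |f s| + ∑ s, |g s|) * (N ^ 2 + N + 2) * (1 + c.total)) * arrBound x := by
  set C := ∑ s, |f s| + ∑ s, |g s| with hC
  have hC0 : 0 ≤ C := add_nonneg (Finset.sum_nonneg fun _ _ => abs_nonneg _)
    (Finset.sum_nonneg fun _ _ => abs_nonneg _)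
  have hfC : ∀ s, |f s| ≤ C := fun s =>
    (Finset.single_le_sum (f := fun s => |f s|) (fun _ _ => abs_nonneg _)
      (Finset.mem_univ s)).trans (le_add_of_nonneg_right
      (Finset.sum_nonneg fun _ _ => abs_nonneg _))
  have hgC : ∀ s, |g s| ≤ C := fun s =>
    (Finset.single_le_sum (f := fun s => |g s|) (fun _ _ => abs_nonneg _)
      (Finset.mem_univ s)).trans (le_add_of_nonneg_left
      (Finset.sum_nonneg fun _ _ => abs_nonneg _))
  set y := c.moveOf x with hy
  set B := 1 + ∑ q, arr q y with hB
  have hB1 : 1 ≤ B := one_le_sum_arr y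
  set Y := c.total with hY
  have hY0 : 0 ≤ Y := c.total_nonneg
  set Q := c.lengths with hQ
  have hQ0 : ∀ q, 0 ≤ Q q := fun q => Nat.cast_nonneg _
  set δ : ZMod N → ℝ := fun q => arr q y - if q = c.1 then c.served else 0 with hδ
  have hδB : ∀ q, |δ q| ≤ B := fun q => by
    have h1 : arr q y ≤ ∑ q, arr q y :=
      Finset.single_le_sum (fun q _ => arr_nonneg q y) (Finset.mem_univ q)
    have h2 := arr_nonneg q y
    have h3 := c.served_mem
    rw [abs_le, hδ]
    dsimp only
    split_ifs <;> constructor <;> linarith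
  have hN : (0 : ℝ) ≤ N := Nat.cast_nonneg _
  have e := potential_increment hg c.1 y.1.1 Q δ (f := f)
  have t1 : |∑ q', (∑ q, Q q * g (q' - q)) * δ q'| ≤ N * (Y * C * B) := by
    refine (Finset.abs_sum_le_sum_abs _ _).trans ((Finset.sum_le_card_nsmul _ _ (Y * C * B)
      fun q' _ => ?_).trans (by simp [ZMod.card]))
    rw [abs_mul]
    refine mul_le_mul ((Finset.abs_sum_le_sum_abs _ _).trans ?_) (hδB _) (abs_nonneg _)
      (by positivity)
    rw [hY, Config.total, Finset.sum_mul]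
    refine Finset.sum_le_sum fun q _ => ?_
    rw [abs_mul, abs_of_nonneg (hQ0 q)]
    exact mul_le_mul_of_nonneg_left (hgC _) (hQ0 q)
  have t2 : |∑ q, ∑ q', g (q' - q) * (δ q * δ q')| ≤ N * (N * (C * (B * B))) := by
    refine (Finset.abs_sum_le_sum_abs _ _).trans ((Finset.sum_le_card_nsmul _ _
      (N * (C * (B * B))) fun q _ => ?_).trans (by simp [ZMod.card]))
    refine (Finset.abs_sum_le_sum_abs _ _).trans ((Finset.sum_le_card_nsmul _ _
      (C * (B * B)) fun q' _ => ?_).trans (by simp [ZMod.card]))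
    rw [abs_mul, abs_mul]
    exact mul_le_mul (hgC _) (mul_le_mul (hδB _) (hδB _) (abs_nonneg _) (by linarith))
      (by positivity) hC0
  have t3 : |∑ q, Q q * f (q - c.1 - y.1.1)| ≤ Y * C := by
    refine (Finset.abs_sum_le_sum_abs _ _).trans ?_
    rw [hY, Config.total, Finset.sum_mul]
    refine Finset.sum_le_sum fun q _ => ?_
    rw [abs_mul, abs_of_nonneg (hQ0 q)]
    exact mul_le_mul_of_nonneg_left (hfC _) (hQ0 q)
  have t4 : |∑ q, f (q - c.1 - y.1.1) * δ q| ≤ N * (C * B) := by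
    refine (Finset.abs_sum_le_sum_abs _ _).trans ((Finset.sum_le_card_nsmul _ _ (C * B)
      fun q' _ => ?_).trans (by simp [ZMod.card]))
    rw [abs_mul]
    exact mul_le_mul (hfC _) (hδB _) (abs_nonneg _) hC0
  have t5 : |∑ q, f (q - c.1) * Q q| ≤ C * Y := by
    refine (Finset.abs_sum_le_sum_abs _ _).trans ?_
    rw [hY, Config.total, Finset.mul_sum]
    refine Finset.sum_le_sum fun q _ => ?_
    rw [abs_mul, abs_of_nonneg (hQ0 q)]
    exact mul_le_mul_of_nonneg_right (hfC _) (hQ0 q)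
  have hle : |c.potentialIncrement f g x| ≤
      N * (Y * C * B) + N * (N * (C * (B * B))) + Y * C + N * (C * B) + C * Y := by
    have he : c.potentialIncrement f g x = _ := e
    rw [he, abs_le]
    rw [abs_le] at t1 t2 t3 t4 t5
    have : 0 ≤ N * (N * (C * (B * B))) := by positivity
    constructor <;> linarith [t1.1, t1.2, t2.1, t2.2, t3.1, t3.2, t4.1, t4.2, t5.1, t5.2]
  refine hle.trans (le_trans ?_ (mul_le_mul_of_nonneg_left (arr_bound_le c x) (by positivity)))
  rw [← hy, ← hB]
  have hBB : B ≤ B ^ 2 := by nlinarith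
  have hB2 : 1 ≤ B ^ 2 := by nlinarith
  have e1 : N * (Y * C * B) ≤ C * (N * Y) * B ^ 2 := by
    have := mul_le_mul_of_nonneg_left hBB (show 0 ≤ C * (N * Y) by positivity)
    linarith
  have e3 : Y * C ≤ C * Y * B ^ 2 := by
    have := mul_le_mul_of_nonneg_left hB2 (show 0 ≤ C * Y by positivity)
    linarith
  have e4 : N * (C * B) ≤ C * N * B ^ 2 := by
    have := mul_le_mul_of_nonneg_left hBB (show 0 ≤ C * N by positivity)
    linarith
  have e8 : 0 ≤ C * ((N : ℝ) ^ 2 * Y) * B ^ 2 := by positivity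
  have e9 : 0 ≤ C * B ^ 2 := by positivity
  linarith [e1, e3, e4, e8, e9]

omit [NeZero N] in
lemma measurable_lengthsAfter (e : ℝ) (i : ZMod N) (Q : ZMod N → ℝ) (q : ZMod N) :
    Measurable fun y : Move N => lengthsAfter e i Q y q :=
  measurable_const.add ((measurable_arr q).sub measurable_const)

lemma measurable_potentialIncrement (f g : ZMod N → ℝ) :
    Measurable fun p : Config N × Innovation N => p.1.potentialIncrement f g p.2 := by
  refine measurable_from_prod_countable_right fun c => ?_
  have h : Measurable fun y : Move N => potential f g (c.1 + y.1.1)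
      (lengthsAfter c.served c.1 c.lengths y) - potential f g c.1 c.lengths := by
    refine Measurable.sub ?_ measurable_const
    unfold potential
    refine Measurable.add (Measurable.div_const (Finset.measurable_fun_sum _ fun q _ =>
      Finset.measurable_fun_sum _ fun q' _ => ?_) _) (Finset.measurable_fun_sum _ fun q _ => ?_)
    · exact measurable_const.mul
        ((measurable_lengthsAfter _ _ _ q).mul (measurable_lengthsAfter _ _ _ q'))
    · exact ((measurable_of_countable fun d => f (q - (c.1 + d))).comp
        (measurable_fst.comp measurable_fst)).mul (measurable_lengthsAfter _ _ _ q)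
  exact h.comp (measurable_moveOf c)

end Config

/-! ### Drift and stability -/

section Chain

variable {N : ℕ} [NeZero N]

/-- The second moments of the batch sizes and of the durations of moves are finite. -/
structure FiniteMoments (M : Model N) : Prop where
  batch : Integrable (fun k : ℕ => (k : ℝ) ^ 2) M.batchLaw
  move : Integrable (fun y : ZMod N × ℝ≥0 => (y.2 : ℝ) ^ 2) M.move
  moveEmpty : Integrable (fun y : ZMod N × ℝ≥0 => (y.2 : ℝ) ^ 2) M.moveEmpty

/-- `f` solves the Poisson equation for the displacements of the server from empty queues, and the
kernel `g` is given by the drift of `f` under the displacements from non-empty queues. -/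
structure IsPotential (M : Model N) (f g : ZMod N → ℝ) : Prop where
  poisson : ∀ s, ∑ d, M.pEmpty d * f (s - d) - f s =
    M.tauEmpty * (if s = 0 then (N : ℝ) else 0) - M.tauEmpty
  kernel : ∀ s, g s = M.tau + (∑ d, M.p d * f (s - d) - f s)
  even : ∀ s, g (-s) = g s
  sum_eq_zero : ∑ s, f s = 0
  posSemidef : ∀ Q : ZMod N → ℝ, 0 ≤ ∑ q, ∑ q', (g (q' - q) - M.tau) * (Q q * Q q')

/-- One step of the system in stationary regime. -/
structure IsStationaryStep {Ω : Type*} [MeasurableSpace Ω] (M : Model N) (Pr : Measure Ω)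
    (z : Ω → State N) (x : Ω → Innovation N) : Prop where
  measurable_state : Measurable z
  measurable_innovation : Measurable x
  innovation_law : Pr.map x = M.innovationLaw
  indep : IndepFun z x Pr
  identDistrib : IdentDistrib (fun ω => step (z ω) (x ω)) z Pr Pr

variable {M : Model N} {f g : ZMod N → ℝ}

omit [NeZero N] in
lemma FiniteMoments.moveLaw (hM : FiniteMoments M) (c : Config N) :
    Integrable (fun y : ZMod N × ℝ≥0 => (y.2 : ℝ) ^ 2) (c.moveLaw M) := by
  unfold Config.moveLaw
  split_ifs
  exacts [hM.moveEmpty, hM.move]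

omit [NeZero N] in
lemma Model.tau_nonneg : 0 ≤ M.tau := integral_nonneg fun y => y.2.coe_nonneg

lemma IsPotential.sum_kernel (h : IsPotential M f g) : ∑ s, g s = N * M.tau := by
  have h1 : ∑ s, ∑ d, M.p d * f (s - d) = 0 := by
    rw [Finset.sum_comm]
    refine Finset.sum_eq_zero fun d _ => ?_
    rw [← Finset.mul_sum, sum_sub_right f d, h.sum_eq_zero, mul_zero]
  rw [Finset.sum_congr rfl fun s _ => h.kernel s, Finset.sum_add_distrib,
    Finset.sum_sub_distrib, h1, h.sum_eq_zero]
  simp [ZMod.card]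

/-- The part of the mean increment of the potential that does not depend on the queue lengths, when
the polled queue is empty. The parameter `ε` is added to the kernel. -/
noncomputable def driftEmpty (M : Model N) (g : ZMod N → ℝ) (ε : ℝ) : ℝ :=
  N * (N * (M.tau + ε)) * (M.rate ^ 2 * M.tauEmpty2) / 2 +
    N * (g 0 + ε) * (M.batchRate * M.b2 * M.tauEmpty) / 2

/-- The part of the mean increment of the potential that does not depend on the queue lengths, when
the polled queue is not empty. The parameter `ε` is added to the kernel. -/
noncomputable def driftBusy (M : Model N) (f g : ZMod N → ℝ) (ε : ℝ) : ℝ :=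
  N * (N * (M.tau + ε)) * (M.rate ^ 2 * M.tau2) / 2 +
    N * (g 0 + ε) * (M.batchRate * M.b2 * M.tau) / 2 - N * (M.tau + ε) * (M.rate * M.tau) +
    (g 0 + ε) / 2 - (g 0 - M.tau + f 0)

/-- Mean increment of the potential: the choice of `f` and `g` makes it depend on the queue lengths
through their sum only. -/
lemma hasMean_potentialIncrement (hM : FiniteMoments M) (h : IsPotential M f g) (ε : ℝ)
    (c : Config N) :
    HasMean M.innovationLaw (fun x => c.potentialIncrement f (fun s => g s + ε) x)
      (if c.2 c.1 = 0 then
        -(M.tauEmpty * (1 - N * M.rate * M.tau - N * M.rate * ε)) * c.total + driftEmpty M g ε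
      else -((1 - N * M.rate * M.tau) * (M.tau + ε)) * c.total + driftBusy M f g ε) := by
  have key := (hasMean_potential_move (M := M) hM.batch (hM.moveLaw c)
    (g := fun s => g s + ε) (fun s => by rw [h.even]) h.sum_eq_zero c.served c.1 c.lengths).comp
    (measurePreserving_moveOf M c)
  refine key.congr (fun x => rfl) ?_
  have hG : ∑ s, (g s + ε) = N * (M.tau + ε) := by
    rw [Finset.sum_add_distrib, h.sum_kernel]
    simp [ZMod.card]
    ring
  rw [hG]
  have hf0 : ∑ d, M.p d * f (-d) = g 0 - M.tau + f 0 := by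
    have := h.kernel 0
    simp only [zero_sub] at this
    linarith
  split_ifs with h0
  · have hz : c.lengths c.1 = 0 := by simp [Config.lengths, h0]
    have h1 : ∀ q, ∑ d, (c.moveLaw M).real {y | y.1 = d} * f (q - c.1 - d) - f (q - c.1) =
        M.tauEmpty * (if q - c.1 = 0 then (N : ℝ) else 0) - M.tauEmpty := fun q => by
      rw [← h.poisson, Config.moveLaw, if_pos h0]; rfl
    simp only [h1]
    simp only [Config.served, Config.moveLaw, if_pos h0]
    have h2 : ∀ q, c.lengths q * (N * (M.tau + ε) * (M.rate * ∫ y, (y.2 : ℝ) ∂M.moveEmpty) -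
        0 * (g (q - c.1) + ε) + (M.tauEmpty * (if q - c.1 = 0 then (N : ℝ) else 0) - M.tauEmpty)) =
        -(M.tauEmpty * (1 - N * M.rate * M.tau - N * M.rate * ε)) * c.lengths q := fun q => by
      have : c.lengths q * (M.tauEmpty * (if q - c.1 = 0 then (N : ℝ) else 0)) = 0 := by
        split_ifs with hq
        · rw [sub_eq_zero.1 hq, hz, zero_mul]
        · simp
      rw [mul_add, mul_sub (c.lengths q) (M.tauEmpty * _), this]
      simp only [Model.tauEmpty]
      ring
    simp only [h2, ← Finset.mul_sum]
    simp only [driftEmpty, Config.total, Model.tauEmpty, Model.tauEmpty2]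
    ring
  · have h1 : ∀ q, ∑ d, (c.moveLaw M).real {y | y.1 = d} * f (q - c.1 - d) - f (q - c.1) =
        g (q - c.1) - M.tau := fun q => by
      rw [h.kernel, Config.moveLaw, if_neg h0, add_sub_cancel_left]; rfl
    have hf0' : ∑ d, (c.moveLaw M).real {y | y.1 = d} * f (-d) = g 0 - M.tau + f 0 := by
      rw [← hf0, Config.moveLaw, if_neg h0]; rfl
    simp only [h1, hf0']
    simp only [Config.served, Config.moveLaw, if_neg h0]
    have h2 : ∀ q, c.lengths q * (N * (M.tau + ε) * (M.rate * ∫ y, (y.2 : ℝ) ∂M.move) -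
        1 * (g (q - c.1) + ε) + (g (q - c.1) - M.tau)) =
        -((1 - N * M.rate * M.tau) * (M.tau + ε)) * c.lengths q := fun q => by
      simp only [Model.tau]
      ring
    simp only [h2, ← Finset.mul_sum]
    simp only [driftBusy, Config.total, Model.tau, Model.tau2]
    ring

/-- The potential is bounded below by a quadratic function of the number of customers as soon as
`ε > 0`, because `g - τ` is positive semidefinite. -/
lemma le_potential (h : IsPotential M f g) {ε : ℝ} (hε : 0 < ε) (c : Config N) :
    ε / 2 * (c.total - (∑ s, |f s|) / ε) ^ 2 ≤
      potential f (fun s => g s + ε) c.1 c.lengths + (∑ s, |f s|) ^ 2 / (2 * ε) := by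
  set C := ∑ s, |f s| with hC
  have hlen : ∀ q, 0 ≤ c.lengths q := fun q => Nat.cast_nonneg _
  have h1 : ∑ q, ∑ q', (g (q' - q) + ε) * (c.lengths q * c.lengths q') =
      ∑ q, ∑ q', (g (q' - q) - M.tau) * (c.lengths q * c.lengths q') +
        (M.tau + ε) * c.total ^ 2 := by
    rw [Config.total, sq, Finset.sum_mul_sum]
    simp only [Finset.mul_sum, ← Finset.sum_add_distrib]
    refine Finset.sum_congr rfl fun q _ => Finset.sum_congr rfl fun q' _ => ?_
    ring
  have h2 : -(C * c.total) ≤ ∑ q, f (q - c.1) * c.lengths q := by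
    rw [Config.total, Finset.mul_sum, ← Finset.sum_neg_distrib]
    refine Finset.sum_le_sum fun q _ => ?_
    have hf : |f (q - c.1)| ≤ C := Finset.single_le_sum (f := fun s => |f s|)
      (fun _ _ => abs_nonneg _) (Finset.mem_univ _)
    have := (abs_le.1 hf).1
    nlinarith [hlen q]
  have h3 := h.posSemidef c.lengths
  have h4 : 0 ≤ M.tau * c.total ^ 2 := mul_nonneg M.tau_nonneg (sq_nonneg _)
  have h5 : ε / 2 * (c.total - C / ε) ^ 2 =
      ε * c.total ^ 2 / 2 - C * c.total + C ^ 2 / (2 * ε) := by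
    field_simp
    ring
  rw [h5, potential, h1]
  linarith

variable {Ω : Type*} [MeasurableSpace Ω] {Pr : Measure Ω} [IsProbabilityMeasure Pr]
  {z : Ω → State N} {x : Ω → Innovation N}

namespace IsStationaryStep

omit [NeZero N] [IsProbabilityMeasure Pr] in
lemma measurable_config (hz : IsStationaryStep M Pr z x) :
    Measurable fun ω => (z ω).config := Polling.measurable_config.comp hz.measurable_state

omit [NeZero N] [IsProbabilityMeasure Pr] in
lemma indep_config (hz : IsStationaryStep M Pr z x) :
    IndepFun (fun ω => (z ω).config) x Pr :=
  hz.indep.comp Polling.measurable_config measurable_id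

omit [IsProbabilityMeasure Pr] in
lemma identDistrib_config (hz : IsStationaryStep M Pr z x) (φ : Config N → ℝ) :
    IdentDistrib (fun ω => φ (step (z ω) (x ω)).config) (fun ω => φ (z ω).config) Pr Pr :=
  hz.identDistrib.comp ((measurable_of_countable φ).comp Polling.measurable_config)

lemma integrable_served (hz : IsStationaryStep M Pr z x) :
    Integrable (fun ω => (z ω).config.served) Pr :=
  Integrable.of_bound ((measurable_of_countable Config.served).comp
    hz.measurable_config).aestronglyMeasurable 1 (Filter.Eventually.of_forall fun ω => by
      rw [Real.norm_eq_abs, abs_le]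
      have := (z ω).config.served_mem
      constructor <;> linarith)

end IsStationaryStep

lemma hasMean_meanDuration (hM : FiniteMoments M) (c : Config N) :
    HasMean M.innovationLaw (fun x => ((c.moveOf x).1.2 : ℝ)) (c.meanDuration M) :=
  HasMean.comp (F := fun y : Move N => (y.1.2 : ℝ)) (measurePreserving_moveOf M c)
    (hasMean_duration (M := M) (integrable_duration_of_sq (hM.moveLaw c)))

lemma hasMean_sum_arr (hM : FiniteMoments M) (c : Config N) :
    HasMean M.innovationLaw (fun x => ∑ q, arr q (c.moveOf x))
      (N * M.rate * c.meanDuration M) :=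
  ((HasMean.sum Finset.univ fun q _ => hasMean_arr (M := M) (integrable_natCast_of_sq hM.batch)
    (integrable_duration_of_sq (hM.moveLaw c)) q).comp (measurePreserving_moveOf M c)).congr
    (fun _ => rfl) (by simp [Config.meanDuration, ZMod.card, mul_assoc])

omit [NeZero N] in
lemma meanDuration_eq (c : Config N) :
    c.meanDuration M = M.tauEmpty + (M.tau - M.tauEmpty) * c.served := by
  unfold Config.meanDuration Config.moveLaw Config.served
  split_ifs
  · simp [Model.tauEmpty]
  · simp [Model.tau]

lemma measurable_move : Measurable fun p : Config N × Innovation N => p.1.moveOf p.2 :=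
  measurable_from_prod_countable_right fun c => measurable_moveOf c

/-- Balance of the number of customers: over one step, as many arrive as are served, in the
mean. -/
lemma flow_balance (hM : FiniteMoments M) (hz : IsStationaryStep M Pr z x) :
    N * M.rate * (M.tauEmpty + (M.tau - M.tauEmpty) * ∫ ω, (z ω).config.served ∂Pr) =
      ∫ ω, (z ω).config.served ∂Pr := by
  have hΨ : Measurable fun p : Config N × Innovation N =>
      ∑ q, arr q (p.1.moveOf p.2) - p.1.served :=
    (Finset.measurable_fun_sum _ fun q _ => (measurable_arr q).comp
      measurable_move).sub
      ((measurable_of_countable Config.served).comp measurable_fst)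
  have hint : Integrable (fun ω => ∑ q, arr q ((z ω).config.moveOf (x ω)) - (z ω).config.served)
      Pr := by
    refine integrable_of_indep (k := fun _ => 1) (R := arrBound) hz.measurable_config
      hz.measurable_innovation hz.indep_config hz.innovation_law hΨ measurable_const
      (fun c y => ?_) (integrable_const _) (integrable_arrBound hM.batch hM.move hM.moveEmpty)
    have h1 := one_le_sum_arr (c.moveOf y)
    have h2 := arr_bound_le c y
    have h3 := c.served_mem
    rw [abs_le, one_mul]
    constructor <;> nlinarith
  have h1 := integral_of_indep (D := fun c => N * M.rate * c.meanDuration M - c.served)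
    hz.measurable_config hz.measurable_innovation hz.indep_config hz.innovation_law hΨ
    (fun c => (hasMean_sum_arr hM c).sub (HasMean.const c.served)) hint
  have h2 := integral_sub_eq_zero (hz.identDistrib_config Config.total) (by
    simpa only [total_step, add_sub_cancel_left] using hint)
  simp only [total_step, add_sub_cancel_left] at h2
  simp only [h2, meanDuration_eq] at h1
  have h3 := (((HasMean.const (μ := Pr) M.tauEmpty).add
    ((HasMean.of_integrable hz.integrable_served).const_mul (M.tau - M.tauEmpty))).const_mul
    (N * M.rate)).sub (HasMean.of_integrable hz.integrable_served)
  have := h3.2.symm.trans h1.2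
  linarith

/-- The polled queue cannot be non-empty almost surely: the generating function of the number of
customers would satisfy `E s ^ Q = E s ^ Q * E s ^ A / s`, where the number `A` of arrivals vanishes
with positive probability. -/
lemma integral_served_ne_one (hz : IsStationaryStep M Pr z x) :
    ∫ ω, (z ω).config.served ∂Pr ≠ 1 := by
  intro hone
  have hserved : ∀ᵐ ω ∂Pr, (z ω).config.served = 1 := by
    have h0 : ∫ ω, (1 - (z ω).config.served) ∂Pr = 0 := by
      rw [integral_sub (integrable_const _) hz.integrable_served, hone]; simp
    rw [integral_eq_zero_iff_of_nonneg (fun ω => sub_nonneg.2 (z ω).config.served_mem.2)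
      ((integrable_const _).sub hz.integrable_served)] at h0
    filter_upwards [h0] with ω hω
    simp only [Pi.zero_apply] at hω
    linarith
  let A : Innovation N → ℝ := fun y => ∑ q, arr q (y.1, y.2.2)
  have hA : Measurable A := Finset.measurable_fun_sum _ fun q _ =>
    (measurable_arr q).comp (measurePreserving_busyMove M).measurable
  have hA0 : ∀ y, 0 ≤ A y := fun y => Finset.sum_nonneg fun q _ => arr_nonneg q _
  have hpow : ∀ s : ℝ, Measurable fun t : ℝ => s ^ t := fun s => by fun_prop
  have hstep : ∀ᵐ ω ∂Pr, (step (z ω) (x ω)).config.total = (z ω).config.total + (A (x ω) - 1) := by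
    filter_upwards [hserved] with ω hω
    rw [total_step, hω]
    have : (z ω).config.moveOf (x ω) = ((x ω).1, (x ω).2.2) := by
      unfold Config.moveOf
      rw [if_neg]
      intro h0
      simp [Config.served, h0] at hω
    rw [this]
  -- The chain being stationary, the generating function of the number of arrivals is the identity.
  have hgen : ∀ s : ℝ, 0 < s → s < 1 → ∫ ω, s ^ A (x ω) ∂Pr = s := by
    intro s hs hs1
    have hle : ∀ t : ℝ, 0 ≤ t → ‖s ^ t‖ ≤ 1 := fun t ht => by
      rw [Real.norm_of_nonneg (Real.rpow_nonneg hs.le _)]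
      exact Real.rpow_le_one hs.le hs1.le ht
    have i1 : Integrable (fun ω => s ^ (z ω).config.total) Pr :=
      Integrable.of_bound (((hpow s).comp (measurable_of_countable _)).comp
        hz.measurable_config).aestronglyMeasurable 1
        (Filter.Eventually.of_forall fun ω => hle _ (z ω).config.total_nonneg)
    have e1 := ((hz.identDistrib_config Config.total).comp (hpow s)).integral_eq
    simp only [Function.comp_def] at e1
    have e2 : ∫ ω, s ^ (step (z ω) (x ω)).config.total ∂Pr =
        (∫ ω, s ^ (z ω).config.total ∂Pr) * (∫ ω, s ^ A (x ω) ∂Pr) * s⁻¹ := by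
      have hind : IndepFun (fun ω => s ^ (z ω).config.total) (fun ω => s ^ A (x ω)) Pr :=
        hz.indep_config.comp (φ := fun c : Config N => s ^ c.total) (ψ := fun y => s ^ A y)
          (measurable_of_countable _) ((hpow s).comp hA)
      have := hind.integral_fun_mul_eq_mul_integral i1.1
        (((hpow s).comp hA).comp hz.measurable_innovation).aestronglyMeasurable
      rw [← this, ← integral_mul_const]
      refine integral_congr_ae ?_
      filter_upwards [hstep] with ω hω
      rw [hω, Real.rpow_add hs, Real.rpow_sub hs, Real.rpow_one]
      ring
    have hpos : 0 < ∫ ω, s ^ (z ω).config.total ∂Pr := by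
      rw [integral_pos_iff_support_of_nonneg (fun ω => Real.rpow_nonneg hs.le _) i1]
      have : (Function.support fun ω => s ^ (z ω).config.total) = Set.univ :=
        Set.eq_univ_of_forall fun ω => (Real.rpow_pos_of_pos hs _).ne'
      rw [this, measure_univ]
      exact one_pos
    rw [e2] at e1
    field_simp at e1
    linarith
  set p := Pr.real {ω | A (x ω) = 0} with hp
  have hms : MeasurableSet {ω | A (x ω) = 0} :=
    (hA.comp hz.measurable_innovation) (measurableSet_singleton 0)
  have hp0 : 0 < p := by
    rw [hp, Measure.real, ENNReal.toReal_pos_iff]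
    refine ⟨?_, measure_lt_top _ _⟩
    have e1 : Pr {ω | A (x ω) = 0} = M.innovationLaw {y | A y = 0} := by
      rw [← hz.innovation_law]
      exact (Measure.map_apply hz.measurable_innovation (hA (measurableSet_singleton 0))).symm
    have e2 : {y : Innovation N | A y = 0} =
        (fun y : Innovation N => (y.1, y.2.2)) ⁻¹' {y | ∀ q, arr q y = 0} := by
      ext y
      simp only [A, Set.mem_ofPred_eq, Set.mem_preimage]
      rw [Finset.sum_eq_zero_iff_of_nonneg fun q _ => arr_nonneg q _]
      simp
    have hms' : MeasurableSet {y : Move N | ∀ q, arr q y = 0} := by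
      simp only [Set.ofPred_forall]
      exact MeasurableSet.iInter fun q => measurable_arr q (measurableSet_singleton 0)
    rw [e1, e2, (measurePreserving_busyMove M).measure_preimage hms'.nullMeasurableSet]
    exact pos_iff_ne_zero.2 measure_no_arrival_ne_zero
  have hp1 : p ≤ 1 := measureReal_le_one
  -- That function is at least `p`, which contradicts its value at `p / 2`.
  have hs := hgen (p / 2) (by linarith) (by linarith)
  have hle : p ≤ ∫ ω, (p / 2) ^ A (x ω) ∂Pr := by
    refine (integral_indicator_one hms).symm.le.trans ?_
    refine integral_mono ((integrable_const (1 : ℝ)).indicator hms) ?_ fun ω => ?_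
    · refine Integrable.of_bound
        (((hpow _).comp hA).comp hz.measurable_innovation).aestronglyMeasurable 1
        (Filter.Eventually.of_forall fun ω => ?_)
      rw [Real.norm_of_nonneg (by positivity)]
      exact Real.rpow_le_one (by linarith) (by linarith) (hA0 _)
    · simp only [Set.indicator_apply, Set.mem_ofPred_eq]
      split_ifs with h0
      · rw [h0]; simp
      · positivity
  linarith

/-- Stability: the load is less than `1`, and a polled queue is non-empty with positive
probability. -/
lemma stability (hM : FiniteMoments M) (hrate : 0 < M.rate) (hτ : 0 < M.tauEmpty)
    (hz : IsStationaryStep M Pr z x) :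
    N * M.rate * M.tau < 1 ∧ 0 < ∫ ω, (z ω).config.served ∂Pr := by
  have hbal := flow_balance hM hz
  set α := ∫ ω, (z ω).config.served ∂Pr with hα
  have h1 : α ≤ 1 := by
    have := integral_mono hz.integrable_served (integrable_const (1 : ℝ))
      fun ω => (z ω).config.served_mem.2
    simpa using this
  have h1' : α < 1 := lt_of_le_of_ne h1 (integral_served_ne_one hz)
  have h0 : 0 ≤ α := integral_nonneg fun ω => (z ω).config.served_mem.1
  have hN : (0 : ℝ) < N := Nat.cast_pos.2 (NeZero.pos N)
  have hpos : 0 < N * M.rate * M.tauEmpty * (1 - α) :=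
    mul_pos (by positivity) (by linarith)
  have hbal' : α * (1 - N * M.rate * M.tau) = N * M.rate * M.tauEmpty * (1 - α) := by
    linear_combination -hbal
  rw [← hbal'] at hpos
  have := (pos_and_pos_or_neg_and_neg_of_mul_pos hpos).resolve_right
    fun h => absurd h.1 (not_lt.2 h0)
  exact ⟨by linarith [this.2], this.1⟩

end Chain

/-! ### Finite mean queue lengths and the balance of the potential -/

section Lyapunov

variable {N : ℕ} [NeZero N] {M : Model N} {f g : ZMod N → ℝ}
  {Ω : Type*} [MeasurableSpace Ω] {Pr : Measure Ω} [IsProbabilityMeasure Pr]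
  {z : Ω → State N} {x : Ω → Innovation N}

omit [IsProbabilityMeasure Pr] in
lemma integrable_of_setIntegral_sublevel_le {X Y : Ω → ℝ} (hX : Measurable X) (hY0 : ∀ ω, 0 ≤ Y ω)
    (K : ℝ) (hint : ∀ n : ℕ, IntegrableOn Y {ω | X ω ≤ n} Pr)
    (h : ∀ n : ℕ, ∫ ω in {ω | X ω ≤ n}, Y ω ∂Pr ≤ K) : Integrable Y Pr := by
  have hcover : AECover Pr Filter.atTop fun n : ℕ => {ω | X ω ≤ n} :=
    { ae_eventually_mem := Filter.Eventually.of_forall fun ω => by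
        obtain ⟨n₀, hn₀⟩ := exists_nat_ge (X ω)
        filter_upwards [Filter.eventually_ge_atTop n₀] with n hn
        exact hn₀.trans (Nat.cast_le.2 hn)
      measurableSet := fun n => measurableSet_le hX measurable_const }
  exact hcover.integrable_of_integral_bounded_of_nonneg_ae K hint
    (Filter.Eventually.of_forall hY0) (Filter.Eventually.of_forall h)

/-- The mean number of customers is finite. The Lyapunov function is the potential whose kernel is
increased by a small `ε`, which makes it coercive while its drift stays negative. -/
lemma integrable_total (hM : FiniteMoments M) (h : IsPotential M f g) (hτ : 0 < M.tauEmpty)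
    (hρ : N * M.rate * M.tau < 1) (hz : IsStationaryStep M Pr z x) :
    Integrable (fun ω => (z ω).config.total) Pr := by
  have hNr : 0 ≤ N * M.rate := mul_nonneg (Nat.cast_nonneg _) M.rate_nonneg
  set ρ := N * M.rate * M.tau with hρdef
  -- With `ε` added to the kernel, the drift at an empty queue is still negative.
  obtain ⟨ε, hε, hεle⟩ : ∃ ε, 0 < ε ∧ N * M.rate * ε ≤ (1 - ρ) / 2 := by
    refine ⟨(1 - ρ) / 2 / (N * M.rate + 1), div_pos (by linarith) (by linarith), ?_⟩
    rw [mul_div_assoc', div_le_iff₀ (by linarith)]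
    nlinarith
  set δ := min ((1 - ρ) * ε) (M.tauEmpty * ((1 - ρ) / 2)) with hδ
  have hδ0 : 0 < δ := lt_min (mul_pos (by linarith) hε) (mul_pos hτ (by linarith))
  set K := |driftEmpty M g ε| + |driftBusy M f g ε| with hK
  have hK0 : 0 ≤ K := add_nonneg (abs_nonneg _) (abs_nonneg _)
  set D : Config N → ℝ := fun c => if c.2 c.1 = 0 then
        -(M.tauEmpty * (1 - ρ - N * M.rate * ε)) * c.total + driftEmpty M g ε
      else -((1 - ρ) * (M.tau + ε)) * c.total + driftBusy M f g ε with hD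
  have hDle : ∀ c, D c ≤ K - δ * c.total := by
    intro c
    have hc := c.total_nonneg
    have k0 := le_abs_self (driftEmpty M g ε)
    have k1 := le_abs_self (driftBusy M f g ε)
    have k2 := abs_nonneg (driftEmpty M g ε)
    have k3 := abs_nonneg (driftBusy M f g ε)
    simp only [hD]
    split_ifs
    · have : δ ≤ M.tauEmpty * (1 - ρ - N * M.rate * ε) :=
        (min_le_right _ _).trans (mul_le_mul_of_nonneg_left (by linarith) hτ.le)
      have := mul_le_mul_of_nonneg_right this hc
      linarith
    · have : δ ≤ (1 - ρ) * (M.tau + ε) :=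
        (min_le_left _ _).trans (mul_le_mul_of_nonneg_left (by linarith [M.tau_nonneg])
          (by linarith))
      have := mul_le_mul_of_nonneg_right this hc
      linarith
  have hg : ∀ s, g (-s) + ε = g s + ε := fun s => by rw [h.even]
  set C := ∑ s, |f s| with hC
  -- The additive constant, suggested by `le_potential`, makes the Lyapunov function nonnegative.
  set V : Config N → ℝ := fun c =>
    potential f (fun s => g s + ε) c.1 c.lengths + C ^ 2 / (2 * ε) with hV
  have hVle : ∀ c, ε / 2 * (c.total - C / ε) ^ 2 ≤ V c := fun c => le_potential h hε c
  have hV0 : ∀ c, 0 ≤ V c := fun c => le_trans (by positivity) (hVle c)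
  have hVm : Measurable fun ω => V (z ω).config :=
    (measurable_of_countable V).comp hz.measurable_config
  have hΔ : ∀ ω, V (step (z ω) (x ω)).config - V (z ω).config =
      (z ω).config.potentialIncrement f (fun s => g s + ε) (x ω) := fun ω => by
    rw [← potential_step]
    simp only [hV]
    ring
  -- The sublevel sets of the Lyapunov function contain boundedly many customers.
  have hbd : ∀ (m : ℝ) c, V c ≤ m → c.total ≤ C / ε + 1 + 2 * m / ε := by
    intro m c hm
    have h1 := (hVle c).trans hm
    have h2 : (c.total - C / ε) ^ 2 ≤ 2 * m / ε := by
      rw [le_div_iff₀ hε]; nlinarith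
    nlinarith [sq_nonneg (c.total - C / ε - 1)]
  set k₀ := (∑ s, |f s| + ∑ s, |g s + ε|) * ((N : ℝ) ^ 2 + N + 2) with hk₀
  have hk₀0 : 0 ≤ k₀ := mul_nonneg (add_nonneg (Finset.sum_nonneg fun _ _ => abs_nonneg _)
    (Finset.sum_nonneg fun _ _ => abs_nonneg _)) (by positivity)
  refine integrable_of_setIntegral_sublevel_le hVm (fun ω => (z ω).config.total_nonneg) (K / δ)
    (fun n => ?_) (fun n => ?_)
  · refine Measure.integrableOn_of_bounded (M := C / ε + 1 + 2 * n / ε) (measure_ne_top _ _)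
      ((measurable_of_countable Config.total).comp hz.measurable_config).aestronglyMeasurable ?_
    rw [ae_restrict_iff' (measurableSet_le hVm measurable_const)]
    refine Filter.Eventually.of_forall fun ω hω => ?_
    rw [Real.norm_of_nonneg (Config.total_nonneg _)]
    exact hbd n _ hω
  · -- The drift inequality is integrated on the sublevel set `B` of the Lyapunov function.
    set B : Set (Config N) := {c | V c ≤ n} with hB
    have hBm : MeasurableSet {ω | V (z ω).config ≤ n} := measurableSet_le hVm measurable_const
    set Ψ : Config N × Innovation N → ℝ := fun p =>
      B.indicator 1 p.1 * p.1.potentialIncrement f (fun s => g s + ε) p.2 with hΨ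
    have hΨm : Measurable Ψ := ((measurable_of_countable (B.indicator 1)).comp measurable_fst).mul
      (measurable_potentialIncrement _ _)
    have hΨi : Integrable (fun ω => Ψ ((z ω).config, x ω)) Pr := by
      refine integrable_of_indep (k := fun c => B.indicator 1 c * (k₀ * (1 + c.total)))
        (R := arrBound) hz.measurable_config hz.measurable_innovation hz.indep_config
        hz.innovation_law hΨm (measurable_of_countable _) (fun c y => ?_) ?_
        (integrable_arrBound hM.batch hM.move hM.moveEmpty)
      · simp only [hΨ, Set.indicator_apply]
        split_ifs
        · simpa using abs_potentialIncrement_le hg c y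
        · simp
      · refine Integrable.of_bound ((measurable_of_countable
          fun c => B.indicator 1 c * (k₀ * (1 + c.total))).comp
          hz.measurable_config).aestronglyMeasurable (k₀ * (1 + (C / ε + 1 + 2 * n / ε)))
          (Filter.Eventually.of_forall fun ω => ?_)
        have hn : (0 : ℝ) ≤ n := Nat.cast_nonneg n
        have hC0 : 0 ≤ C := Finset.sum_nonneg fun _ _ => abs_nonneg _
        have ht := (z ω).config.total_nonneg
        simp only [Set.indicator_apply]
        split_ifs with hc
        · rw [Pi.one_apply, one_mul, Real.norm_of_nonneg (mul_nonneg hk₀0 (by linarith))]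
          exact mul_le_mul_of_nonneg_left (by linarith [hbd n _ hc]) hk₀0
        · rw [zero_mul, norm_zero]
          positivity
    have hmean := integral_of_indep (D := fun c => B.indicator 1 c * D c) hz.measurable_config
      hz.measurable_innovation hz.indep_config hz.innovation_law hΨm
      (fun c => (hasMean_potentialIncrement hM h ε c).const_mul (B.indicator 1 c)) hΨi
    have hind : ∀ F : Config N → ℝ, ∀ ω, B.indicator 1 (z ω).config * F (z ω).config =
        {ω | V (z ω).config ≤ n}.indicator (fun ω => F (z ω).config) ω := fun F ω => by
      simp only [Set.indicator_apply, hB, Set.mem_ofPred_eq]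
      split_ifs <;> simp
    have hΨind : (fun ω => Ψ ((z ω).config, x ω)) = {ω | V (z ω).config ≤ n}.indicator
        (fun ω => V (step (z ω) (x ω)).config - V (z ω).config) := by
      ext ω
      simp only [hΨ, hΔ, Set.indicator_apply, hB, Set.mem_ofPred_eq]
      split_ifs <;> simp
    have hnonneg := setIntegral_sub_nonneg (hz.identDistrib_config V) hVm (fun ω => hV0 _)
      (fun ω => hV0 _) n (by
        rw [← integrable_indicator_iff hBm, ← hΨind]
        exact hΨi)
    rw [← integral_indicator hBm, ← hΨind, ← hmean.2] at hnonneg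
    have hDi := hmean.1
    simp only [hind] at hnonneg hDi
    rw [integral_indicator hBm] at hnonneg
    rw [integrable_indicator_iff hBm] at hDi
    have hTi : IntegrableOn (fun ω => (z ω).config.total) {ω | V (z ω).config ≤ n} Pr := by
      refine Measure.integrableOn_of_bounded (M := C / ε + 1 + 2 * n / ε) (measure_ne_top _ _)
        ((measurable_of_countable Config.total).comp hz.measurable_config).aestronglyMeasurable ?_
      rw [ae_restrict_iff' hBm]
      refine Filter.Eventually.of_forall fun ω hω => ?_
      rw [Real.norm_of_nonneg (Config.total_nonneg _)]
      exact hbd n _ hω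
    have hle : ∫ ω in {ω | V (z ω).config ≤ n}, D (z ω).config ∂Pr ≤
        ∫ ω in {ω | V (z ω).config ≤ n}, (K - δ * (z ω).config.total) ∂Pr :=
      setIntegral_mono hDi ((integrable_const K).sub (hTi.const_mul δ)) fun ω => hDle _
    rw [integral_sub (integrable_const K) (hTi.const_mul δ), integral_const_mul,
      setIntegral_const, smul_eq_mul] at hle
    have hKle : Pr.real {ω | V (z ω).config ≤ n} * K ≤ K :=
      mul_le_of_le_one_left hK0 measureReal_le_one
    rw [le_div_iff₀ hδ0]
    linarith

/-- Exact balance of the potential, which determines the mean number of customers at a polling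
instant, weighted by the mean duration of the step that follows. -/
lemma potential_balance (hM : FiniteMoments M) (h : IsPotential M f g)
    (hz : IsStationaryStep M Pr z x) (hT : Integrable (fun ω => (z ω).config.total) Pr) :
    Integrable (fun ω => (z ω).config.meanDuration M * (z ω).config.total) Pr ∧
    (1 - N * M.rate * M.tau) * ∫ ω, (z ω).config.meanDuration M * (z ω).config.total ∂Pr =
      driftEmpty M g 0 + (driftBusy M f g 0 - driftEmpty M g 0) *
        ∫ ω, (z ω).config.served ∂Pr := by
  have hint1 : Integrable (fun ω => (z ω).config.meanDuration M * (z ω).config.total) Pr := by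
    refine hT.bdd_mul (c := |M.tauEmpty| + |M.tau|)
      ((measurable_of_countable (Config.meanDuration M)).comp
        hz.measurable_config).aestronglyMeasurable (Filter.Eventually.of_forall fun ω => ?_)
    rw [meanDuration_eq]
    unfold Config.served
    have h1 := abs_nonneg M.tauEmpty
    have h2 := abs_nonneg M.tau
    rw [Real.norm_eq_abs]
    split_ifs
    · simp only [mul_zero, add_zero]; linarith
    · simp only [mul_one, add_sub_cancel]; linarith
  refine ⟨hint1, ?_⟩
  have hg : ∀ s, g (-s) + 0 = g s + 0 := fun s => by rw [h.even]
  have hint : Integrable (fun ω => (z ω).config.potentialIncrement f (fun s => g s + 0) (x ω))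
      Pr :=
    integrable_of_indep (k := fun c => (∑ s, |f s| + ∑ s, |g s + 0|) * (N ^ 2 + N + 2) *
      (1 + c.total)) (R := arrBound) hz.measurable_config hz.measurable_innovation hz.indep_config
      hz.innovation_law (measurable_potentialIncrement f fun s => g s + 0)
      (measurable_of_countable _) (fun c y => abs_potentialIncrement_le hg c y)
      (((integrable_const 1).add hT).const_mul _)
      (integrable_arrBound hM.batch hM.move hM.moveEmpty)
  have h1 := integral_of_indep hz.measurable_config hz.measurable_innovation hz.indep_config
    hz.innovation_law (measurable_potentialIncrement f fun s => g s + 0)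
    (fun c => hasMean_potentialIncrement hM h 0 c) hint
  have h2 := integral_sub_eq_zero (hz.identDistrib_config fun c =>
    potential f (fun s => g s + 0) c.1 c.lengths) (by simpa only [potential_step] using hint)
  simp only [potential_step] at h2
  rw [h2] at h1
  have h3 := (((HasMean.of_integrable hint1).const_mul (-(1 - N * M.rate * M.tau))).add
    (HasMean.const (driftEmpty M g 0))).add
    ((HasMean.of_integrable hz.integrable_served).const_mul
      (driftBusy M f g 0 - driftEmpty M g 0))
  have h4 := h3.2
  rw [integral_congr_ae (Filter.Eventually.of_forall fun ω => ?_), h1.2] at h4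
  · linarith
  · simp only [meanDuration_eq, Config.served]
    split_ifs <;> ring

end Lyapunov

/-! ### Ages and Little's formula -/

section Ages

variable {N : ℕ} [NeZero N] {M : Model N}

/-- Sum over all waiting customers of a function of the age. -/
noncomputable def State.ageSum (φ : ℝ → ℝ) (z : State N) : ℝ := ∑ q, ((z.2 q).map φ).sum

lemma sum_map_eq_sum_range (φ : ℝ → ℝ) (l : List ℝ) :
    (l.map φ).sum = ∑ i ∈ Finset.range l.length, φ (l.getD i 0) := by
  induction l with
  | nil => simp
  | cons a l ih =>
    rw [List.map_cons, List.sum_cons, List.length_cons, Finset.sum_range_succ', ih, add_comm]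
    rfl

lemma measurable_getD (i : ℕ) : Measurable fun l : List ℝ => l.getD i 0 :=
  (measurable_pi_apply i).comp (measurable_snd.comp
    (comap_measurable (fun l : List ℝ => (l.length, fun i : ℕ => l.getD i 0))))

lemma measurable_ageSum {φ : ℝ → ℝ} (hφ : Measurable φ) :
    Measurable (State.ageSum φ : State N → ℝ) := by
  have h : Measurable fun l : List ℝ => (l.map φ).sum := by
    simp only [sum_map_eq_sum_range]
    exact measurable_sum_range measurable_length fun i => hφ.comp (measurable_getD i)
  exact Finset.measurable_fun_sum _ fun q _ =>
    h.comp ((measurable_pi_apply q).comp measurable_snd)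

lemma measurable_waitingTime : Measurable (State.waitingTime : State N → ℝ) := by
  refine measurable_from_prod_countable_right fun i => ?_
  have h : ∀ l : List ℝ, l.headD 0 = l.getD 0 0 := fun l => by cases l <;> rfl
  simp only [State.waitingTime, h]
  exact (measurable_getD 0).comp (measurable_pi_apply i)

lemma sum_map_tail (φ : ℝ → ℝ) (h0 : φ 0 = 0) (l : List ℝ) :
    (l.tail.map φ).sum = (l.map φ).sum - φ (l.headD 0) := by
  cases l <;> simp [h0]

lemma sum_map_add (t : ℝ) (l : List ℝ) : (l.map fun age => age + t).sum = l.sum + l.length * t := by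
  induction l with
  | nil => simp
  | cons a l ih => simp only [List.map_cons, List.sum_cons, List.length_cons, ih]; push_cast; ring

/-- All customers get older by the duration of the move, except the one who is served. -/
lemma ageSum_id_step (z : State N) (x : Innovation N) :
    (step z x).ageSum id = z.ageSum id - z.waitingTime +
      (((z.config.moveOf x).1.2 : ℝ) * (z.config.total - z.config.served) +
        ∑ q, arrAge q (z.config.moveOf x)) := by
  set t : ℝ := ((z.config.moveOf x).1.2 : ℝ) with ht
  have h : ∀ q, (((step z x).2 q).map id).sum = ((z.2 q).map id).sum
      - (if q = z.1 then z.waitingTime else 0) +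
      (t * (z.config.lengths q - if q = z.1 then z.config.served else 0)
        + arrAge q (z.config.moveOf x)) := by
    intro q
    have harr : (arrivals (fun j => x.2.2 (q, j)) t).sum = arrAge q (z.config.moveOf x) :=
      sum_arrivals _ _
    rw [step_snd, List.map_id, List.map_id, List.sum_append, ← ht, harr, sum_map_add]
    by_cases hq : q = z.1
    · subst hq
      have hs := sum_map_tail id rfl (z.2 z.1)
      simp only [List.map_id, id] at hs
      have hl : ((z.2 z.1).tail.length : ℝ) = z.config.lengths z.1 - z.config.served := by
        have hlen : ∀ l : List ℝ,
            (l.tail.length : ℝ) = l.length - if l.length = 0 then (0 : ℝ) else 1 := fun l => by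
          cases l <;> simp
        simp only [Config.lengths, Config.served, State.config]
        rw [hlen]
        by_cases h0 : (z.2 z.1).length = 0 <;> simp only [h0, if_true, if_false]
      simp only [if_true]
      rw [hs, hl, State.waitingTime]
      ring
    · simp only [if_neg hq, Config.lengths, State.config]
      ring
  simp only [State.ageSum, h, Finset.sum_add_distrib, Finset.sum_sub_distrib, ← Finset.mul_sum,
    Finset.sum_ite_eq', Finset.mem_univ, if_true]
  rw [Config.total]

/-- The negative parts of the ages of the waiting customers can only decrease. -/
lemma ageSum_negPart_step_le (z : State N) (x : Innovation N) :
    (step z x).ageSum (fun a => max (-a) 0) ≤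
      z.ageSum (fun a => max (-a) 0) - max (-z.waitingTime) 0 := by
  set φ : ℝ → ℝ := fun a => max (-a) 0 with hφ
  have h : ∀ q, (((step z x).2 q).map φ).sum ≤ ((z.2 q).map φ).sum
      - (if q = z.1 then φ z.waitingTime else 0) := by
    intro q
    have harr : ((arrivals (fun j => x.2.2 (q, j)) ((z.config.moveOf x).1.2 : ℝ)).map φ).sum
        = 0 := by
      refine List.sum_eq_zero fun y hy => ?_
      obtain ⟨a, ha, rfl⟩ := List.mem_map.1 hy
      exact max_eq_right (neg_nonpos.2 (nonneg_of_mem_arrivals ha))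
    rw [step_snd, List.map_append, List.sum_append, harr, add_zero, List.map_map]
    have hmono : ∀ l : List ℝ, (l.map (φ ∘ fun age => age +
        ((z.config.moveOf x).1.2 : ℝ))).sum ≤ (l.map φ).sum := fun l =>
      List.sum_le_sum fun a _ => max_le_max_right 0
        (neg_le_neg (le_add_of_nonneg_right (NNReal.coe_nonneg _)))
    refine (hmono _).trans ?_
    by_cases hq : q = z.1
    · subst hq
      simp only [if_true]
      rw [sum_map_tail φ (by simp [hφ]), State.waitingTime]
    · simp [hq]
  refine (Finset.sum_le_sum fun q _ => h q).trans (le_of_eq ?_)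
  simp [Finset.sum_sub_distrib, State.ageSum, hφ]

lemma ageSum_posPart (z : State N) :
    z.ageSum (fun a => max a 0) = z.ageSum id + z.ageSum (fun a => max (-a) 0) := by
  simp only [State.ageSum, ← Finset.sum_add_distrib]
  refine Finset.sum_congr rfl fun q _ => ?_
  induction z.2 q with
  | nil => simp
  | cons a l ih =>
    simp only [List.map_cons, List.sum_cons, ih, id]
    have : max a 0 = a + max (-a) 0 := by
      rcases le_total a 0 with h | h
      · rw [max_eq_right h, max_eq_left (by linarith)]; ring
      · rw [max_eq_left h, max_eq_right (by linarith)]; ring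
    rw [this]
    ring

lemma ageSum_nonneg {φ : ℝ → ℝ} (hφ : ∀ a, 0 ≤ φ a) (z : State N) : 0 ≤ z.ageSum φ :=
  Finset.sum_nonneg fun q _ => List.sum_nonneg fun y hy => by
    obtain ⟨a, -, rfl⟩ := List.mem_map.1 hy
    exact hφ a

lemma waitingTime_le_ageSum (z : State N) :
    max z.waitingTime 0 ≤ z.ageSum (fun a => max a 0) := by
  refine le_trans ?_ (Finset.single_le_sum (f := fun q => ((z.2 q).map fun a => max a 0).sum)
    (fun q _ => List.sum_nonneg fun y hy => ?_) (Finset.mem_univ z.1))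
  · rw [State.waitingTime]
    cases z.2 z.1 with
    | nil => simp
    | cons a l =>
      simp only [List.headD_cons, List.map_cons, List.sum_cons]
      refine le_add_of_nonneg_right (List.sum_nonneg fun y hy => ?_)
      obtain ⟨a, -, rfl⟩ := List.mem_map.1 hy
      exact le_max_right _ _
  · obtain ⟨a, -, rfl⟩ := List.mem_map.1 hy
    exact le_max_right _ _

variable {Ω : Type*} [MeasurableSpace Ω] {Pr : Measure Ω} [IsProbabilityMeasure Pr]
  {z : Ω → State N} {x : Ω → Innovation N}

/-- Increase of the total age over one step, apart from the age of the served customer. -/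
noncomputable def agingOf (p : Config N × Innovation N) : ℝ :=
  ((p.1.moveOf p.2).1.2 : ℝ) * (p.1.total - p.1.served) + ∑ q, arrAge q (p.1.moveOf p.2)

lemma measurable_agingOf : Measurable (agingOf : Config N × Innovation N → ℝ) := by
  have h1 : Measurable fun p : Config N × Innovation N => ((p.1.moveOf p.2).1.2 : ℝ) :=
    measurable_coe_nnreal_real.comp (measurable_snd.comp (measurable_fst.comp measurable_move))
  exact (h1.mul ((measurable_of_countable fun c : Config N => c.total - c.served).comp
    measurable_fst)).add (Finset.measurable_fun_sum _ fun q _ =>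
      (measurable_arrAge q).comp measurable_move)

lemma hasMean_agingOf (hM : FiniteMoments M) (c : Config N) :
    HasMean M.innovationLaw (fun y => agingOf (c, y))
      (c.meanDuration M * (c.total - c.served) +
        N * M.rate / 2 * (M.tauEmpty2 + (M.tau2 - M.tauEmpty2) * c.served)) := by
  have h1 := HasMean.comp (measurePreserving_moveOf M c)
    (HasMean.sum Finset.univ fun q (_ : q ∈ Finset.univ) =>
      hasMean_arrAge (M := M) (integrable_natCast_of_sq hM.batch) (hM.moveLaw c) q)
  refine (((hasMean_meanDuration hM c).const_mul (c.total - c.served)).add h1).congr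
    (fun y => by simp only [agingOf]; ring) ?_
  have h2 : ∫ y, (y.2 : ℝ) ^ 2 ∂(c.moveLaw M) =
      M.tauEmpty2 + (M.tau2 - M.tauEmpty2) * c.served := by
    unfold Config.moveLaw Config.served
    split_ifs
    · simp [Model.tauEmpty2]
    · simp [Model.tau2]
  rw [h2]
  simp [ZMod.card]
  ring

lemma integrable_agingOf (hM : FiniteMoments M) (hz : IsStationaryStep M Pr z x)
    (hT : Integrable (fun ω => (z ω).config.total) Pr) :
    Integrable (fun ω => agingOf ((z ω).config, x ω)) Pr := by
  let R : Innovation N → ℝ := fun y =>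
    ((y.1.2 : ℝ) + ∑ q, arrAge q (y.1, y.2.2)) + ((y.2.1.2 : ℝ) + ∑ q, arrAge q y.2)
  have hagepos : ∀ y : Move N, 0 ≤ ∑ q, arrAge q y := fun y =>
    Finset.sum_nonneg fun q _ => arrAge_nonneg q y
  have hR : Integrable R M.innovationLaw := by
    have key : ∀ (κ : Measure (ZMod N × ℝ≥0)) [IsProbabilityMeasure κ],
        Integrable (fun y : ZMod N × ℝ≥0 => (y.2 : ℝ) ^ 2) κ →
        Integrable (fun y : Move N => (y.1.2 : ℝ) + ∑ q, arrAge q y) (κ.prod M.streamsLaw) :=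
      fun κ _ hκ => ((hasMean_duration (M := M) (integrable_duration_of_sq hκ)).add
        (HasMean.sum Finset.univ fun q _ =>
          hasMean_arrAge (M := M) (integrable_natCast_of_sq hM.batch) hκ q)).1
    exact ((measurePreserving_busyMove M).integrable_comp_of_integrable (key _ hM.move)).add
      ((measurePreserving_emptyMove M).integrable_comp_of_integrable (key _ hM.moveEmpty))
  refine integrable_of_indep (k := fun c => 1 + c.total) (R := R) hz.measurable_config
    hz.measurable_innovation hz.indep_config hz.innovation_law measurable_agingOf
    (measurable_of_countable _) (fun c y => ?_) ((integrable_const 1).add hT) hR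
  have hle : ((c.moveOf y).1.2 : ℝ) + ∑ q, arrAge q (c.moveOf y) ≤ R y := by
    simp only [R]
    unfold Config.moveOf
    split_ifs
    · exact le_add_of_nonneg_left (add_nonneg (NNReal.coe_nonneg _) (hagepos _))
    · exact le_add_of_nonneg_right (add_nonneg (NNReal.coe_nonneg _) (hagepos _))
  have ht := (c.moveOf y).1.2.coe_nonneg
  have ha := hagepos (c.moveOf y)
  have hc := c.total_nonneg
  have hs := c.served_mem
  refine le_trans ?_ (mul_le_mul_of_nonneg_left hle (by linarith))
  rw [agingOf, abs_le]
  have h1 := mul_nonneg ht hc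
  have h2 := mul_nonneg ha hc
  have h3 := mul_nonneg ht hs.1
  have h4 := mul_le_mul_of_nonneg_left hs.2 ht
  constructor <;> nlinarith

/-- Little's formula: the waiting time is integrable, and the mean waiting time is the time integral
of the number of waiting customers over a mean step. -/
lemma waitingTime_balance (hM : FiniteMoments M) (hz : IsStationaryStep M Pr z x)
    (hT : Integrable (fun ω => (z ω).config.total) Pr) :
    HasMean Pr (fun ω => (z ω).waitingTime)
      (∫ ω, (z ω).config.meanDuration M * (z ω).config.total ∂Pr
        - M.tau * ∫ ω, (z ω).config.served ∂Pr
        + N * M.rate / 2 * (M.tauEmpty2 + (M.tau2 - M.tauEmpty2) *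
          ∫ ω, (z ω).config.served ∂Pr)) := by
  set neg : ℝ → ℝ := fun a => max (-a) 0 with hneg
  set pos : ℝ → ℝ := fun a => max a 0 with hpos
  have hnegm : Measurable neg := by fun_prop
  have hposm : Measurable pos := by fun_prop
  have hdistr : ∀ {φ : ℝ → ℝ}, Measurable φ → IdentDistrib
      (fun ω => (step (z ω) (x ω)).ageSum φ) (fun ω => (z ω).ageSum φ) Pr Pr := fun hφ =>
    hz.identDistrib.comp (measurable_ageSum hφ)
  -- The initial law might charge negative ages, but their sum never increases, hence is constant,
  -- and the customers who are served have nonnegative ages.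
  have hconst : (fun ω => (step (z ω) (x ω)).ageSum neg) =ᵐ[Pr] fun ω => (z ω).ageSum neg :=
    ae_eq_of_le_of_identDistrib (hdistr hnegm) fun ω =>
      (ageSum_negPart_step_le (z ω) (x ω)).trans (sub_le_self _ (le_max_right _ _))
  have hWneg : ∀ᵐ ω ∂Pr, neg (z ω).waitingTime = 0 := by
    filter_upwards [hconst] with ω hω
    have h1 := ageSum_negPart_step_le (z ω) (x ω)
    have h2 : 0 ≤ neg (z ω).waitingTime := le_max_right _ _
    linarith
  have hWpos : ∀ᵐ ω ∂Pr, pos (z ω).waitingTime = (z ω).waitingTime := by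
    filter_upwards [hWneg] with ω hω
    have : -(z ω).waitingTime ≤ 0 := (le_max_left _ _).trans hω.le
    exact max_eq_left (by linarith)
  have hincr : ∀ᵐ ω ∂Pr, (step (z ω) (x ω)).ageSum pos - (z ω).ageSum pos =
      agingOf ((z ω).config, x ω) - pos (z ω).waitingTime := by
    filter_upwards [hconst, hWpos] with ω h1 h2
    rw [h2, ageSum_posPart, ageSum_posPart, h1, ageSum_id_step, agingOf]
    ring
  have hU := integrable_agingOf hM hz hT
  have hXm : Measurable fun ω => (z ω).ageSum pos :=
    (measurable_ageSum hposm).comp hz.measurable_state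
  have hYm : Measurable fun ω => pos (z ω).waitingTime :=
    hposm.comp (measurable_waitingTime.comp hz.measurable_state)
  have hY0 : ∀ ω, 0 ≤ pos (z ω).waitingTime := fun ω => le_max_right _ _
  have hYon : ∀ n : ℕ, IntegrableOn (fun ω => pos (z ω).waitingTime)
      {ω | (z ω).ageSum pos ≤ n} Pr := fun n => by
    refine Measure.integrableOn_of_bounded (M := n) (measure_ne_top _ _)
      hYm.aestronglyMeasurable ?_
    rw [ae_restrict_iff' (measurableSet_le hXm measurable_const)]
    refine Filter.Eventually.of_forall fun ω hω => ?_
    rw [Real.norm_of_nonneg (hY0 ω)]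
    exact (waitingTime_le_ageSum _).trans hω
  -- On a sublevel set of the total age, the mean age that leaves with the served customers does
  -- not exceed the mean increase of the other ages.
  have hYint : Integrable (fun ω => pos (z ω).waitingTime) Pr := by
    refine integrable_of_setIntegral_sublevel_le hXm hY0
      (∫ ω, |agingOf ((z ω).config, x ω)| ∂Pr) hYon fun n => ?_
    have hi : IntegrableOn (fun ω => (step (z ω) (x ω)).ageSum pos - (z ω).ageSum pos)
        {ω | (z ω).ageSum pos ≤ n} Pr :=
      (hU.integrableOn.sub (hYon n)).congr (ae_restrict_of_ae (hincr.mono fun _ h => h.symm))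
    have h1 := setIntegral_sub_nonneg (hdistr hposm) hXm
      (fun ω => ageSum_nonneg (fun a => le_max_right _ _) _)
      (fun ω => ageSum_nonneg (fun a => le_max_right _ _) _) n hi
    rw [integral_congr_ae (ae_restrict_of_ae hincr), integral_sub hU.integrableOn (hYon n)] at h1
    have h2 : ∫ ω in {ω | (z ω).ageSum pos ≤ n}, agingOf ((z ω).config, x ω) ∂Pr ≤
        ∫ ω, |agingOf ((z ω).config, x ω)| ∂Pr :=
      (setIntegral_mono hU.integrableOn hU.abs.integrableOn fun ω => le_abs_self _).trans
        (setIntegral_le_integral hU.abs (Filter.Eventually.of_forall fun _ => abs_nonneg _))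
    linarith
  have hmean := integral_of_indep hz.measurable_config hz.measurable_innovation hz.indep_config
    hz.innovation_law measurable_agingOf (fun c => hasMean_agingOf hM c) hU
  have hzero := integral_sub_eq_zero (hdistr hposm)
    ((hU.sub hYint).congr (hincr.mono fun _ h => h.symm))
  rw [integral_congr_ae hincr, integral_sub hU hYint, ← hmean.2] at hzero
  refine ⟨hYint.congr hWpos, ?_⟩
  rw [← integral_congr_ae hWpos]
  have hsplit : ∀ ω, (z ω).config.meanDuration M * ((z ω).config.total - (z ω).config.served) +
      N * M.rate / 2 * (M.tauEmpty2 + (M.tau2 - M.tauEmpty2) * (z ω).config.served) =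
      ((z ω).config.meanDuration M * (z ω).config.total - M.tau * (z ω).config.served) +
      N * M.rate / 2 * (M.tauEmpty2 + (M.tau2 - M.tauEmpty2) * (z ω).config.served) := fun ω => by
    rw [meanDuration_eq]
    unfold Config.served
    split_ifs <;> ring
  have hs := HasMean.of_integrable hz.integrable_served
  have hD := hmean.1
  simp only [hsplit] at hD hzero
  have htail := ((HasMean.const (μ := Pr) M.tauEmpty2).add
    (hs.const_mul (M.tau2 - M.tauEmpty2))).const_mul (N * M.rate / 2)
  have hX : Integrable (fun ω => (z ω).config.meanDuration M * (z ω).config.total) Pr := by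
    refine ((hD.sub htail.1).add (hs.1.const_mul M.tau)).congr
      (Filter.Eventually.of_forall fun ω => ?_)
    simp only [Pi.add_apply, Pi.sub_apply]
    ring
  have := (((HasMean.of_integrable hX).sub (hs.const_mul M.tau)).add htail).2
  linarith

end Ages

/-! ### The mean waiting time -/

section WaitingTime

variable {N : ℕ} [NeZero N] {M : Model N}

/-- The three balance equations, solved for the mean waiting time. Here `α` is the probability that
the polled queue is non-empty, `X` the mean of the product of the duration of a step with the number
of customers waiting at its start, and `W` the mean of the waiting time over all
polling instants, counted as `0` when nobody is served. The hypotheses are the balances of the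
number of customers, of the potential and of the total age. -/
lemma mean_waitingTime_eq {n r b b2 τ τ2 τ' τ2' f0 g0 α X W : ℝ} (hn : 0 < n) (hr : 0 < r)
    (hb : 0 < b) (hτ' : 0 < τ') (hρ : n * (r * b) * τ < 1) (hα : 0 < α)
    (hflow : n * (r * b) * (τ' + (τ - τ') * α) = α)
    (hX : (1 - n * (r * b) * τ) * X =
      (n * (n * τ) * ((r * b) ^ 2 * τ2') / 2 + n * g0 * (r * b2 * τ') / 2) +
      ((n * (n * τ) * ((r * b) ^ 2 * τ2) / 2 + n * g0 * (r * b2 * τ) / 2 - n * τ * (r * b * τ) +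
        g0 / 2 - (g0 - τ + f0)) -
      (n * (n * τ) * ((r * b) ^ 2 * τ2') / 2 + n * g0 * (r * b2 * τ') / 2)) * α)
    (hW : W = X - τ * α + n * (r * b) / 2 * (τ2' + (τ2 - τ2') * α)) :
    α⁻¹ * W = -f0 / (1 - n * (r * b) * τ) + n * (r * b) * τ2 / (2 * (1 - n * (r * b) * τ)) +
      τ2' / (2 * τ') + (b2 - b) / (2 * b) * (g0 / (1 - n * (r * b) * τ)) := by
  have h1 : 0 < 1 - n * (r * b) * τ := by linarith
  set D := 1 - n * (r * b) * τ with hD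
  have hβ : 1 - α = α * D / (n * (r * b) * τ') := by
    rw [eq_div_iff (by positivity), hD]
    linear_combination hflow
  have hDW : D * W = α * (n * (r * b) * τ2 / 2 + D * τ2' / (2 * τ') - f0 +
      (b2 - b) / (2 * b) * g0) := by
    have e1 : D * W = (1 - α) * (n * (r * b) * τ2' / 2 + n * g0 * (r * b2 * τ') / 2) +
        α * (n * (r * b) * τ2 / 2 + n * g0 * (r * b2 * τ) / 2 - g0 / 2 - f0) := by
      rw [hW, mul_add, mul_sub, hX, hD]
      ring
    rw [e1, hβ]
    field_simp
    rw [hD]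
    ring
  have : W = α * (n * (r * b) * τ2 / 2 + D * τ2' / (2 * τ') - f0 +
      (b2 - b) / (2 * b) * g0) / D := by
    rw [eq_div_iff h1.ne']; linarith
  rw [this]
  field_simp
  ring

omit [NeZero N] in
/-- Stationarity is stated in terms of push-forward measures; the states are almost
everywhere measurable because their push-forwards are not zero. -/
lemma IsStationaryRun.identDistrib {Ω : Type*} [MeasurableSpace Ω] {Pr : Measure Ω}
    [IsProbabilityMeasure Pr] {Z : ℕ → Ω → State N} {x : ℕ → Ω → Innovation N}
    (hZ : IsStationaryRun M Pr Z x) (n : ℕ) : IdentDistrib (Z n) (Z 0) Pr Pr := by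
  refine ⟨?_, hZ.measurable_init.aemeasurable, hZ.stationary n⟩
  -- The push-forward along a function that is not almost everywhere measurable is zero.
  by_contra hn
  have h := hZ.stationary n
  rw [Measure.map_of_not_aemeasurable hn] at h
  have := Measure.isProbabilityMeasure_map (μ := Pr) hZ.measurable_init.aemeasurable
  exact IsProbabilityMeasure.ne_zero _ h.symm

omit [NeZero N] in
lemma IsStationaryRun.isStationaryStep {Ω : Type*} [MeasurableSpace Ω] {Pr : Measure Ω}
    [IsProbabilityMeasure Pr] {Z : ℕ → Ω → State N} {x : ℕ → Ω → Innovation N}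
    (hZ : IsStationaryRun M Pr Z x) : IsStationaryStep M Pr (Z 0) (x 0) where
  measurable_state := hZ.measurable_init
  measurable_innovation := hZ.measurable_innovation 0
  innovation_law := hZ.innovation_law 0
  indep := hZ.init_indep.comp measurable_id (measurable_pi_apply 0)
  identDistrib := by
    have := hZ.identDistrib 1
    rwa [show Z 1 = fun ω => step (Z 0 ω) (x 0 ω) from funext fun ω => hZ.evolution 0 ω] at this

lemma measurableSet_serving : MeasurableSet {z : State N | z.Serving} := by
  have : {z : State N | z.Serving} = State.config ⁻¹' {c | c.2 c.1 ≠ 0} := by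
    ext z
    simp [State.Serving, State.config]
  rw [this]
  exact measurable_config (Set.to_countable _).measurableSet

end WaitingTime

end Polling

theorem mainTheorem2 {N : ℕ} [NeZero N] (M : Polling.Model N)
    (hb : 0 < M.b)
    (hb2 : Integrable (fun k : ℕ => (k : ℝ) ^ 2) M.batchLaw)
    (htau2 : Integrable (fun y : ZMod N × ℝ≥0 => (y.2 : ℝ) ^ 2) M.move)
    (htauEmpty : 0 < M.tauEmpty)
    (htauEmpty2 : Integrable (fun y : ZMod N × ℝ≥0 => (y.2 : ℝ) ^ 2) M.moveEmpty)
    (hirr : M.PEmpty.IsIrreducible)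
    (hmirror : (1 - M.P) * (1 - M.PEmpty).transpose = (1 - M.P).transpose * (1 - M.PEmpty))
    {Ω : Type*} [MeasurableSpace Ω] (Pr : Measure Ω) [IsProbabilityMeasure Pr]
    (Z : ℕ → Ω → Polling.State N) (x : ℕ → Ω → Polling.Innovation N)
    (hZ : Polling.IsStationaryRun M Pr Z x) (n : ℕ) :
    N * M.rate * M.tau < 1 ∧
    0 < Pr {ω | Polling.State.Serving (Z n ω)} ∧
    Integrable (fun ω => Polling.State.waitingTime (Z n ω)) (Polling.servedLaw Pr Z n) ∧
    ((∫ ω, Polling.State.waitingTime (Z n ω) ∂(Polling.servedLaw Pr Z n) : ℝ) : ℂ) =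
      M.tauEmpty / (1 - N * M.rate * M.tau) * ∑ l ∈ Finset.Ico 1 N, 1 / (1 - M.muEmpty l)
      + N * M.rate * M.tau2 / (2 * (1 - N * M.rate * M.tau))
      + M.tauEmpty2 / (2 * M.tauEmpty)
      + (M.b2 - M.b) / (2 * M.b) *
        ((M.tau + (N - 1) * M.tauEmpty) / (1 - N * M.rate * M.tau)
          - M.tauEmpty / (1 - N * M.rate * M.tau) *
            ∑ l ∈ Finset.Ico 1 N, (M.mu l - M.muEmpty l) / (1 - M.muEmpty l)) := by
  open Polling in
  have hM : FiniteMoments M := ⟨hb2, htau2, htauEmpty2⟩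
  have hz := hZ.isStationaryStep
  have hid := hZ.identDistrib n
  obtain ⟨hρ, hα⟩ := stability hM (mul_pos M.batchRate_pos hb) htauEmpty hz
  have hprob : ∀ κ : Measure (ZMod N × ℝ≥0), IsProbabilityMeasure κ →
      ∑ d, κ.real {y | y.1 = d} = 1 := fun κ _ => by
    have := (hasMean_displacement (M := M) (κ := κ) fun _ => 1).2
    simpa using this.symm
  obtain ⟨f, g, h1, h2, h3, h4, h5, hf0, hg0⟩ := exists_potential M.p M.pEmpty
    (fun _ => measureReal_nonneg) (hprob _ M.move_prob) (hprob _ M.moveEmpty_prob) hirr hmirror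
    M.tau M.tauEmpty htauEmpty.le
  have hpot : IsPotential M f g := ⟨h1, h2, h3, h4, h5⟩
  have hT := integrable_total hM hpot htauEmpty hρ hz
  have hW := waitingTime_balance hM hz hT
  have hX := (potential_balance hM hpot hz hT).2
  have hflow := flow_balance hM hz
  set α := ∫ ω, (Z 0 ω).config.served ∂Pr with hαdef
  have hserv : Pr {ω | State.Serving (Z n ω)} = ENNReal.ofReal α := by
    have e1 := hid.measure_mem_eq measurableSet_serving
    have e2 : (fun ω => (Z 0 ω).config.served) = (Z 0 ⁻¹' {z | z.Serving}).indicator 1 := by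
      ext ω
      by_cases h0 : (Z 0 ω).2 (Z 0 ω).1 = [] <;>
        simp [Config.served, State.config, State.Serving, h0]
    have e3 : α = Pr.real (Z 0 ⁻¹' {z | z.Serving}) := by
      rw [hαdef, e2, integral_indicator_one (hZ.measurable_init measurableSet_serving)]
    rw [e3, ofReal_measureReal]
    exact e1
  have hidW := hid.comp measurable_waitingTime
  have hWn : Integrable (fun ω => State.waitingTime (Z n ω)) Pr := hidW.integrable_iff.2 hW.1
  refine ⟨hρ, by rw [hserv]; exact ENNReal.ofReal_pos.2 hα, ?_, ?_⟩
  · exact hWn.restrict.smul_measure (ENNReal.inv_ne_top.2 (by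
      rw [hserv]; exact (ENNReal.ofReal_pos.2 hα).ne'))
  have hreal : ∫ ω, State.waitingTime (Z n ω) ∂(servedLaw Pr Z n) =
      α⁻¹ * ∫ ω, State.waitingTime (Z 0 ω) ∂Pr := by
    unfold servedLaw ProbabilityTheory.cond
    rw [integral_smul_measure, hserv, ENNReal.toReal_inv, ENNReal.toReal_ofReal hα.le,
      setIntegral_eq_integral_of_forall_compl_eq_zero, smul_eq_mul]
    · congr 1
      exact hidW.integral_eq
    · intro ω hω
      have : (Z n ω).2 (Z n ω).1 = [] := not_not.1 hω
      simp [State.waitingTime, this]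
  simp only [driftEmpty, driftBusy, add_zero] at hX
  have key := mean_waitingTime_eq (Nat.cast_pos.2 (NeZero.pos N)) M.batchRate_pos hb htauEmpty hρ
    hα hflow hX hW.2
  rw [hreal, key]
  push_cast
  rw [hf0, hg0]
  simp only [fourier_natCast]
  change _ = _ * ∑ l ∈ Finset.Ico 1 N, 1 / (1 - ∑ d : ZMod N, _) + _ + _ + _
  simp only [Model.rate, Model.mu, Model.muEmpty]
  push_cast
  ring
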